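/- **Setting.** Let $X$ be a locally compact metric space and $H_X$ an ample $X$-module: a separable Hilbert space with a non-degenerate $*$-homomorphism $\rho:C_0(X)\to B(H_X)$ such that $\rho(f)$ is not compact for $f\ne0$; write $f$ for $\rho(f)$. For $T\in B(H_X)$, $\mathrm{supp}(T)\subset X\times X$ is the complement of the set of all $(y,x)$ for which there are $f,g\in C_0(X)$ with $gTf=0$, $f(x)\neq0$, $g(y)\neq0$, and $\mathrm{prop}(T)=\sup\{d(x,y):(y,x)\in\mathrm{supp}(T)\}\in[0,\infty]$. The algebraic Roe algebra $C^*_{\mathrm{alg}}(X)$ consists of the $T\in B(H_X)$ with $\mathrm{prop}(T)<\infty$ and with $Tf$ and $fT$ compact for all $f\in C_0(X)$. The algebraic localization algebra $C^*_{L,\mathrm{alg}}(X)$ consists of the bounded uniformly continuous functions $f:[1,\infty)\to C^*_{\mathrm{alg}}(X)$ with $\mathrm{prop}(f(t))\to0$ as $t\to\infty$, and $A:=C^*_L(X)$ is its completion in the supremum norm. $A$ is filtered by $$A_r=\{f\in C^*_{L,\mathrm{alg}}(X):\sup_{t\in[1,\infty)}\mathrm{prop}(f(t))<r\}\qquad(r>0),$$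 or by the closures of these subspaces; the statement holds for both filtrations. **K-groups.** Let $\tilde A=A+\mathbb C$ be the unitization of $A$, and let $\rho_A:\tilde A\to\mathbb C$ be the projection onto the scalars. $K_0(\tilde A)$ is the Grothendieck group of the monoid of homotopy classes of projections in matrix algebras over $\tilde A$ under block sum, $K_0(A)=\ker(K_0(\tilde A)\to K_0(\mathbb C))$, and $K_1(A)=K_1(\tilde A)$ is the group of homotopy classes of unitaries in matrix algebras over $\tilde A$; in both cases homotopies are norm-continuous paths after enlarging the matrices by $p\mapsto\mathrm{diag}(p,0)$, respectively $u\mapsto\mathrm{diag}(u,1)$. **Controlled K-groups.** For a subspace $S\subset A$ let $P^\varepsilon_\infty(S)$ be the set of self-adjoint matrices $p$ over $\tilde A$ (of any size) with entries in $S+\mathbb C$ and $\|p^2-p\|<\varepsilon$, and $U^\varepsilon_\infty(S)$ the set of matrices $u$ with entries in $S+\mathbb C$ and $\|u^*u-1\|<\varepsilon$, $\|uu^*-1\|<\varepsilon$; matrices of different size are compared via $p\mapsto\mathrm{diag}(p,0)$ and $u\mapsto\mathrm{diag}(u,1)$. On $P^\varepsilon_\infty(A_r)\times\mathbb N$ let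 $(p,\ell)\sim(q,\ell')$ if for some $k$ the matrices $\mathrm{diag}(p,I_{k+\ell'})$ and $\mathrm{diag}(q,I_{k+\ell})$ are homotopic in $P^\varepsilon_\infty(A_r)$. Let $\chi$ be the characteristic function of $[\frac12,\infty)$. Then $$K_0^{\varepsilon,r}(A)=\{[p,\ell]\in (P^\varepsilon_\infty(A_r)\times\mathbb N)/{\sim}\ :\ \mathrm{rank}\,\chi(\rho_A(p))=\ell\},\qquad K_1^{\varepsilon,r}(A)=U^\varepsilon_\infty(A_r)/{\sim_{3\varepsilon,2r}},$$ where $u\sim_{3\varepsilon,2r}v$ means that $u$ and $v$ are homotopic in $U^{3\varepsilon}_\infty(A_{2r})$; addition is the block sum, $[p,\ell]+[q,\ell']=[\mathrm{diag}(p,q),\ell+\ell']$ and $[u]+[v]=[\mathrm{diag}(u,v)]$. **Lemma.** Let $0<\varepsilon<\frac18$ and $r>0$. The natural maps $$K_0^{\varepsilon,r}(C^*_L(X))\to K_0(C^*_L(X)),\ [p,\ell]\mapsto[\chi(p)]-[I_\ell],\qquad K_1^{\varepsilon,r}(C^*_L(X))\to K_1(C^*_L(X)),\ [u]\mapsto[u(u^*u)^{-1/2}]$$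 are well defined and are isomorphisms of groups. Their inverses are given by shifting in time. For a matrix $p$ over $\tilde A$ and $N\ge0$ let $\sigma_N(p)$ be the matrix obtained by replacing, in every entry, the component $f\in A$ by $t\mapsto f(t+N)$ and keeping the scalar component. 1. If $p\in P^\varepsilon_\infty(C^*_{L,\mathrm{alg}}(X))$, then $\sigma_N(p)\in P^\varepsilon_\infty(A_r)$ for all sufficiently large $N$. For every $N\geq 0$ with $\sigma_N(p)\in P^\varepsilon_\infty(A_r)$ and every $\ell\in\mathbb N$ with $[\chi(p)]-[I_\ell]\in K_0(A)$, the inverse of the first map sends $[\chi(p)]-[I_\ell]$ to $[\sigma_N(p),\ell]$. 2. If $u\in U^\varepsilon_\infty(C^*_{L,\mathrm{alg}}(X))$, then $\sigma_N(u)\in U^\varepsilon_\infty(A_r)$ for all sufficiently large $N$. For every $N\geq 0$ with $\sigma_N(u)\in U^\varepsilon_\infty(A_r)$, the inverse of the second map sends $[u(u^*u)^{-1/2}]$ to $[\sigma_N(u)]$. -/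

import Mathlib

open scoped ZeroAtInfty ENNReal

attribute [local instance] CStarAlgebra.spectralOrder CStarAlgebra.spectralOrderedRing

noncomputable section

namespace CtrlK

/-- `M_n(B)`, with its C*-norm. -/
abbrev CMat (n : ℕ) (B : Type*) := CStarMatrix (Fin n) (Fin n) B

section Matrices

variable {B : Type*} [CStarAlgebra B]

/-- The block sum `diag(a, b)`. -/
def dsum {n m : ℕ} (a : CMat n B) (b : CMat m B) : CMat (n + m) B :=
  CStarMatrix.ofMatrix (Matrix.reindex finSumFinEquiv finSumFinEquiv
    (Matrix.fromBlocks (CStarMatrix.ofMatrix.symm a) 0 0 (CStarMatrix.ofMatrix.symm b)))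

/-- The diagonal matrix with all diagonal entries equal to `d`. -/
def diagMat (d : B) (n : ℕ) : CMat n B := CStarMatrix.ofMatrix (Matrix.diagonal fun _ => d)

/-- `diag(a, d, …, d)` of size `N`, for a matrix `a` of size `n ≤ N`
(only used for `n ≤ N`). -/
def pad (d : B) {n : ℕ} (N : ℕ) (a : CMat n B) : CMat N B :=
  CStarMatrix.ofMatrix fun i j =>
    if h : (i : ℕ) < n ∧ (j : ℕ) < n then a ⟨i, h.1⟩ ⟨j, h.2⟩ else if i = j then d else 0

/-- A scalar matrix viewed in `M_n(B)`. -/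
def scal {n : ℕ} (w : CMat n ℂ) : CMat n B := w.map (algebraMap ℂ B)

lemma of_apply {R : Type*} {n m : ℕ} (f : Matrix (Fin n) (Fin m) R) (i : Fin n) (j : Fin m) :
    CStarMatrix.ofMatrix f i j = f i j := rfl

lemma of_symm_apply {R : Type*} {n m : ℕ} (f : CStarMatrix (Fin n) (Fin m) R) (i : Fin n)
    (j : Fin m) : CStarMatrix.ofMatrix.symm f i j = f i j := rfl

lemma pad_apply (d : B) {n : ℕ} (N : ℕ) (a : CMat n B) (i j : Fin N) :
    pad d N a i j =
      if h : (i : ℕ) < n ∧ (j : ℕ) < n then a ⟨i, h.1⟩ ⟨j, h.2⟩ else if i = j then d else 0 :=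
  rfl

lemma dsum_apply {n m : ℕ} (a : CMat n B) (b : CMat m B) (i j : Fin (n + m)) :
    dsum a b i j =
      if hi : (i : ℕ) < n then
        if hj : (j : ℕ) < n then a ⟨i, hi⟩ ⟨j, hj⟩ else 0
      else if hj : (j : ℕ) < n then 0 else b ⟨i - n, by omega⟩ ⟨j - n, by omega⟩ := by
  induction i using Fin.addCases <;> induction j using Fin.addCases <;>
    simp [dsum, of_apply, of_symm_apply]

lemma pad_self (d : B) {n : ℕ} (a : CMat n B) : pad d n a = a := by
  ext i j
  simp [pad_apply]

lemma pad_pad (d : B) {n N N' : ℕ} (h : n ≤ N) (_ : N ≤ N') (a : CMat n B) :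
    pad d N' (pad d N a) = pad d N' a := by
  ext i j
  simp only [pad_apply]
  by_cases hi : (i : ℕ) < n ∧ (j : ℕ) < n
  · have : (i : ℕ) < N ∧ (j : ℕ) < N := by omega
    simp [hi, this]
  · simp only [hi, dite_false]
    by_cases h2 : (i : ℕ) < N ∧ (j : ℕ) < N
    · simp [h2, Fin.ext_iff]
    · simp [h2]

lemma pad_add (d : B) {n : ℕ} (k : ℕ) (a : CMat n B) :
    pad d (n + k) a = dsum a (diagMat d k) := by
  ext i j
  rw [pad_apply, dsum_apply]
  by_cases hi : (i : ℕ) < n <;> by_cases hj : (j : ℕ) < n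
  · simp [hi, hj]
  · have : i ≠ j := by rintro rfl; omega
    simp [hi, hj, this]
  · have : i ≠ j := by rintro rfl; omega
    simp [hi, hj, this]
  · have : i = j ↔ (i : ℕ) - n = (j : ℕ) - n := by rw [Fin.ext_iff]; omega
    simp [hi, hj, this, diagMat, of_apply, Matrix.diagonal_apply]

lemma pad_dsum (d : B) {n m k : ℕ} (a : CMat n B) (b : CMat m B) :
    pad d (n + (m + k)) (dsum a b) = dsum a (pad d (m + k) b) := by
  ext i j
  rw [pad_apply, dsum_apply]
  by_cases hi : (i : ℕ) < n <;> by_cases hj : (j : ℕ) < n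
  · have : (i : ℕ) < n + m ∧ (j : ℕ) < n + m := by omega
    simp [hi, hj, dsum_apply, this]
  · have : i ≠ j := by rintro rfl; omega
    simp [hi, hj, dsum_apply, this]
  · have : i ≠ j := by rintro rfl; omega
    simp [hi, hj, dsum_apply, this]
  · have h1 : i = j ↔ (i : ℕ) - n = (j : ℕ) - n := by rw [Fin.ext_iff]; omega
    have h2 : ((i : ℕ) < n + m ∧ (j : ℕ) < n + m) ↔ ((i : ℕ) - n < m ∧ (j : ℕ) - n < m) := by omega
    simp only [hi, hj, dsum_apply, h1, h2, pad_apply, dite_false, Fin.mk.injEq]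

lemma dsum_assoc {n m k : ℕ} (d : B) (a : CMat n B) (b : CMat m B) (c : CMat k B) :
    pad d (n + m + k) (dsum a (dsum b c)) = dsum (dsum a b) c := by
  ext i j
  have hij : (i : ℕ) < n + (m + k) ∧ (j : ℕ) < n + (m + k) := by omega
  simp only [pad_apply, hij, dsum_apply]
  by_cases hi : (i : ℕ) < n <;> by_cases hj : (j : ℕ) < n <;>
  by_cases hi' : (i : ℕ) < n + m <;> by_cases hj' : (j : ℕ) < n + m <;>
  simp [hi, hj, hi', hj'] <;> (try split_ifs) <;> first | rfl | (congr 1 <;> simp <;> omega) | omega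

lemma dsum_comm_perm {n m : ℕ} (d : B) (a : CMat n B) (b : CMat m B) :
    ∃ σ : Equiv.Perm (Fin (n + m)), ∀ i j,
      pad d (n + m) (dsum b a) i j = dsum a b (σ i) (σ j) := by
  refine ⟨(finCongr (add_comm n m)).trans finAddFlip, fun i j => ?_⟩
  have key : ∀ i : Fin (n + m), ((((finCongr (add_comm n m)).trans finAddFlip) i : Fin (n + m)) : ℕ)
      = if (i : ℕ) < m then n + i else i - m := by
    intro i
    split_ifs with h
    · have : (finCongr (add_comm n m) i : Fin (m + n)) = Fin.castAdd n ⟨i, h⟩ := by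
        ext; simp
      rw [Equiv.trans_apply, this, finAddFlip_apply_castAdd]; simp
    · have : (finCongr (add_comm n m) i : Fin (m + n)) = Fin.natAdd m ⟨i - m, by omega⟩ := by
        ext; simp; omega
      rw [Equiv.trans_apply, this, finAddFlip_apply_natAdd]; simp
  have hij : (i : ℕ) < m + n ∧ (j : ℕ) < m + n := by omega
  rw [pad_apply, dif_pos hij, dsum_apply, dsum_apply]
  simp only [key]
  by_cases hi : (i : ℕ) < m <;> by_cases hj : (j : ℕ) < m
  · simp [hi, hj]
  · have : (j : ℕ) - m < n := by omega
    simp [hi, hj, this]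
  · have : (i : ℕ) - m < n := by omega
    simp [hi, hj, this]
  · have h1 : (i : ℕ) - m < n := by omega
    have h2 : (j : ℕ) - m < n := by omega
    simp [hi, hj, h1, h2]

lemma continuous_entries {X : Type*} [TopologicalSpace X] {n : ℕ} {f : X → CMat n B} :
    Continuous f ↔ ∀ i j, Continuous fun x => f x i j := by
  constructor
  · intro h i j
    exact (continuous_apply_apply i j).comp h
  · intro h
    exact continuous_pi fun i => continuous_pi fun j => h i j

lemma continuous_pad (d : B) (n N : ℕ) : Continuous (fun a : CMat n B => pad d N a) := by
  rw [continuous_entries]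
  intro i j
  simp only [pad_apply]
  split_ifs with h
  · exact continuous_apply_apply _ _
  all_goals exact continuous_const

lemma continuous_dsum_right {n m : ℕ} (a : CMat n B) :
    Continuous (fun b : CMat m B => dsum a b) := by
  rw [continuous_entries]
  intro i j
  simp only [dsum_apply]
  split_ifs with h
  any_goals exact continuous_const
  exact continuous_apply_apply _ _

lemma scal_mul {n : ℕ} (w w' : CMat n ℂ) : (scal (w * w') : CMat n B) = scal w * scal w' :=
  Matrix.map_mul (L := w) (M := w') (f := algebraMap ℂ B)

lemma scal_one {n : ℕ} : (scal 1 : CMat n B) = 1 := by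
  ext i j
  by_cases h : i = j <;> simp [scal, CStarMatrix.one_apply, h]

lemma scal_star {n : ℕ} (w : CMat n ℂ) : (scal (star w) : CMat n B) = star (scal w) := by
  ext i j
  simp only [scal, CStarMatrix.star_apply, CStarMatrix.map_apply]
  exact algebraMap_star_comm (R := ℂ) (A := B) _

lemma continuous_scal {n : ℕ} : Continuous (scal : CMat n ℂ → CMat n B) := by
  rw [continuous_entries]
  intro i j
  exact (continuous_algebraMap ℂ B).comp (continuous_apply_apply i j)

lemma scal_mem_unitary {n : ℕ} {w : CMat n ℂ} (hw : w ∈ unitary (CMat n ℂ)) :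
    (scal w : CMat n B) ∈ unitary (CMat n B) := by
  rw [Unitary.mem_iff] at hw ⊢
  rw [← scal_star, ← scal_mul, ← scal_mul, hw.1, hw.2, scal_one]
  exact ⟨rfl, rfl⟩

end Matrices

/-- A family of matrices over `B` with the properties that are needed to form the commutative
monoid of its stable homotopy classes; `d` (which is `0` or `1`) is the scalar with which
matrices are padded in the inclusions `M_n(B) → M_{n+1}(B)`. -/
structure MatFamily (B : Type*) [CStarAlgebra B] where
  carrier : ∀ n : ℕ, Set (CMat n B)
  d : B
  diag_mem : ∀ n, diagMat d n ∈ carrier n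
  dsum_mem : ∀ {n m : ℕ} {a : CMat n B} {b : CMat m B},
    a ∈ carrier n → b ∈ carrier m → dsum a b ∈ carrier (n + m)
  conj_mem : ∀ {n : ℕ} {w : CMat n ℂ} {a : CMat n B}, w ∈ unitary (CMat n ℂ) → a ∈ carrier n →
    scal w * a * star (scal w) ∈ carrier n

namespace MatFamily

variable {B : Type*} [CStarAlgebra B] (F : MatFamily B)

/-- The elements of the union of the `F_n`, each recorded with a size. -/
abbrev Elt := Σ n : ℕ, F.carrier n

/-- Two matrices in the family are homotopic in the union `F_∞`: after padding to a common size
`N` they are joined by a norm-continuous path in `F_N`. -/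
def Homotopic (a b : F.Elt) : Prop :=
  ∃ N : ℕ, a.1 ≤ N ∧ b.1 ≤ N ∧
    JoinedIn (F.carrier N) (pad F.d N a.2.1) (pad F.d N b.2.1)

variable {F}

lemma pad_mem {n N : ℕ} (h : n ≤ N) {a : CMat n B} (ha : a ∈ F.carrier n) :
    pad F.d N a ∈ F.carrier N := by
  obtain ⟨k, rfl⟩ := Nat.exists_eq_add_of_le h
  rw [pad_add]
  exact F.dsum_mem ha (F.diag_mem k)

lemma joined_pad {n N : ℕ} (h : n ≤ N) {a b : CMat n B} (hab : JoinedIn (F.carrier n) a b) :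
    JoinedIn (F.carrier N) (pad F.d N a) (pad F.d N b) := by
  obtain ⟨γ, hγ⟩ := hab
  exact ⟨γ.map (continuous_pad F.d n N), fun t => pad_mem h (hγ t)⟩

lemma homotopic_of_pad_eq {a b : F.Elt} (h : b.1 ≤ a.1) (hab : pad F.d a.1 b.2.1 = a.2.1) :
    F.Homotopic a b :=
  ⟨a.1, le_rfl, h, by rw [hab, pad_self]; exact JoinedIn.refl a.2.2⟩

lemma homotopic_refl (a : F.Elt) : F.Homotopic a a :=
  homotopic_of_pad_eq le_rfl (pad_self _ _)

lemma Homotopic.symm {a b : F.Elt} : F.Homotopic a b → F.Homotopic b a := by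
  rintro ⟨N, h, h', hj⟩
  exact ⟨N, h', h, hj.symm⟩

lemma Homotopic.trans {a b c : F.Elt} : F.Homotopic a b → F.Homotopic b c → F.Homotopic a c := by
  rintro ⟨N, h1, h2, hj⟩ ⟨N', h1', h2', hj'⟩
  refine ⟨max N N', h1.trans (le_max_left _ _), h2'.trans (le_max_right _ _), ?_⟩
  have e := joined_pad (le_max_left N N') hj
  have e' := joined_pad (le_max_right N N') hj'
  rw [pad_pad _ h1 (le_max_left _ _), pad_pad _ h2 (le_max_left _ _)] at e
  rw [pad_pad _ h1' (le_max_right _ _), pad_pad _ h2' (le_max_right _ _)] at e'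
  exact e.trans e'

variable (F) in
/-- Homotopy in `F_∞` as an equivalence relation. -/
def homotopySetoid : Setoid F.Elt where
  r := F.Homotopic
  iseqv := ⟨homotopic_refl, Homotopic.symm, Homotopic.trans⟩

/-- The block sum on `F_∞`. -/
def add (a b : F.Elt) : F.Elt := ⟨a.1 + b.1, dsum a.2.1 b.2.1, F.dsum_mem a.2.2 b.2.2⟩

lemma joined_swap {n : ℕ} (x y : Fin n) {a : CMat n B} (ha : a ∈ F.carrier n) :
    JoinedIn (F.carrier n) a
      (CStarMatrix.ofMatrix fun i j => a (Equiv.swap x y i) (Equiv.swap x y j)) := by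
  obtain ⟨P, hP⟩ : ∃ P : CMat n ℂ, ∀ i j, P i j = if Equiv.swap x y i = j then 1 else 0 :=
    ⟨CStarMatrix.ofMatrix fun i j => if Equiv.swap x y i = j then 1 else 0, fun _ _ => rfl⟩
  have hPs : star P = P := by
    ext i j
    have : Equiv.swap x y j = i ↔ Equiv.swap x y i = j := by
      constructor <;> (rintro rfl; simp)
    simp only [hP, CStarMatrix.star_apply, this]
    split_ifs <;> simp
  have hPP : P * P = 1 := by
    ext i j
    have e : ∀ k, Equiv.swap x y k = j ↔ k = Equiv.swap x y j := fun k => by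
      constructor <;> (rintro rfl; simp)
    simp [hP, CStarMatrix.mul_apply, CStarMatrix.one_apply, e]
  let Q : CMat n ℂ := (1 / 2 : ℂ) • (1 - P)
  have hQs : star Q = Q := by simp [Q, hPs, star_smul]
  have hQQ : Q * Q = Q := by
    have : (1 - P) * (1 - P) = (2 : ℂ) • (1 - P) := by
      rw [sub_mul, mul_sub, mul_sub, hPP, two_smul]; simp; abel
    simp only [Q, smul_mul_assoc, mul_smul_comm, this, smul_smul]; norm_num
  let c : ℝ → ℂ := fun t => Complex.exp ((Real.pi * t : ℝ) * Complex.I)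
  have hc : ∀ t, c t * (starRingEnd ℂ) (c t) = 1 := by
    intro t
    rw [Complex.mul_conj, Complex.normSq_eq_norm_sq, Complex.norm_exp_ofReal_mul_I]; simp
  let W : ℝ → CMat n ℂ := fun t => 1 + (c t - 1) • Q
  have hWs : ∀ t, star (W t) = 1 + ((starRingEnd ℂ) (c t) - 1) • Q := by
    intro t; simp [W, star_smul, hQs]
  have hWu : ∀ t, W t ∈ unitary (CMat n ℂ) := by
    intro t
    have h1 : W t * star (W t) = 1 := by
      rw [hWs]
      have e : ∀ u v : ℂ, (u + 1) * (v + 1) = 1 → (1 + u • Q) * (1 + v • Q) = 1 := by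
        intro u v huv
        have : (1 + u • Q) * (1 + v • Q) = 1 + (u + v + u * v) • Q := by
          simp only [mul_add, add_mul, one_mul, mul_one, smul_mul_assoc, mul_smul_comm, hQQ]
          module
        rw [this, show u + v + u * v = 0 by linear_combination huv, zero_smul, add_zero]
      refine e _ _ ?_
      linear_combination hc t
    have h2 : star (W t) * W t = 1 := by
      rw [hWs]
      have e : ∀ u v : ℂ, (u + 1) * (v + 1) = 1 → (1 + u • Q) * (1 + v • Q) = 1 := by
        intro u v huv
        have : (1 + u • Q) * (1 + v • Q) = 1 + (u + v + u * v) • Q := by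
          simp only [mul_add, add_mul, one_mul, mul_one, smul_mul_assoc, mul_smul_comm, hQQ]
          module
        rw [this, show u + v + u * v = 0 by linear_combination huv, zero_smul, add_zero]
      refine e _ _ ?_
      linear_combination hc t
    exact Unitary.mem_iff.2 ⟨h2, h1⟩
  have hWc : Continuous W := by
    have : Continuous c := by fun_prop
    fun_prop
  have hW0 : W 0 = 1 := by simp [W, c]
  have hW1 : W 1 = P := by
    have : c 1 = -1 := by simp [c, Complex.exp_pi_mul_I]
    simp only [W, this, Q, smul_smul]
    norm_num
  refine JoinedIn.ofLine (f := fun t => scal (W t) * a * star (scal (W t))) ?_ ?_ ?_ ?_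
  · have := (continuous_scal (B := B)).comp hWc
    exact Continuous.continuousOn ((this.mul continuous_const).mul this.star)
  · simp [hW0, scal_one]
  · simp only [hW1, ← scal_star, hPs]
    ext i j
    change _ = a (Equiv.swap x y i) (Equiv.swap x y j)
    have e : ∀ k, Equiv.swap x y k = j ↔ k = Equiv.swap x y j := fun k => by
      constructor <;> (rintro rfl; simp)
    simp [hP, CStarMatrix.mul_apply, scal, CStarMatrix.map_apply, e]
  · rintro _ ⟨t, -, rfl⟩
    exact F.conj_mem (hWu t) ha

lemma joined_perm {n : ℕ} (σ : Equiv.Perm (Fin n)) {a : CMat n B} (ha : a ∈ F.carrier n) :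
    JoinedIn (F.carrier n) a (CStarMatrix.ofMatrix fun i j => a (σ i) (σ j)) := by
  induction σ using Equiv.Perm.swap_induction_on' with
  | one => exact JoinedIn.refl ha
  | mul_swap f x y _ ih => exact ih.trans (joined_swap x y ih.target_mem)

lemma add_comm_homotopic (a b : F.Elt) : F.Homotopic (add a b) (add b a) := by
  obtain ⟨σ, hσ⟩ := dsum_comm_perm F.d a.2.1 b.2.1
  refine ⟨a.1 + b.1, le_rfl, (Nat.add_comm _ _).le, ?_⟩
  have h := joined_perm σ (F.dsum_mem a.2.2 b.2.2)
  have e : pad F.d (a.1 + b.1) (dsum b.2.1 a.2.1) =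
      CStarMatrix.ofMatrix fun i j => dsum a.2.1 b.2.1 (σ i) (σ j) := by
    ext i j; exact hσ i j
  simp only [add]
  rw [pad_self, e]
  exact h

lemma add_right_homotopic (a : F.Elt) {b b' : F.Elt} (h : F.Homotopic b b') :
    F.Homotopic (add a b) (add a b') := by
  obtain ⟨N, h1, h2, γ, hγ⟩ := h
  refine ⟨a.1 + N, by simp [add, h1], by simp [add, h2], ?_⟩
  obtain ⟨k, rfl⟩ := Nat.exists_eq_add_of_le h1
  obtain ⟨k', hk'⟩ := Nat.exists_eq_add_of_le h2
  simp only [add]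
  rw [pad_dsum, hk', pad_dsum, ← hk']
  exact ⟨γ.map (continuous_dsum_right a.2.1), fun t => F.dsum_mem a.2.2 (hγ t)⟩

variable (F) in
/-- The set of homotopy classes of `F_∞`. -/
def Classes : Type _ := Quotient F.homotopySetoid

/-- The class of a matrix. -/
def cls {n : ℕ} (a : CMat n B) (ha : a ∈ F.carrier n) : F.Classes :=
  Quotient.mk F.homotopySetoid ⟨n, a, ha⟩

instance : Zero F.Classes := ⟨cls (diagMat F.d 0) (F.diag_mem 0)⟩

instance : Add F.Classes :=
  ⟨Quotient.map₂ add fun _ a' h _ _ h' =>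
    ((add_comm_homotopic _ _).trans (add_right_homotopic _ h)).trans
      ((add_comm_homotopic _ _).trans (add_right_homotopic a' h'))⟩

/-- Homotopy classes form a commutative monoid under `[a] + [b] = [diag(a, b)]`. -/
instance : AddCommMonoid F.Classes where
  nsmul := nsmulRec
  add_comm := by
    rintro ⟨a⟩ ⟨b⟩
    exact Quotient.sound (s := F.homotopySetoid) (add_comm_homotopic a b)
  add_assoc := by
    rintro ⟨a⟩ ⟨b⟩ ⟨c⟩
    exact Quotient.sound (s := F.homotopySetoid)
      (homotopic_of_pad_eq (Nat.add_assoc _ _ _).ge (dsum_assoc _ _ _ _))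
  zero_add := by
    rintro ⟨a⟩
    exact Quotient.sound (s := F.homotopySetoid) ((add_comm_homotopic _ _).trans
      (homotopic_of_pad_eq (Nat.le_add_right _ _) (pad_add _ _ _)))
  add_zero := by
    rintro ⟨a⟩
    exact Quotient.sound (s := F.homotopySetoid) (homotopic_of_pad_eq (Nat.le_add_right _ _) (pad_add _ _ _))

end MatFamily

section BlockSums

variable {B : Type*} [CStarAlgebra B]

/-- Block sums as a `*`-homomorphism `M_n(B) × M_m(B) → M_{n+m}(B)`. -/
def dsumHom (B : Type*) [CStarAlgebra B] (n m : ℕ) :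
    (CMat n B × CMat m B) →⋆ₐ[ℂ] CMat (n + m) B where
  toFun x := dsum x.1 x.2
  map_one' := by
    ext i j
    rw [dsum_apply]
    simp only [Prod.fst_one, Prod.snd_one, CStarMatrix.one_apply, Fin.ext_iff]
    split_ifs <;> first | rfl | omega
  map_mul' x y := by
    have h := Matrix.submatrix_mul_equiv
      (Matrix.fromBlocks (CStarMatrix.ofMatrix.symm x.1) 0 0 (CStarMatrix.ofMatrix.symm x.2))
      (Matrix.fromBlocks (CStarMatrix.ofMatrix.symm y.1) 0 0 (CStarMatrix.ofMatrix.symm y.2))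
      finSumFinEquiv.symm finSumFinEquiv.symm finSumFinEquiv.symm
    rw [Matrix.fromBlocks_multiply] at h
    simp only [Matrix.mul_zero, Matrix.zero_mul, add_zero, zero_add] at h
    exact h.symm
  map_zero' := by
    ext i j
    rw [dsum_apply]
    split_ifs <;> rfl
  map_add' x y := by
    ext i j
    simp only [dsum_apply, CStarMatrix.add_apply, Prod.fst_add, Prod.snd_add]
    split_ifs <;> simp
  commutes' c := by
    rw [Algebra.algebraMap_eq_smul_one, Algebra.algebraMap_eq_smul_one]
    ext i j
    rw [dsum_apply]
    simp only [Prod.smul_fst, Prod.smul_snd, Prod.fst_one, Prod.snd_one, CStarMatrix.smul_apply,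
      CStarMatrix.one_apply, Fin.ext_iff]
    split_ifs <;> first | rfl | omega | simp
  map_star' x := by
    ext i j
    simp only [dsum_apply, CStarMatrix.star_apply, Prod.fst_star, Prod.snd_star]
    split_ifs <;> simp

lemma dsumHom_apply {n m : ℕ} (a : CMat n B) (b : CMat m B) :
    dsumHom B n m (a, b) = dsum a b := rfl

lemma dsum_mul {n m : ℕ} (a a' : CMat n B) (b b' : CMat m B) :
    dsum a b * dsum a' b' = dsum (a * a') (b * b') :=
  (map_mul (dsumHom B n m) (a, b) (a', b')).symm

lemma dsum_star {n m : ℕ} (a : CMat n B) (b : CMat m B) :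
    star (dsum a b) = dsum (star a) (star b) :=
  (map_star (dsumHom B n m) (a, b)).symm

lemma dsum_sub {n m : ℕ} (a a' : CMat n B) (b b' : CMat m B) :
    dsum a b - dsum a' b' = dsum (a - a') (b - b') :=
  (map_sub (dsumHom B n m) (a, b) (a', b')).symm

lemma dsum_one (n m : ℕ) : dsum (1 : CMat n B) (1 : CMat m B) = 1 :=
  map_one (dsumHom B n m)

lemma norm_dsum_lt {n m : ℕ} {a : CMat n B} {b : CMat m B} {ε : ℝ} (ha : ‖a‖ < ε)
    (hb : ‖b‖ < ε) : ‖dsum a b‖ < ε :=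
  (NonUnitalStarAlgHom.norm_apply_le (dsumHom B n m) (a, b)).trans_lt (by
    rw [Prod.norm_def]; exact max_lt ha hb)

lemma diagMat_zero (n : ℕ) : diagMat (0 : B) n = 0 := by
  ext i j; simp [diagMat, of_apply]

lemma diagMat_one (n : ℕ) : diagMat (1 : B) n = 1 := by
  rfl

lemma dsum_entries_mem {n m : ℕ} {a : CMat n B} {b : CMat m B} {S : Submodule ℂ B}
    (ha : ∀ i j, a i j ∈ S) (hb : ∀ i j, b i j ∈ S) (i j : Fin (n + m)) : dsum a b i j ∈ S := by
  rw [dsum_apply]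
  split_ifs
  exacts [ha _ _, S.zero_mem, S.zero_mem, hb _ _]

lemma one_entries_mem {n : ℕ} {S : Submodule ℂ B} (h1 : (1 : B) ∈ S) (i j : Fin n) :
    (1 : CMat n B) i j ∈ S := by
  rw [CStarMatrix.one_apply]
  split_ifs
  exacts [h1, S.zero_mem]

lemma scal_conj_entries_mem {n : ℕ} {S : Submodule ℂ B} (w : CMat n ℂ) {a : CMat n B}
    (ha : ∀ i j, a i j ∈ S) (i j : Fin n) :
    (scal w * a * star (scal w) : CMat n B) i j ∈ S := by
  rw [← scal_star, CStarMatrix.mul_apply]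
  refine S.sum_mem fun k _ => ?_
  rw [CStarMatrix.mul_apply, Finset.sum_mul]
  refine S.sum_mem fun l _ => ?_
  have : (scal w : CMat n B) i l * a l k * (scal (star w) : CMat n B) k j =
      (w i l * (star w) k j) • a l k := by
    simp only [scal, CStarMatrix.map_apply, Algebra.algebraMap_eq_smul_one, smul_mul_assoc,
      one_mul, mul_smul_comm, mul_one, smul_smul]
    rw [mul_comm]
  rw [this]
  exact S.smul_mem _ (ha _ _)

lemma norm_scal_conj {n : ℕ} {w : CMat n ℂ} (hw : w ∈ unitary (CMat n ℂ)) (x : CMat n B) :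
    ‖scal w * x * star (scal w)‖ = ‖x‖ := by
  have h : (scal w : CMat n B) ∈ unitary (CMat n B) := scal_mem_unitary hw
  have h' : star (scal w : CMat n B) ∈ unitary (CMat n B) := Unitary.star_mem h
  rw [CStarRing.norm_mul_mem_unitary _ h', CStarRing.norm_mem_unitary_mul _ h]

lemma scal_conj_mul {n : ℕ} {w : CMat n ℂ} (hw : w ∈ unitary (CMat n ℂ)) (x y : CMat n B) :
    ((scal w * x * star (scal w)) * (scal w * y * star (scal w)) : CMat n B) =
      (scal w * (x * y) * star (scal w) : CMat n B) := by
  have h := (Unitary.mem_iff.1 (scal_mem_unitary (B := B) hw)).1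
  generalize (scal w : CMat n B) = v at h ⊢
  calc v * x * star v * (v * y * star v) = v * x * (star v * v) * y * star v := by
        simp only [mul_assoc]
    _ = v * (x * y) * star v := by rw [h, mul_one]; simp only [mul_assoc]

lemma scal_conj_one {n : ℕ} {w : CMat n ℂ} (hw : w ∈ unitary (CMat n ℂ)) :
    (scal w * 1 * star (scal w) : CMat n B) = 1 := by
  rw [mul_one]; exact (Unitary.mem_iff.1 (scal_mem_unitary (B := B) hw)).2

lemma scal_conj_star {n : ℕ} (w : CMat n ℂ) (x : CMat n B) :
    star (scal w * x * star (scal w)) = scal w * star x * star (scal w) := by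
  simp [mul_assoc]

end BlockSums

/-! ### The K-theory of C*-algebras -/

section KTheory

variable (B : Type*) [CStarAlgebra B]

/-- The projections in the matrix algebras `M_n(B)`. -/
def projFam : MatFamily B where
  carrier n := {p | IsStarProjection p}
  d := 0
  diag_mem n := by
    simp only [diagMat_zero]; exact IsStarProjection.zero _
  dsum_mem ha hb := ⟨by
    rw [IsIdempotentElem, dsum_mul, ha.isIdempotentElem.eq, hb.isIdempotentElem.eq], by
    rw [IsSelfAdjoint, dsum_star, ha.isSelfAdjoint.star_eq, hb.isSelfAdjoint.star_eq]⟩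
  conj_mem hw ha := ⟨by
    rw [IsIdempotentElem, scal_conj_mul hw, ha.isIdempotentElem.eq], by
    rw [IsSelfAdjoint, scal_conj_star, ha.isSelfAdjoint.star_eq]⟩

/-- The unitaries in the matrix algebras `M_n(B)`. -/
def unitFam : MatFamily B where
  carrier n := {u | u ∈ unitary (CMat n B)}
  d := 1
  diag_mem n := by
    simp only [diagMat_one]; exact one_mem (unitary (CMat n B))
  dsum_mem {n m a b} ha hb := by
    have ha := Unitary.mem_iff.1 ha
    have hb := Unitary.mem_iff.1 hb
    refine Unitary.mem_iff.2 ⟨?_, ?_⟩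
    · rw [dsum_star, dsum_mul, ha.1, hb.1, dsum_one]
    · rw [dsum_star, dsum_mul, ha.2, hb.2, dsum_one]
  conj_mem hw ha :=
    mul_mem (mul_mem (scal_mem_unitary hw) ha) (Unitary.star_mem (scal_mem_unitary hw))

/-- `K_0` of a unital C*-algebra: the Grothendieck group of the monoid of homotopy classes of
projections in matrix algebras. -/
abbrev K0Unital : Type _ := Algebra.GrothendieckAddGroup (projFam B).Classes

variable {B}

/-- The class `[p] ∈ K_0(B)` of a projection. -/
def K0Unital.cls {n : ℕ} (p : CMat n B) (hp : IsStarProjection p) : K0Unital B :=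
  Algebra.GrothendieckAddGroup.of (MatFamily.cls (F := projFam B) p hp)

variable {C : Type*} [CStarAlgebra C]

/-- Entrywise application of a `*`-homomorphism. -/
def mapMat (φ : B →⋆ₐ[ℂ] C) {n : ℕ} (a : CMat n B) : CMat n C := a.map φ

lemma mapMat_mul (φ : B →⋆ₐ[ℂ] C) {n : ℕ} (a b : CMat n B) :
    mapMat φ (a * b) = mapMat φ a * mapMat φ b :=
  Matrix.map_mul (L := a) (M := b) (f := φ)

lemma mapMat_star (φ : B →⋆ₐ[ℂ] C) {n : ℕ} (a : CMat n B) :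
    mapMat φ (star a) = star (mapMat φ a) := by
  ext i j
  simp [mapMat, CStarMatrix.star_apply, map_star]

lemma mapMat_dsum (φ : B →⋆ₐ[ℂ] C) {n m : ℕ} (a : CMat n B) (b : CMat m B) :
    mapMat φ (dsum a b) = dsum (mapMat φ a) (mapMat φ b) := by
  ext i j
  simp only [mapMat, CStarMatrix.map_apply, dsum_apply]
  split_ifs <;> simp

lemma mapMat_pad_zero (φ : B →⋆ₐ[ℂ] C) {n : ℕ} (N : ℕ) (a : CMat n B) :
    mapMat φ (pad 0 N a) = pad 0 N (mapMat φ a) := by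
  ext i j
  simp only [mapMat, CStarMatrix.map_apply, pad_apply]
  split_ifs <;> simp

lemma continuous_mapMat (φ : B →⋆ₐ[ℂ] C) (n : ℕ) :
    Continuous (mapMat φ : CMat n B → CMat n C) := by
  rw [continuous_entries]
  intro i j
  have hφ : Continuous φ := AddMonoidHomClass.continuous_of_bound φ 1
    (by simpa only [one_mul] using NonUnitalStarAlgHom.norm_apply_le φ)
  exact hφ.comp (continuous_apply_apply i j)

lemma mapMat_isStarProjection (φ : B →⋆ₐ[ℂ] C) {n : ℕ} {p : CMat n B} (hp : IsStarProjection p) :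
    IsStarProjection (mapMat φ p) :=
  ⟨by rw [IsIdempotentElem, ← mapMat_mul, hp.isIdempotentElem.eq],
    by rw [IsSelfAdjoint, ← mapMat_star, hp.isSelfAdjoint.star_eq]⟩

/-- The homomorphism induced on homotopy classes of projections. -/
def projClassesMap (φ : B →⋆ₐ[ℂ] C) : (projFam B).Classes →+ (projFam C).Classes where
  toFun := Quotient.map
    (fun a => ⟨a.1, mapMat φ a.2.1, mapMat_isStarProjection φ a.2.2⟩) (by
      rintro a b ⟨N, h1, h2, γ, hγ⟩
      refine ⟨N, h1, h2, ?_⟩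
      change JoinedIn _ (pad 0 N (mapMat φ a.2.1)) (pad 0 N (mapMat φ b.2.1))
      rw [← mapMat_pad_zero, ← mapMat_pad_zero]
      exact ⟨γ.map (continuous_mapMat φ N), fun t => mapMat_isStarProjection φ (hγ t)⟩)
  map_zero' := by
    refine congrArg (Quotient.mk (projFam C).homotopySetoid) ?_
    refine Sigma.ext rfl (heq_of_eq (Subtype.ext ?_))
    ext i
    exact i.elim0
  map_add' := by
    rintro ⟨a⟩ ⟨b⟩
    refine congrArg (Quotient.mk (projFam C).homotopySetoid) ?_
    exact Sigma.ext rfl (heq_of_eq (Subtype.ext (mapMat_dsum φ _ _)))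

/-- Functoriality of `K_0` for unital `*`-homomorphisms. -/
def K0Unital.map (φ : B →⋆ₐ[ℂ] C) : K0Unital B →+ K0Unital C :=
  Algebra.GrothendieckAddGroup.lift
    ((Algebra.GrothendieckAddGroup.of : _ →+ K0Unital C).comp (projClassesMap φ))

lemma K0Unital.map_cls (φ : B →⋆ₐ[ℂ] C) {n : ℕ} (p : CMat n B) (hp : IsStarProjection p) :
    K0Unital.map φ (K0Unital.cls p hp) = K0Unital.cls (mapMat φ p) (mapMat_isStarProjection φ hp) :=
  DFunLike.congr_fun (Algebra.GrothendieckAddGroup.lift.symm_apply_apply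
    ((Algebra.GrothendieckAddGroup.of : _ →+ K0Unital C).comp (projClassesMap φ))) _

variable (B) in
/-- `K_1` of a unital C*-algebra: homotopy classes of unitaries in matrix algebras. -/
abbrev K1Unital : Type _ := (unitFam B).Classes

namespace K1Unital

lemma star_add_self_homotopic (u : (unitFam B).Elt) :
    (unitFam B).Homotopic
      (MatFamily.add ⟨u.1, star u.2.1, Unitary.star_mem u.2.2⟩ u)
      ⟨0, diagMat 1 0, (unitFam B).diag_mem 0⟩ := by
  obtain ⟨n, u, hu⟩ := u
  have hu' := Unitary.mem_iff.1 hu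
  have h1 : (1 : CMat n B) ∈ (unitFam B).carrier n := one_mem (unitary (CMat n B))
  have hj : JoinedIn ((unitFam B).carrier (n + n)) (dsum 1 u) (dsum u 1) := by
    obtain ⟨σ, hσ⟩ := dsum_comm_perm (1 : B) (1 : CMat n B) u
    have h := MatFamily.joined_perm (F := unitFam B) σ ((unitFam B).dsum_mem h1 hu)
    have e : dsum u 1 = CStarMatrix.ofMatrix fun i j => dsum (1 : CMat n B) u (σ i) (σ j) := by
      ext i j
      have := hσ i j
      rwa [pad_self] at this
    rwa [← e] at h
  obtain ⟨γ, hγ⟩ := hj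
  have hs : dsum (star u) (1 : CMat n B) ∈ (unitFam B).carrier (n + n) :=
    (unitFam B).dsum_mem (Unitary.star_mem hu) h1
  refine ⟨n + n, le_rfl, Nat.zero_le _, ?_⟩
  have e1 : pad (unitFam B).d (n + n) (dsum (star u) u) = dsum (star u) 1 * dsum 1 u := by
    rw [pad_self, dsum_mul, mul_one, one_mul]
  have e2 : pad (unitFam B).d (n + n) (diagMat (1 : B) 0) = dsum (star u) 1 * dsum u 1 := by
    rw [dsum_mul, hu'.1, mul_one, dsum_one]
    ext i j
    simp [pad_apply, CStarMatrix.one_apply, unitFam]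
  change JoinedIn _ (pad (unitFam B).d (n + n) (dsum (star u) u))
    (pad (unitFam B).d (n + n) (diagMat (1 : B) 0))
  rw [e1, e2]
  exact ⟨γ.map (continuous_const.mul continuous_id), fun t =>
    (unitary (CMat (n + n) B)).mul_mem hs (hγ t)⟩

instance : Neg (K1Unital B) where
  neg := Quotient.map (fun u => ⟨u.1, star u.2.1, Unitary.star_mem u.2.2⟩) (by
    rintro a b ⟨N, h1, h2, γ, hγ⟩
    refine ⟨N, h1, h2, ?_⟩
    have e : ∀ {n : ℕ} (a : CMat n B), pad (unitFam B).d N (star a) =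
        star (pad (unitFam B).d N a) := by
      intro n a
      ext i j
      simp only [pad_apply, CStarMatrix.star_apply, unitFam, and_comm (a := (j : ℕ) < n),
        eq_comm (a := j)]
      split_ifs <;> simp
    change JoinedIn _ (pad (unitFam B).d N (star a.2.1)) (pad (unitFam B).d N (star b.2.1))
    rw [e, e]
    exact ⟨γ.map continuous_star, fun t => Unitary.star_mem (hγ t)⟩)

/-- `K_1(B)` is an abelian group, with `-[u] = [u*]`. -/
instance : AddCommGroup (K1Unital B) where
  __ := (inferInstance : AddCommMonoid (unitFam B).Classes)
  zsmul := zsmulRec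
  neg_add_cancel := by
    rintro ⟨u⟩
    exact Quotient.sound (s := (unitFam B).homotopySetoid) (star_add_self_homotopic u)

end K1Unital

variable (A : Type*) [NonUnitalCStarAlgebra A]

/-- The canonical projection `ρ_A : Ã → ℂ` of the unitization onto the scalars. -/
def scalarPart : Unitization ℂ A →⋆ₐ[ℂ] ℂ where
  __ := Unitization.fstHom ℂ A
  map_star' _ := rfl

/-- `K_0(A) = ker (K_0(Ã) → K_0(ℂ))` for a non-unital C*-algebra. -/
abbrev K0 : AddSubgroup (K0Unital (Unitization ℂ A)) := (K0Unital.map (scalarPart A)).ker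

/-- `K_1(A) = K_1(Ã)` for a non-unital C*-algebra. -/
abbrev K1 : Type _ := K1Unital (Unitization ℂ A)

end KTheory

/-! ### Quasi-projections and quasi-unitaries -/

section Quasi

variable {B : Type*} [CStarAlgebra B]

/-- The `ε`-quasi-projections of `M_n(B)` with entries in the subspace `S`; for `S = B_r` these
are the `(ε, r)`-quasi-projections. -/
def QProj (ε : ℝ) (S : Submodule ℂ B) (n : ℕ) : Set (CMat n B) :=
  {p | (∀ i j, p i j ∈ S) ∧ IsSelfAdjoint p ∧ ‖p * p - p‖ < ε}

/-- The `ε`-quasi-unitaries of `M_n(B)` with entries in the subspace `S`; for `S = B_r` these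
are the `(ε, r)`-quasi-unitaries. -/
def QUnit (ε : ℝ) (S : Submodule ℂ B) (n : ℕ) : Set (CMat n B) :=
  {u | (∀ i j, u i j ∈ S) ∧ ‖star u * u - 1‖ < ε ∧ ‖u * star u - 1‖ < ε}

lemma one_mem_QProj {ε : ℝ} (hε : 0 < ε) {S : Submodule ℂ B} (h1 : (1 : B) ∈ S) (n : ℕ) :
    (1 : CMat n B) ∈ QProj ε S n :=
  ⟨one_entries_mem h1, IsSelfAdjoint.one _, by simpa using hε⟩

lemma one_mem_QUnit {ε : ℝ} (hε : 0 < ε) {S : Submodule ℂ B} (h1 : (1 : B) ∈ S) (n : ℕ) :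
    (1 : CMat n B) ∈ QUnit ε S n :=
  ⟨one_entries_mem h1, by simpa using hε, by simpa using hε⟩

lemma QUnit_mono {ε ε' : ℝ} (hε : ε ≤ ε') {S S' : Submodule ℂ B} (hS : S ≤ S') (n : ℕ) :
    QUnit ε S n ⊆ QUnit ε' S' n :=
  fun _ hu => ⟨fun i j => hS (hu.1 i j), hu.2.1.trans_le hε, hu.2.2.trans_le hε⟩

/-- Quasi-projections, as a family of matrices. -/
def qProjFam (ε : ℝ) (hε : 0 < ε) (S : Submodule ℂ B) : MatFamily B where
  carrier := QProj ε S
  d := 0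
  diag_mem n := by
    rw [diagMat_zero]
    exact ⟨fun i j => S.zero_mem, IsSelfAdjoint.zero _, by simpa using hε⟩
  dsum_mem {n m a b} ha hb := by
    refine ⟨dsum_entries_mem ha.1 hb.1, ?_, ?_⟩
    · rw [IsSelfAdjoint, dsum_star, ha.2.1.star_eq, hb.2.1.star_eq]
    · rw [dsum_mul, dsum_sub]
      exact norm_dsum_lt ha.2.2 hb.2.2
  conj_mem {n w a} hw ha := by
    refine ⟨scal_conj_entries_mem w ha.1, ?_, ?_⟩
    · rw [IsSelfAdjoint, scal_conj_star, ha.2.1.star_eq]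
    · rw [scal_conj_mul hw, ← sub_mul, ← mul_sub, norm_scal_conj hw]
      exact ha.2.2

/-- Quasi-unitaries, as a family of matrices. -/
def qUnitFam (ε : ℝ) (hε : 0 < ε) (S : Submodule ℂ B) (h1 : (1 : B) ∈ S) : MatFamily B where
  carrier := QUnit ε S
  d := 1
  diag_mem n := by
    rw [diagMat_one]
    exact one_mem_QUnit hε h1 n
  dsum_mem {n m a b} ha hb := by
    refine ⟨dsum_entries_mem ha.1 hb.1, ?_, ?_⟩
    · rw [dsum_star, dsum_mul, ← dsum_one, dsum_sub]
      exact norm_dsum_lt ha.2.1 hb.2.1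
    · rw [dsum_star, dsum_mul, ← dsum_one, dsum_sub]
      exact norm_dsum_lt ha.2.2 hb.2.2
  conj_mem {n w a} hw ha := by
    refine ⟨scal_conj_entries_mem w ha.1, ?_, ?_⟩
    · rw [scal_conj_star, scal_conj_mul hw, ← scal_conj_one hw, ← sub_mul, ← mul_sub,
        norm_scal_conj hw]
      exact ha.2.1
    · rw [scal_conj_star, scal_conj_mul hw, ← scal_conj_one hw, ← sub_mul, ← mul_sub,
        norm_scal_conj hw]
      exact ha.2.2

/-- The class of the unit matrix `I_k` among the quasi-projections. -/
def oneCls (ε : ℝ) (hε : 0 < ε) (S : Submodule ℂ B) (h1 : (1 : B) ∈ S) (k : ℕ) :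
    (qProjFam ε hε S).Classes :=
  MatFamily.cls (F := qProjFam ε hε S) (1 : CMat k B) (one_mem_QProj hε h1 k)

lemma oneCls_add (ε : ℝ) (hε : 0 < ε) (S : Submodule ℂ B) (h1 : (1 : B) ∈ S) (k l : ℕ) :
    oneCls ε hε S h1 (k + l) = oneCls ε hε S h1 k + oneCls ε hε S h1 l := by
  refine congrArg (Quotient.mk (qProjFam ε hε S).homotopySetoid) ?_
  exact Sigma.ext rfl (heq_of_eq (Subtype.ext (dsum_one k l).symm))

/-- The relation `(p, ℓ) ∼ (q, ℓ')` on `P_∞ × ℕ`: for some `k`, the quasi-projections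
`diag(p, I_{k+ℓ'})` and `diag(q, I_{k+ℓ})` are homotopic. It only depends on the homotopy classes
of `p` and `q` and is stated for these. -/
def k0Con (ε : ℝ) (hε : 0 < ε) (S : Submodule ℂ B) (h1 : (1 : B) ∈ S) :
    AddCon ((qProjFam ε hε S).Classes × ℕ) where
  r x y := ∃ k : ℕ, x.1 + oneCls ε hε S h1 (k + y.2) = y.1 + oneCls ε hε S h1 (k + x.2)
  iseqv := by
    refine ⟨fun x => ⟨0, rfl⟩, ?_, ?_⟩
    · rintro x y ⟨k, h⟩
      exact ⟨k, h.symm⟩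
    · rintro x y z ⟨k, h⟩ ⟨k', h'⟩
      refine ⟨k + k' + y.2, ?_⟩
      simp only [oneCls_add] at h h' ⊢
      calc x.1 + (oneCls ε hε S h1 k + oneCls ε hε S h1 k' + oneCls ε hε S h1 y.2 +
            oneCls ε hε S h1 z.2)
          = x.1 + (oneCls ε hε S h1 k + oneCls ε hε S h1 y.2) +
            (oneCls ε hε S h1 k' + oneCls ε hε S h1 z.2) := by abel
        _ = y.1 + (oneCls ε hε S h1 k' + oneCls ε hε S h1 z.2) +
            (oneCls ε hε S h1 k + oneCls ε hε S h1 x.2) := by rw [h]; abel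
        _ = _ := by rw [h']; abel
  add' := by
    rintro x y z w ⟨k, h⟩ ⟨k', h'⟩
    refine ⟨k + k', ?_⟩
    simp only [oneCls_add, Prod.fst_add, Prod.snd_add] at h h' ⊢
    calc x.1 + z.1 + (oneCls ε hε S h1 k + oneCls ε hε S h1 k' +
          (oneCls ε hε S h1 y.2 + oneCls ε hε S h1 w.2))
        = x.1 + (oneCls ε hε S h1 k + oneCls ε hε S h1 y.2) +
          (z.1 + (oneCls ε hε S h1 k' + oneCls ε hε S h1 w.2)) := by abel
      _ = _ := by rw [h, h']; abel

/-- `K_0^{ε,r}(B)` for unital `B`, where `S = B_r`: the quotient of `P_∞ × ℕ` by `∼`, with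
`[p, ℓ] + [q, ℓ'] = [diag(p, q), ℓ + ℓ']`. -/
abbrev CtrlK0Unital (ε : ℝ) (hε : 0 < ε) (S : Submodule ℂ B) (h1 : (1 : B) ∈ S) : Type _ :=
  (k0Con ε hε S h1).Quotient

/-- The class `[p, ℓ]`. -/
def CtrlK0Unital.cls {ε : ℝ} (hε : 0 < ε) {S : Submodule ℂ B} (h1 : (1 : B) ∈ S) {n : ℕ}
    (p : CMat n B) (hp : p ∈ QProj ε S n) (l : ℕ) : CtrlK0Unital ε hε S h1 :=
  (k0Con ε hε S h1).toQuotient (MatFamily.cls (F := qProjFam ε hε S) p hp, l)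

/-- `K_1^{ε,r}(B)` for unital `B`, where `S = B_r` and `S' = B_{2r}`: classes of elements of
`U_∞^{ε,r}(B)` under homotopy in `U_∞^{3ε,2r}(B)`, with `[u] + [v] = [diag(u, v)]`. -/
def CtrlK1Unital (ε : ℝ) (hε : 0 < ε) {S S' : Submodule ℂ B} (hS : S ≤ S') (h1 : (1 : B) ∈ S) :
    AddSubmonoid (qUnitFam (3 * ε) (by positivity) S' (hS h1)).Classes where
  carrier := {x | ∃ (n : ℕ) (u : CMat n B) (hu : u ∈ QUnit ε S n),
    x = MatFamily.cls (F := qUnitFam (3 * ε) (by positivity) S' (hS h1)) u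
      (QUnit_mono (by linarith) hS n hu)}
  zero_mem' := ⟨0, diagMat 1 0, (qUnitFam ε hε S h1).diag_mem 0, rfl⟩
  add_mem' := by
    rintro _ _ ⟨n, u, hu, rfl⟩ ⟨m, v, hv, rfl⟩
    exact ⟨n + m, dsum u v, (qUnitFam ε hε S h1).dsum_mem hu hv, rfl⟩

/-- The class `[u]`. -/
def CtrlK1Unital.cls {ε : ℝ} (hε : 0 < ε) {S S' : Submodule ℂ B} (hS : S ≤ S') (h1 : (1 : B) ∈ S)
    {n : ℕ} (u : CMat n B) (hu : u ∈ QUnit ε S n) : CtrlK1Unital ε hε hS h1 :=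
  ⟨_, n, u, hu, rfl⟩

end Quasi

/-! ### Functional calculus -/

section FunctionalCalculus

variable {B : Type*} [CStarAlgebra B]

/-- The characteristic function `χ` of `[1/2, ∞)`. -/
def chi (x : ℝ) : ℝ := if 1 / 2 ≤ x then 1 else 0

/-- The spectral projection `χ(p)`. If `‖p² - p‖ < 1/4` and `p = p*`, then `χ` is continuous on the
spectrum of `p`. -/
def spectralProj (p : B) : B := cfc chi p

lemma spectralProj_isStarProjection (p : B) : IsStarProjection (spectralProj p) := by
  have hsa : IsSelfAdjoint (spectralProj p) := cfc_predicate chi p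
  refine ⟨?_, hsa⟩
  by_cases hp : IsSelfAdjoint p
  · by_cases hc : ContinuousOn chi (spectrum ℝ p)
    · rw [IsIdempotentElem, spectralProj, ← cfc_mul chi chi p]
      congr 1
      ext x
      simp only [chi]
      split_ifs <;> simp
    · rw [spectralProj, cfc_apply_of_not_continuousOn p hc]
      exact IsIdempotentElem.zero
  · rw [spectralProj, cfc_apply_of_not_predicate p hp]
    exact IsIdempotentElem.zero

/-- The unitary part `u (u* u)^{-1/2}` of an invertible element. -/
def polarPart (u : B) : B := u * cfc (fun x : ℝ => x ^ (-(1 / 2) : ℝ)) (star u * u)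

lemma polarPart_mem_unitary {u : B} (h1 : ‖star u * u - 1‖ < 1) (h2 : ‖u * star u - 1‖ < 1) :
    polarPart u ∈ unitary B := by
  have isu : ∀ a : B, ‖a - 1‖ < 1 → IsUnit a := by
    intro a ha
    have := isUnit_one_sub_of_norm_lt_one (x := 1 - a) (by rwa [norm_sub_rev])
    simpa using this
  set a := star u * u with ha
  have hasa : IsSelfAdjoint a := IsSelfAdjoint.star_mul_self u
  have hspec : ∀ x ∈ spectrum ℝ a, 0 < x := by
    intro x hx
    have hx0 : 0 ≤ x := spectrum_star_mul_self_nonneg x hx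
    rcases hx0.lt_or_eq with h | h
    · exact h
    · rw [← h] at hx
      exact absurd (isu a h1) (spectrum.zero_mem_iff ℝ |>.1 hx)
  set f : ℝ → ℝ := fun x => x ^ (-(1 / 2) : ℝ) with hf
  have hfc : ContinuousOn f (spectrum ℝ a) := fun x hx =>
    (Real.continuousAt_rpow_const x _ (Or.inl (hspec x hx).ne')).continuousWithinAt
  set c := cfc f a with hcdef
  have hcs : star c = c := (cfc_predicate f a : IsSelfAdjoint c)
  have hcac : c * (a * c) = 1 := by
    have e1 : a * c = cfc (fun x => x * f x) a := by
      rw [hcdef]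
      conv_lhs => rw [← cfc_id ℝ a]
      rw [cfc_id ℝ a, cfc_mul (fun x => x) f a, cfc_id' ℝ a]
    rw [e1, hcdef, ← cfc_mul f (fun x => x * f x) a]
    have : (spectrum ℝ a).EqOn (fun x => f x * (x * f x)) (fun _ => 1) := by
      intro x hx
      have hx := hspec x hx
      simp only [hf]
      rw [mul_left_comm, ← Real.rpow_add hx]
      norm_num
      rw [Real.rpow_neg_one, mul_inv_cancel₀ hx.ne']
    rw [cfc_congr this, cfc_const_one ℝ a]
  have hcomm : a * c = c * a := by
    exact (cfc_commute_cfc (fun x : ℝ => x) f a |>.eq) |> fun h => by rwa [cfc_id' ℝ a] at h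
  have hv : star (polarPart u) * polarPart u = 1 := by
    change star (u * c) * (u * c) = 1
    rw [star_mul, hcs, ← hcac, ha]
    simp only [mul_assoc]
  have hcu : IsUnit c := by
    refine ⟨⟨c, a * c, hcac, ?_⟩, rfl⟩
    rw [hcomm, mul_assoc, hcac]
  have huu : IsUnit u := by
    obtain ⟨y, hy⟩ := (isu _ h2).exists_right_inv
    obtain ⟨z, hz⟩ := (isu _ h1).exists_left_inv
    exact isUnit_iff_exists_and_exists.2 ⟨⟨star u * y, by rw [← mul_assoc, hy]⟩,
      ⟨z * star u, by rw [mul_assoc, hz]⟩⟩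
  have hvu : IsUnit (polarPart u) := huu.mul hcu
  refine Unitary.mem_iff.2 ⟨hv, ?_⟩
  obtain ⟨w, hw⟩ := hvu.exists_right_inv
  have : star (polarPart u) = w := by
    calc star (polarPart u) = star (polarPart u) * (polarPart u * w) := by rw [hw, mul_one]
      _ = w := by rw [← mul_assoc, hv, one_mul]
  rw [this, hw]

lemma QUnit_polarPart_mem {ε : ℝ} (hε : ε ≤ 1) {S : Submodule ℂ B} {n : ℕ} {u : CMat n B}
    (hu : u ∈ QUnit ε S n) : polarPart u ∈ unitary (CMat n B) :=
  polarPart_mem_unitary (hu.2.1.trans_le hε) (hu.2.2.trans_le hε)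

/-- The rank of the spectral projection `χ(a)` of a scalar matrix. -/
def chiRank {n : ℕ} (a : CMat n ℂ) : ℕ := (CStarMatrix.ofMatrix.symm (spectralProj a)).rank

lemma cfc_hom {P D : Type*} [CStarAlgebra P] [CStarAlgebra D] (φ : P →⋆ₐ[ℂ] D) (f : ℝ → ℝ) (x : P)
    (hx : IsSelfAdjoint x) (hf : ContinuousOn f (spectrum ℝ x)) :
    φ (cfc f x) = cfc f (φ x) :=
  StarAlgHom.map_cfc (R := ℝ) (S := ℂ) φ f x hf (AddMonoidHomClass.continuous_of_bound _ 1
    (by simpa only [one_mul] using NonUnitalStarAlgHom.norm_apply_le φ)) hx (hx.map φ)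

lemma cfc_hom_prod {B C D : Type*} [CStarAlgebra B] [CStarAlgebra C] [CStarAlgebra D] (φ : B × C →⋆ₐ[ℂ] D) (f : ℝ → ℝ) (a : B) (b : C) (ha : IsSelfAdjoint a)
    (hb : IsSelfAdjoint b) (hc : ContinuousOn f (spectrum ℝ a ∪ spectrum ℝ b)) :
  φ (cfc f a, cfc f b) = cfc f (φ (a,b)) := by
  have hab : IsSelfAdjoint ((a, b)) := Prod.ext ha hb
  have hc' : ContinuousOn f (spectrum ℝ (a, b)) := by rw [Prod.spectrum_eq]; exact hc
  have h1 := cfc_hom φ f (a, b) hab hc'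
  have h2 := cfc_hom (StarAlgHom.fst ℂ B C) f (a, b) hab hc'
  have h3 := cfc_hom (StarAlgHom.snd ℂ B C) f (a, b) hab hc'
  rw [← h1]
  exact congrArg φ (Prod.ext h2.symm h3.symm)
lemma rank_fromBlocks_diag {n m : Type*} [Fintype n] [Fintype m] [DecidableEq n] [DecidableEq m] (A : Matrix n n ℂ) (D : Matrix m m ℂ) :
   (Matrix.fromBlocks A 0 0 D).rank = A.rank + D.rank := by
  have h : (Matrix.fromBlocks A 0 0 D).mulVecLin =
     (LinearEquiv.sumArrowLequivProdArrow n m ℂ ℂ).symm.toLinearMap ∘ₗ (A.mulVecLin.prodMap D.mulVecLin) ∘ₗ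
      (LinearEquiv.sumArrowLequivProdArrow n m ℂ ℂ).toLinearMap := by
    refine LinearMap.ext fun v => ?_
    ext i
    cases i <;> simp [Matrix.mulVec, dotProduct, Fintype.sum_sum_type]
  have h2 : Module.finrank ℂ (A.mulVecLin.prodMap D.mulVecLin).range = A.rank + D.rank := by
    have e1 := LinearMap.finrank_range_add_finrank_ker (A.mulVecLin.prodMap D.mulVecLin)
    have e2 := LinearMap.finrank_range_add_finrank_ker A.mulVecLin
    have e3 := LinearMap.finrank_range_add_finrank_ker D.mulVecLin
    have e4 : Module.finrank ℂ (A.mulVecLin.range.prod D.mulVecLin.range) = A.rank + D.rank := by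
      let e : (A.mulVecLin.range.prod D.mulVecLin.range) ≃ₗ[ℂ] A.mulVecLin.range × D.mulVecLin.range :=
       { toFun := fun x => (⟨x.1.1, x.2.1⟩, ⟨x.1.2, x.2.2⟩)
         invFun := fun y => ⟨(y.1.1, y.2.1), y.1.2, y.2.2⟩
         map_add' := fun _ _ => rfl
         map_smul' := fun _ _ => rfl
         left_inv := fun _ => rfl
         right_inv := fun _ => rfl }
      rw [e.finrank_eq, Module.finrank_prod]; rfl
    rw [LinearMap.range_prodMap, e4]
  rw [← h2, Matrix.rank, h, LinearMap.range_comp, LinearMap.range_comp_of_range_eq_top, LinearEquiv.finrank_map_eq]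
  exact LinearEquiv.range _

lemma finite_spectrum_scalar {n : ℕ} (a : CMat n ℂ) : (spectrum ℝ a).Finite :=
  Matrix.finite_real_spectrum (A := (CStarMatrix.ofMatrix.symm a : Matrix (Fin n) (Fin n) ℂ))

lemma chiRank_dsum {n m : ℕ} {a : CMat n ℂ} {b : CMat m ℂ} (ha : IsSelfAdjoint a)
    (hb : IsSelfAdjoint b) : chiRank (dsum a b) = chiRank a + chiRank b := by
  have e : dsum (spectralProj a) (spectralProj b) = spectralProj (dsum a b) :=
    cfc_hom_prod (dsumHom ℂ n m) chi a b ha hb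
      (((finite_spectrum_scalar a).union (finite_spectrum_scalar b)).continuousOn _)
  unfold chiRank
  rw [← e, ← rank_fromBlocks_diag]
  exact Matrix.rank_reindex _ _ _

end FunctionalCalculus

/-! ### Filtered C*-algebras and controlled K-theory -/

section Filtered

/-- A filtration of a (non-unital) C*-algebra `A` by linear subspaces `A_r`, `r > 0`. The subspaces
are not required to be closed. -/
structure Filtration (A : Type*) [NonUnitalCStarAlgebra A] where
  sub : ∀ r : ℝ, 0 < r → Submodule ℂ A
  mono : ∀ {r r' : ℝ} (hr : 0 < r) (hr' : 0 < r'), r ≤ r' → sub r hr ≤ sub r' hr'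
  star_mem : ∀ {r : ℝ} (hr : 0 < r) {a : A}, a ∈ sub r hr → star a ∈ sub r hr
  mul_mem : ∀ {r r' : ℝ} (hr : 0 < r) (hr' : 0 < r') {a b : A}, a ∈ sub r hr → b ∈ sub r' hr' →
    a * b ∈ sub (r + r') (add_pos hr hr')
  dense : ∀ a : A, a ∈ closure {b : A | ∃ (r : ℝ) (hr : 0 < r), b ∈ sub r hr}

variable {A : Type*} [NonUnitalCStarAlgebra A]

/-- The subspace `S + ℂ` of the unitization. -/
def addScalars (S : Submodule ℂ A) : Submodule ℂ (Unitization ℂ A) where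
  carrier := {x | x.snd ∈ S}
  zero_mem' := S.zero_mem
  add_mem' := S.add_mem
  smul_mem' c _ hx := S.smul_mem c hx

lemma one_mem_addScalars (S : Submodule ℂ A) : (1 : Unitization ℂ A) ∈ addScalars S :=
  S.zero_mem

lemma addScalars_mono {S S' : Submodule ℂ A} (h : S ≤ S') : addScalars S ≤ addScalars S' :=
  fun _ hx => h hx

/-- The set `P_n^{ε}` of `ε`-quasi-projections over `Ã` with entries in `S + ℂ`. -/
abbrev QP (ε : ℝ) (S : Submodule ℂ A) (n : ℕ) : Set (CMat n (Unitization ℂ A)) :=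
  QProj ε (addScalars S) n

/-- The set `U_n^{ε}` of `ε`-quasi-unitaries over `Ã` with entries in `S + ℂ`. -/
abbrev QU (ε : ℝ) (S : Submodule ℂ A) (n : ℕ) : Set (CMat n (Unitization ℂ A)) :=
  QUnit ε (addScalars S) n

/-- `K_0^{ε,r}(Ã)`. -/
abbrev CtrlK0Unitization (F : Filtration A) (ε r : ℝ) (hε : 0 < ε) (hr : 0 < r) : Type _ :=
  CtrlK0Unital ε hε (addScalars (F.sub r hr)) (one_mem_addScalars _)

/-- The class `[p, ℓ] ∈ K_0^{ε,r}(Ã)`. -/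
def CtrlK0Unitization.cls {F : Filtration A} {ε r : ℝ} (hε : 0 < ε) (hr : 0 < r) {n : ℕ}
    (p : CMat n (Unitization ℂ A)) (hp : p ∈ QP ε (F.sub r hr) n) (l : ℕ) :
    CtrlK0Unitization F ε r hε hr :=
  CtrlK0Unital.cls hε (one_mem_addScalars _) p hp l

/-- `K_0^{ε,r}(A)` for a non-unital filtered C*-algebra `A`: the classes `[p, ℓ] ∈ K_0^{ε,r}(Ã)`
for which the projection `χ(ρ_A(p))` has rank `ℓ`. -/
def CtrlK0 (F : Filtration A) (ε r : ℝ) (hε : 0 < ε) (hr : 0 < r) :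
    AddSubmonoid (CtrlK0Unitization F ε r hε hr) where
  carrier := {x | ∃ (n : ℕ) (p : CMat n (Unitization ℂ A)) (hp : p ∈ QP ε (F.sub r hr) n) (l : ℕ),
    chiRank (mapMat (scalarPart A) p) = l ∧ x = CtrlK0Unitization.cls hε hr p hp l}
  zero_mem' := ⟨0, diagMat 0 0, (qProjFam ε hε _).diag_mem 0, 0, by
    have := Matrix.rank_le_width (CStarMatrix.ofMatrix.symm
      (spectralProj (mapMat (scalarPart A) (diagMat (0 : Unitization ℂ A) 0))))
    exact Nat.le_zero.1 this, rfl⟩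
  add_mem' := by
    rintro _ _ ⟨n, p, hp, l, hl, rfl⟩ ⟨m, q, hq, l', hl', rfl⟩
    refine ⟨n + m, dsum p q, (qProjFam ε hε _).dsum_mem hp hq, l + l', ?_, rfl⟩
    have hsa : ∀ {k : ℕ} {a : CMat k (Unitization ℂ A)}, IsSelfAdjoint a →
        IsSelfAdjoint (mapMat (scalarPart A) a) := fun h => by
      rw [IsSelfAdjoint, ← mapMat_star, h.star_eq]
    rw [mapMat_dsum, chiRank_dsum (hsa hp.2.1) (hsa hq.2.1), hl, hl']

/-- `K_1^{ε,r}(A)` for a non-unital filtered C*-algebra `A`: classes of `(ε, r)`-quasi-unitaries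
over `Ã` under homotopy through `(3ε, 2r)`-quasi-unitaries. -/
def CtrlK1 (F : Filtration A) (ε r : ℝ) (hε : 0 < ε) (hr : 0 < r) :
    AddSubmonoid (qUnitFam (3 * ε) (by positivity) (addScalars (F.sub (2 * r) (by positivity)))
      (one_mem_addScalars _)).Classes :=
  CtrlK1Unital ε hε (addScalars_mono (F.mono hr (by positivity) (by linarith)))
    (one_mem_addScalars _)

/-- The class `[u] ∈ K_1^{ε,r}(A)`. -/
def CtrlK1.cls {F : Filtration A} {ε r : ℝ} (hε : 0 < ε) (hr : 0 < r) {n : ℕ}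
    (u : CMat n (Unitization ℂ A)) (hu : u ∈ QU ε (F.sub r hr) n) : CtrlK1 F ε r hε hr :=
  CtrlK1Unital.cls hε _ (one_mem_addScalars _) u hu

/-- The element `[χ(p)] - [I_ℓ]` of `K_0(Ã)`. -/
def comparisonK0 {n : ℕ} (p : CMat n (Unitization ℂ A)) (l : ℕ) :
    K0Unital (Unitization ℂ A) :=
  K0Unital.cls (spectralProj p) (spectralProj_isStarProjection p) -
    K0Unital.cls (1 : CMat l (Unitization ℂ A)) (IsStarProjection.one _)

/-- The element `[u (u* u)^{-1/2}]` of `K_1(A)`, for an `ε`-quasi-unitary `u` over `Ã`. -/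
def comparisonK1 {ε : ℝ} (hε : ε ≤ 1) {S : Submodule ℂ A} {n : ℕ}
    (u : CMat n (Unitization ℂ A)) (hu : u ∈ QU ε S n) : K1 A :=
  MatFamily.cls (F := unitFam (Unitization ℂ A)) (polarPart u) (QUnit_polarPart_mem hε hu)

end Filtered

/-! ### Modules over a space, propagation, and the localization algebra -/

/-- An ample `X`-module: a non-degenerate `*`-representation `ρ` of `C_0(X)` on a Hilbert space `H`
such that `ρ(f)` is not compact for `f ≠ 0`. -/
structure AmpleModule (X : Type*) [MetricSpace X] [LocallyCompactSpace X]
    (H : Type*) [NormedAddCommGroup H] [InnerProductSpace ℂ H] [CompleteSpace H] where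
  ρ : C₀(X, ℂ) →⋆ₙₐ[ℂ] (H →L[ℂ] H)
  nondegenerate :
    (Submodule.span ℂ {v : H | ∃ (f : C₀(X, ℂ)) (w : H), v = ρ f w}).topologicalClosure = ⊤
  ample : ∀ f : C₀(X, ℂ), f ≠ 0 → ¬ IsCompactOperator (ρ f)

section Compact

variable {H : Type*} [NormedAddCommGroup H] [InnerProductSpace ℂ H] [CompleteSpace H]

lemma isCompactOperator_star {T : H →L[ℂ] H} (hT : IsCompactOperator T) :
    IsCompactOperator (star T : H →L[ℂ] H) := by
  have hTS : IsCompactOperator (T ∘L (star T)) := hT.comp_clm (star T)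
  have h1 := (isCompactOperator_iff_isCompact_closure_image_closedBall
    (T ∘L (star T)).toLinearMap one_pos).1 hTS
  have htb : TotallyBounded ((T ∘L (star T)) '' Metric.closedBall (0 : H) 1) :=
    h1.totallyBounded.subset subset_closure
  refine (isCompactOperator_iff_isCompact_closure_image_closedBall
    (star T : H →L[ℂ] H).toLinearMap one_pos).2 ?_
  refine (TotallyBounded.closure ?_).isCompact_of_isClosed isClosed_closure
  refine Metric.totallyBounded_of_finite_discretization fun ε hε => ?_
  obtain ⟨t, htf, ht⟩ := Metric.totallyBounded_iff.1 htb (ε ^ 2 / 8) (by positivity)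
  have hsel : ∀ v : ((star T : H →L[ℂ] H).toLinearMap '' Metric.closedBall (0 : H) 1),
      ∃ y : t, ∃ x : H, ‖x‖ ≤ 1 ∧ (star T) x = v.1 ∧ dist (T (star T x)) y < ε ^ 2 / 8 := by
    rintro ⟨_, x, hx, rfl⟩
    obtain ⟨y, hy, hxy⟩ := Set.mem_iUnion₂.1 (ht ⟨x, hx, rfl⟩)
    exact ⟨⟨y, hy⟩, x, by simpa using hx, rfl, hxy⟩
  choose F G hG1 hG2 hG3 using hsel
  have : Fintype t := htf.fintype
  refine ⟨t, this, F, fun v w hvw => ?_⟩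
  have h3 : dist (T (star T (G v))) (T (star T (G w))) < ε ^ 2 / 4 := by
    have a := hG3 v
    have b := hG3 w
    rw [← hvw] at b
    calc _ ≤ _ := dist_triangle_right _ _ ((F v : H))
      _ < _ := by linarith
  rw [← hG2 v, ← hG2 w, dist_eq_norm, ← map_sub]
  rw [dist_eq_norm, ← map_sub, ← map_sub] at h3
  set z := G v - G w
  have hz : ‖z‖ ≤ 2 := (norm_sub_le _ _).trans (by linarith [hG1 v, hG1 w])
  have h4 : ‖star T z‖ ^ 2 ≤ ‖T (star T z)‖ * ‖z‖ := by
    have e : inner ℂ (star T z) (star T z) = inner ℂ (T (star T z)) z := by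
      rw [ContinuousLinearMap.star_eq_adjoint, ContinuousLinearMap.adjoint_inner_right]
    have := norm_inner_le_norm (𝕜 := ℂ) (T (star T z)) z
    rw [← e, inner_self_eq_norm_sq_to_K] at this
    simpa using this
  have h5 : ‖star T z‖ ^ 2 < ε ^ 2 := by
    calc _ ≤ _ := h4
      _ ≤ ε ^ 2 / 4 * 2 := mul_le_mul h3.le hz (norm_nonneg _) (by positivity)
      _ < _ := by nlinarith
  exact lt_of_pow_lt_pow_left₀ 2 hε.le h5

end Compact

section CZero

variable {X : Type*} [MetricSpace X]

/-- A compactly supported continuous function, as an element of `C_0(X)`. -/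
def ofCompactSupport (f : X → ℂ) (hf : Continuous f) (hs : HasCompactSupport f) : C₀(X, ℂ) :=
  ⟨⟨f, hf⟩, hs.is_zero_at_infty⟩

lemma norm_le_of_forall {f : C₀(X, ℂ)} {c : ℝ} (hc : 0 ≤ c) (h : ∀ x, ‖f x‖ ≤ c) : ‖f‖ ≤ c := by
  rw [← ZeroAtInftyContinuousMap.norm_toBCF_eq_norm]
  exact (BoundedContinuousFunction.norm_le hc).2 h

variable [LocallyCompactSpace X]

lemma exists_cutoff {K V : Set X} (hK : IsCompact K) (hV : IsOpen V) (hKV : K ⊆ V) :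
    ∃ f : C₀(X, ℂ), (∀ x ∈ K, f x = 1) ∧ IsCompact (tsupport f) ∧ tsupport f ⊆ V ∧
      ∀ x, ∃ s ∈ Set.Icc (0 : ℝ) 1, f x = s := by
  obtain ⟨f, h1, h2, h3, h4⟩ := exists_continuousMap_one_of_isCompact_subset_isOpen hK hV hKV
  have e : tsupport (fun x => (f x : ℂ)) = tsupport f := by
    unfold tsupport
    congr 1
    ext x
    simp
  refine ⟨ofCompactSupport (fun x => (f x : ℂ)) (by fun_prop) ?_, ?_, ?_, ?_, ?_⟩
  · rw [HasCompactSupport, e]; exact h2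
  · intro x hx
    change ((f x : ℝ) : ℂ) = 1
    rw [h1 hx]; simp
  · change IsCompact (tsupport fun x => (f x : ℂ))
    rwa [e]
  · change (tsupport fun x => (f x : ℂ)) ⊆ V
    rwa [e]
  · exact fun x => ⟨f x, h4 x, rfl⟩

/-- A function in `C_0(X)` with support in a compact set `K` lies in every ideal of `C_0(X)` that
has no common zero on `K`. -/
lemma mem_ideal (J : Set C₀(X, ℂ)) (h0 : (0 : C₀(X, ℂ)) ∈ J)
    (hadd : ∀ f ∈ J, ∀ g ∈ J, f + g ∈ J) (hmul : ∀ h, ∀ f ∈ J, h * f ∈ J)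
    {K : Set X} (hK : IsCompact K) (hJ : ∀ x ∈ K, ∃ f ∈ J, f x ≠ 0) (f : C₀(X, ℂ))
    (hf : tsupport f ⊆ K) : f ∈ J := by
  have key : ∃ F ∈ J, (∀ x, ∃ s : ℝ, 0 ≤ s ∧ F x = s) ∧ ∀ x ∈ K, F x ≠ 0 := by
    refine hK.induction_on (p := fun s => ∃ F ∈ J, (∀ x, ∃ s : ℝ, 0 ≤ s ∧ F x = s) ∧
      ∀ x ∈ s, F x ≠ 0) ?_ ?_ ?_ ?_
    · exact ⟨0, h0, fun x => ⟨0, le_rfl, by simp⟩, by simp⟩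
    · rintro s t hst ⟨F, hF, h1, h2⟩
      exact ⟨F, hF, h1, fun x hx => h2 x (hst hx)⟩
    · rintro s t ⟨F, hF, h1, h2⟩ ⟨G, hG, h3, h4⟩
      refine ⟨F + G, hadd F hF G hG, fun x => ?_, fun x hx => ?_⟩
      · obtain ⟨a, ha, ha'⟩ := h1 x
        obtain ⟨b, hb, hb'⟩ := h3 x
        exact ⟨a + b, by positivity, by simp [ha', hb']⟩
      · obtain ⟨a, ha, ha'⟩ := h1 x
        obtain ⟨b, hb, hb'⟩ := h3 x
        have : (F + G) x = ((a + b : ℝ) : ℂ) := by simp [ha', hb']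
        rw [this]
        norm_cast
        rcases hx with hx | hx
        · have := h2 x hx
          rw [ha'] at this
          have : a ≠ 0 := by exact_mod_cast this
          have := lt_of_le_of_ne ha this.symm
          positivity
        · have := h4 x hx
          rw [hb'] at this
          have : b ≠ 0 := by exact_mod_cast this
          have := lt_of_le_of_ne hb this.symm
          positivity
    · intro x hx
      obtain ⟨g, hg, hgx⟩ := hJ x hx
      refine ⟨{y | g y ≠ 0}, mem_nhdsWithin_of_mem_nhds ?_, star g * g, hmul _ g hg, fun y => ?_,
        fun y hy => ?_⟩
      · exact (isOpen_ne_fun (map_continuous g) continuous_const).mem_nhds hgx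
      · refine ⟨‖g y‖ ^ 2, by positivity, ?_⟩
        have := Complex.conj_mul' (g y)
        push_cast
        exact this
      · have : (star g * g) y = star (g y) * g y := rfl
        rw [this]
        exact mul_ne_zero (star_ne_zero.2 hy) hy
  obtain ⟨F, hFJ, -, hF⟩ := key
  have hcont : Continuous fun x => f x / F x := by
    rw [continuous_iff_continuousAt]
    intro x
    by_cases hx : F x = 0
    · have hx' : x ∉ tsupport f := fun h => hF x (hf h) hx
      have : (fun x => f x / F x) =ᶠ[nhds x] fun _ => 0 := by
        filter_upwards [(isClosed_tsupport f).isOpen_compl.mem_nhds hx'] with y hy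
        simp [image_eq_zero_of_notMem_tsupport hy]
      exact (continuousAt_const (y := (0 : ℂ))).congr this.symm
    · exact (map_continuous f).continuousAt.div (map_continuous F).continuousAt hx
  have hcs : HasCompactSupport fun x => f x / F x := by
    refine HasCompactSupport.intro hK fun x hx => ?_
    have : x ∉ tsupport f := fun h => hx (hf h)
    simp [image_eq_zero_of_notMem_tsupport this]
  have : f = ofCompactSupport _ hcont hcs * F := by
    ext x
    change f x = f x / F x * F x
    by_cases hx : F x = 0
    · have hx' : x ∉ tsupport f := fun h => hF x (hf h) hx
      simp [image_eq_zero_of_notMem_tsupport hx', hx]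
    · field_simp
  rw [this]
  exact hmul _ F hFJ

end CZero

namespace AmpleModule

variable {X : Type*} [MetricSpace X] [LocallyCompactSpace X]
variable {H : Type*} [NormedAddCommGroup H] [InnerProductSpace ℂ H] [CompleteSpace H]
variable (M : AmpleModule X H)

/-- The support of an operator `T`: the complement of the set of those `(y, x)` for which there are
`f, g ∈ C_0(X)` with `g T f = 0`, `f(x) ≠ 0` and `g(y) ≠ 0`. -/
def supp (T : H →L[ℂ] H) : Set (X × X) :=
  {z | ∃ f g : C₀(X, ℂ), M.ρ g * T * M.ρ f = 0 ∧ f z.2 ≠ 0 ∧ g z.1 ≠ 0}ᶜ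

/-- The propagation `prop(T) = sup {d(x, y) : (y, x) ∈ supp(T)} ∈ [0, ∞]`. -/
def propagation (T : H →L[ℂ] H) : ℝ≥0∞ := ⨆ z ∈ M.supp T, edist z.2 z.1

variable {M}

lemma notMem_supp {T : H →L[ℂ] H} {z : X × X} : z ∉ M.supp T ↔
    ∃ f g : C₀(X, ℂ), M.ρ g * T * M.ρ f = 0 ∧ f z.2 ≠ 0 ∧ g z.1 ≠ 0 := by
  simp [supp]

lemma edist_le_propagation {T : H →L[ℂ] H} {z : X × X} (h : z ∈ M.supp T) :
    edist z.2 z.1 ≤ M.propagation T :=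
  le_iSup₂ (f := fun (z : X × X) (_ : z ∈ M.supp T) => edist z.2 z.1) z h

lemma exists_bump (x : X) {δ : ℝ} (hδ : 0 < δ) :
    ∃ f : C₀(X, ℂ), f x = 1 ∧ IsCompact (tsupport f) ∧ tsupport f ⊆ Metric.ball x δ := by
  obtain ⟨f, h1, h2, h3, -⟩ := exists_cutoff (isCompact_singleton (x := x))
    (Metric.isOpen_ball (x := x) (ε := δ)) (by simpa using hδ)
  exact ⟨f, h1 x rfl, h2, h3⟩

lemma supp_zero : M.supp (0 : H →L[ℂ] H) = ∅ := by
  ext z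
  simp only [Set.mem_empty_iff_false, iff_false, notMem_supp]
  obtain ⟨f, hf, -⟩ := exists_bump z.2 one_pos
  obtain ⟨g, hg, -⟩ := exists_bump z.1 one_pos
  exact ⟨f, g, by simp, by simp [hf], by simp [hg]⟩

lemma supp_add (S T : H →L[ℂ] H) : M.supp (S + T) ⊆ M.supp S ∪ M.supp T := by
  intro z hz
  by_contra h
  simp only [Set.mem_union, not_or, notMem_supp] at h
  obtain ⟨⟨f, g, h1, h2, h3⟩, f', g', h1', h2', h3'⟩ := h
  refine notMem_supp.2 ⟨f * f', g * g', ?_, mul_ne_zero h2 h2', mul_ne_zero h3 h3'⟩ hz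
  rw [mul_add, add_mul]
  have e1 : M.ρ (g * g') * S * M.ρ (f * f') = 0 := by
    rw [mul_comm g, map_mul, map_mul]
    calc M.ρ g' * M.ρ g * S * (M.ρ f * M.ρ f') = M.ρ g' * (M.ρ g * S * M.ρ f) * M.ρ f' := by
          simp only [mul_assoc]
      _ = 0 := by rw [h1, mul_zero, zero_mul]
  have e2 : M.ρ (g * g') * T * M.ρ (f * f') = 0 := by
    rw [mul_comm f, map_mul, map_mul]
    calc M.ρ g * M.ρ g' * T * (M.ρ f' * M.ρ f) = M.ρ g * (M.ρ g' * T * M.ρ f') * M.ρ f := by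
          simp only [mul_assoc]
      _ = 0 := by rw [h1', mul_zero, zero_mul]
  rw [e1, e2, add_zero]

lemma supp_smul (c : ℂ) (T : H →L[ℂ] H) : M.supp (c • T) ⊆ M.supp T := by
  intro z hz
  by_contra h
  obtain ⟨f, g, h1, h2, h3⟩ := notMem_supp.1 h
  refine notMem_supp.2 ⟨f, g, ?_, h2, h3⟩ hz
  rw [mul_smul_comm, smul_mul_assoc, h1, smul_zero]

lemma propagation_zero : M.propagation (0 : H →L[ℂ] H) = 0 := by
  simp [propagation, supp_zero]

lemma propagation_add (S T : H →L[ℂ] H) :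
    M.propagation (S + T) ≤ max (M.propagation S) (M.propagation T) := by
  refine iSup₂_le fun z hz => ?_
  rcases supp_add S T hz with h | h
  · exact (edist_le_propagation h).trans (le_max_left _ _)
  · exact (edist_le_propagation h).trans (le_max_right _ _)

lemma propagation_smul (c : ℂ) (T : H →L[ℂ] H) : M.propagation (c • T) ≤ M.propagation T :=
  iSup₂_le fun _ hz => edist_le_propagation (supp_smul c T hz)

lemma propagation_star (T : H →L[ℂ] H) : M.propagation (star T) ≤ M.propagation T := by
  refine iSup₂_le fun z hz => ?_
  have : (z.2, z.1) ∈ M.supp T := by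
    by_contra h
    obtain ⟨f, g, h1, h2, h3⟩ := notMem_supp.1 h
    refine notMem_supp.2 ⟨star g, star f, ?_, star_ne_zero.2 h3, star_ne_zero.2 h2⟩ hz
    have := congrArg star h1
    rw [star_mul, star_mul, ← map_star, ← map_star, star_zero, ← mul_assoc] at this
    exact this
  rw [edist_comm]
  exact edist_le_propagation (z := (z.2, z.1)) this

lemma block_eq_zero (T : H →L[ℂ] H) {f g : C₀(X, ℂ)} (hf : IsCompact (tsupport f))
    (hg : IsCompact (tsupport g))
    (h : ∀ y ∈ tsupport g, ∀ x ∈ tsupport f, (y, x) ∉ M.supp T) : M.ρ g * T * M.ρ f = 0 := by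
  have step : ∀ y ∈ tsupport g, ∃ g' : C₀(X, ℂ), M.ρ g' * T * M.ρ f = 0 ∧ g' y ≠ 0 := by
    intro y hy
    refine mem_ideal {f | ∃ g' : C₀(X, ℂ), M.ρ g' * T * M.ρ f = 0 ∧ g' y ≠ 0} ?_ ?_ ?_ hf ?_ f
      subset_rfl
    · obtain ⟨g', hg', -⟩ := exists_bump y one_pos
      exact ⟨g', by simp, by simp [hg']⟩
    · rintro f1 ⟨g1, h1, h1'⟩ f2 ⟨g2, h2, h2'⟩
      refine ⟨g1 * g2, ?_, mul_ne_zero h1' h2'⟩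
      rw [map_add, mul_add]
      have e1 : M.ρ (g1 * g2) * T * M.ρ f1 = 0 := by
        rw [mul_comm g1, map_mul, mul_assoc, mul_assoc, ← mul_assoc (M.ρ g1), h1, mul_zero]
      have e2 : M.ρ (g1 * g2) * T * M.ρ f2 = 0 := by
        rw [map_mul, mul_assoc, mul_assoc, ← mul_assoc (M.ρ g2), h2, mul_zero]
      rw [e1, e2, add_zero]
    · rintro k f1 ⟨g1, h1, h1'⟩
      refine ⟨g1, ?_, h1'⟩
      rw [mul_comm k, map_mul, ← mul_assoc, h1, zero_mul]
    · intro x hx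
      obtain ⟨f', g', h1, h2, h3⟩ := notMem_supp.1 (h y hy x hx)
      exact ⟨f', ⟨g', h1, h3⟩, h2⟩
  refine mem_ideal {g | M.ρ g * T * M.ρ f = 0} ?_ ?_ ?_ hg ?_ g subset_rfl
  · simp
  · intro g1 h1 g2 h2
    simp only [Set.mem_ofPred_eq] at h1 h2 ⊢
    rw [map_add, add_mul, add_mul, h1, h2, add_zero]
  · intro k g1 h1
    simp only [Set.mem_ofPred_eq] at h1 ⊢
    rw [map_mul, mul_assoc, mul_assoc, ← mul_assoc (M.ρ g1), h1, mul_zero]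
  · intro y hy
    obtain ⟨g', h1, h2⟩ := step y hy
    exact ⟨g', h1, h2⟩

lemma approx_vector (v : H) : ∀ ε > 0, ∃ K : Set X, IsCompact K ∧ ∀ h : C₀(X, ℂ),
    (∀ x ∈ K, h x = 1) → (∀ x, ∃ s ∈ Set.Icc (0 : ℝ) 1, h x = s) → ‖M.ρ h v - v‖ ≤ ε := by
  have hn : ∀ h : C₀(X, ℂ), (∀ x, ∃ s ∈ Set.Icc (0 : ℝ) 1, h x = s) → ‖M.ρ h‖ ≤ 1 := by
    intro h hh
    refine (NonUnitalStarAlgHom.norm_apply_le M.ρ h).trans (norm_le_of_forall zero_le_one ?_)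
    intro x
    obtain ⟨s, hs, hx⟩ := hh x
    rw [hx, Complex.norm_real, Real.norm_of_nonneg hs.1]
    exact hs.2
  have hv : v ∈ closure ((Submodule.span ℂ {v : H | ∃ (f : C₀(X, ℂ)) (w : H), v = M.ρ f w} :
      Submodule ℂ H) : Set H) := by
    have := M.nondegenerate
    rw [← Submodule.topologicalClosure_coe, this]
    trivial
  have hspan : ∀ u ∈ Submodule.span ℂ {v : H | ∃ (f : C₀(X, ℂ)) (w : H), v = M.ρ f w},
      ∀ ε > 0, ∃ K : Set X, IsCompact K ∧ ∀ h : C₀(X, ℂ),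
      (∀ x ∈ K, h x = 1) → (∀ x, ∃ s ∈ Set.Icc (0 : ℝ) 1, h x = s) → ‖M.ρ h u - u‖ ≤ ε := by
    intro u hu
    induction hu using Submodule.span_induction with
    | mem u hu =>
      obtain ⟨k, w, rfl⟩ := hu
      intro ε hε
      set η := ε / (‖w‖ + 1) with hη
      have hη0 : 0 < η := by positivity
      obtain ⟨K, hK, hKk⟩ : ∃ K : Set X, IsCompact K ∧ ∀ x ∉ K, ‖k x‖ < η := by
        have h1 := ZeroAtInftyContinuousMapClass.zero_at_infty k
        have h2 := h1 (Metric.ball_mem_nhds 0 hη0)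
        obtain ⟨K, hK, hK'⟩ := Filter.mem_cocompact.1 h2
        exact ⟨K, hK, fun x hx => by simpa using hK' hx⟩
      refine ⟨K, hK, fun h h1 h2 => ?_⟩
      have e : M.ρ h (M.ρ k w) - M.ρ k w = M.ρ (h * k - k) w := by
        rw [map_sub, map_mul]; rfl
      have hle : ‖h * k - k‖ ≤ η := by
        refine norm_le_of_forall hη0.le fun x => ?_
        have e1 : (h * k - k) x = (h x - 1) * k x := by
          simp only [ZeroAtInftyContinuousMap.sub_apply, ZeroAtInftyContinuousMap.mul_apply]; ring
        rw [e1]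
        by_cases hx : x ∈ K
        · rw [h1 x hx]; simpa using hη0.le
        · obtain ⟨s, hs, hsx⟩ := h2 x
          rw [hsx, norm_mul]
          have : ‖(s : ℂ) - 1‖ ≤ 1 := by
            rw [← Complex.ofReal_one, ← Complex.ofReal_sub, Complex.norm_real, Real.norm_eq_abs,
              abs_le]
            constructor <;> linarith [hs.1, hs.2]
          calc _ ≤ 1 * ‖k x‖ := by gcongr
            _ ≤ η := by rw [one_mul]; exact (hKk x hx).le
      rw [e]
      calc _ ≤ ‖M.ρ (h * k - k)‖ * ‖w‖ := ContinuousLinearMap.le_opNorm _ _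
        _ ≤ η * (‖w‖ + 1) := by
            gcongr
            · exact (NonUnitalStarAlgHom.norm_apply_le M.ρ _).trans hle
            · linarith
        _ = ε := by rw [hη]; field_simp
    | zero => exact fun ε hε => ⟨∅, isCompact_empty, fun h _ _ => by simpa using hε.le⟩
    | add u w _ _ hu hw =>
      intro ε hε
      obtain ⟨K, hK, hK'⟩ := hu (ε / 2) (by positivity)
      obtain ⟨L, hL, hL'⟩ := hw (ε / 2) (by positivity)
      refine ⟨K ∪ L, hK.union hL, fun h h1 h2 => ?_⟩
      have a := hK' h (fun x hx => h1 x (Or.inl hx)) h2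
      have b := hL' h (fun x hx => h1 x (Or.inr hx)) h2
      rw [map_add, add_sub_add_comm]
      exact (norm_add_le _ _).trans (by linarith)
    | smul c u _ hu =>
      intro ε hε
      obtain ⟨K, hK, hK'⟩ := hu (ε / (‖c‖ + 1)) (by positivity)
      refine ⟨K, hK, fun h h1 h2 => ?_⟩
      have a := hK' h h1 h2
      rw [map_smul, ← smul_sub, norm_smul]
      calc _ ≤ (‖c‖ + 1) * (ε / (‖c‖ + 1)) := by gcongr; linarith
        _ = ε := by field_simp
  intro ε hε
  obtain ⟨u, hu, huv⟩ := Metric.mem_closure_iff.1 hv (ε / 4) (by positivity)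
  obtain ⟨K, hK, hK'⟩ := hspan u hu (ε / 2) (by positivity)
  refine ⟨K, hK, fun h h1 h2 => ?_⟩
  have a := hK' h h1 h2
  rw [dist_eq_norm] at huv
  have e : M.ρ h v - v = M.ρ h (v - u) + (M.ρ h u - u) - (v - u) := by
    rw [map_sub]; abel
  have b : ‖M.ρ h (v - u)‖ ≤ ε / 4 :=
    calc _ ≤ ‖M.ρ h‖ * ‖v - u‖ := ContinuousLinearMap.le_opNorm _ _
      _ ≤ 1 * (ε / 4) := by gcongr; exact hn h h2
      _ = _ := one_mul _
  rw [e]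
  calc _ ≤ ‖M.ρ h (v - u)‖ + ‖M.ρ h u - u‖ + ‖v - u‖ :=
        (norm_sub_le _ _).trans (by gcongr; exact norm_add_le _ _)
    _ ≤ ε := by linarith

lemma mul_eq_zero_of_cutoffs {S T : H →L[ℂ] H}
    (h : ∀ k : C₀(X, ℂ), IsCompact (tsupport k) → S * M.ρ k * T = 0) : S * T = 0 := by
  ext w
  change S (T w) = 0
  refine norm_le_zero_iff.1 (le_of_forall_pos_le_add fun ε hε => ?_)
  obtain ⟨K, hK, hK'⟩ := approx_vector (M := M) (T w) (ε / (‖S‖ + 1)) (by positivity)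
  obtain ⟨k, h1, h2, -, h3⟩ := exists_cutoff hK isOpen_univ (Set.subset_univ K)
  have a := hK' k h1 h3
  have b : S (M.ρ k (T w)) = 0 := DFunLike.congr_fun (h k h2) w
  have e : S (T w) = -S (M.ρ k (T w) - T w) := by rw [map_sub, b]; simp
  rw [e, norm_neg, zero_add]
  calc _ ≤ ‖S‖ * ‖M.ρ k (T w) - T w‖ := ContinuousLinearMap.le_opNorm _ _
    _ ≤ (‖S‖ + 1) * (ε / (‖S‖ + 1)) := by gcongr; linarith
    _ = ε := by field_simp

lemma propagation_mul (S T : H →L[ℂ] H) :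
    M.propagation (S * T) ≤ M.propagation S + M.propagation T := by
  refine iSup₂_le fun ⟨z, x⟩ hzx => ?_
  by_contra! hlt
  simp only at hlt
  rw [edist_dist] at hlt
  have hfin := hlt.trans ENNReal.ofReal_lt_top
  have hS : M.propagation S ≠ ⊤ := fun h => by simp [h] at hfin
  have hT : M.propagation T ≠ ⊤ := fun h => by simp [h] at hfin
  set b := (M.propagation S).toReal with hb
  set a := (M.propagation T).toReal with ha
  have hb0 : 0 ≤ b := ENNReal.toReal_nonneg
  have ha0 : 0 ≤ a := ENNReal.toReal_nonneg
  have hab : b + a < dist x z := by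
    rw [← ENNReal.ofReal_toReal hS, ← ENNReal.ofReal_toReal hT, ← ENNReal.ofReal_add hb0 ha0] at hlt
    exact (ENNReal.ofReal_lt_ofReal_iff_of_nonneg (by positivity)).1 hlt
  have far : ∀ (R : H →L[ℂ] H), M.propagation R ≠ ⊤ → ∀ y w : X,
      (M.propagation R).toReal < dist w y → (y, w) ∉ M.supp R := by
    intro R hR y w hd hmem
    have := edist_le_propagation hmem
    rw [edist_dist, ← ENNReal.ofReal_toReal hR,
      ENNReal.ofReal_le_ofReal_iff ENNReal.toReal_nonneg] at this
    exact absurd hd (not_lt.2 this)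
  set δ := (dist x z - b - a) / 5 with hδ
  have hδ0 : 0 < δ := by simp only [hδ]; linarith
  obtain ⟨f, hf1, hf2, hf3⟩ := exists_bump x hδ0
  obtain ⟨g, hg1, hg2, hg3⟩ := exists_bump z hδ0
  refine notMem_supp.2 ⟨f, g, ?_, by simp [hf1], by simp [hg1]⟩ hzx
  have : M.ρ g * (S * T) * M.ρ f = (M.ρ g * S) * (T * M.ρ f) := by simp only [mul_assoc]
  rw [this]
  refine mul_eq_zero_of_cutoffs (M := M) fun k hk => ?_
  let φ : X → ℝ := fun w => max 0 (min 1 ((a + 3 * δ - dist w x) / δ))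
  have hφ : Continuous φ := by fun_prop
  have hφ1 : ∀ w, dist w x ≤ a + 2 * δ → φ w = 1 := by
    intro w hw
    have : 1 ≤ (a + 3 * δ - dist w x) / δ := by rw [le_div_iff₀ hδ0]; linarith
    simp [φ, this]
  have hφ0 : ∀ w, a + 3 * δ ≤ dist w x → φ w = 0 := by
    intro w hw
    have : (a + 3 * δ - dist w x) / δ ≤ 0 := div_nonpos_of_nonpos_of_nonneg (by linarith) hδ0.le
    simp [φ, this]
  have hkc : HasCompactSupport k := hk
  let k1 : C₀(X, ℂ) := ofCompactSupport (fun w => (φ w : ℂ) * k w) (by fun_prop) hkc.mul_left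
  let k2 : C₀(X, ℂ) := ofCompactSupport (fun w => (1 - φ w : ℂ) * k w) (by fun_prop) hkc.mul_left
  have hk1s : tsupport k1 ⊆ {w | dist w x ≤ a + 3 * δ} := by
    refine closure_minimal (fun w hw => ?_) (isClosed_le (by fun_prop) continuous_const)
    by_contra h
    refine hw ?_
    change (φ w : ℂ) * k w = 0
    rw [hφ0 w (not_le.1 h).le]; simp
  have hk2s : tsupport k2 ⊆ {w | a + 2 * δ ≤ dist w x} := by
    refine closure_minimal (fun w hw => ?_) (isClosed_le continuous_const (by fun_prop))
    by_contra h
    refine hw ?_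
    change (1 - φ w : ℂ) * k w = 0
    rw [hφ1 w (not_le.1 h).le]; simp
  have hkk : k = k1 + k2 := by
    ext w
    change k w = (φ w : ℂ) * k w + (1 - φ w : ℂ) * k w
    ring
  have e1 : M.ρ g * S * M.ρ k1 = 0 := by
    refine block_eq_zero S (hkc.mul_left : HasCompactSupport fun w => (φ w : ℂ) * k w) hg2
      fun y hy w hw => far S hS y w ?_
    have h1 := hk1s hw
    have h2 := hg3 hy
    simp only [Set.mem_ofPred_eq, Metric.mem_ball] at h1 h2
    have h3 := dist_triangle4 x w y z
    rw [dist_comm x w] at h3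
    have : dist x z = 5 * δ + b + a := by simp only [hδ]; ring
    linarith
  have e2 : M.ρ k2 * T * M.ρ f = 0 := by
    refine block_eq_zero T hf2 (hkc.mul_left : HasCompactSupport fun w => (1 - φ w : ℂ) * k w)
      fun w hw x' hx' => far T hT w x' ?_
    have h1 := hk2s hw
    have h2 := hf3 hx'
    simp only [Set.mem_ofPred_eq, Metric.mem_ball] at h1 h2
    have h3 := dist_triangle w x' x
    rw [dist_comm w x'] at h3
    linarith
  rw [hkk, map_add, mul_add, add_mul, e1, zero_mul, zero_add]
  calc M.ρ g * S * M.ρ k2 * (T * M.ρ f) = M.ρ g * S * (M.ρ k2 * T * M.ρ f) := by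
        simp only [mul_assoc]
    _ = 0 := by rw [e2, mul_zero]

variable (M) in
/-- The algebraic Roe algebra `C*_alg(H)`: the locally compact operators of finite propagation.
Local compactness is required on both sides, so that this is a `*`-algebra. -/
def algRoe : NonUnitalStarSubalgebra ℂ (H →L[ℂ] H) where
  carrier := {T | (∀ f : C₀(X, ℂ), IsCompactOperator (T * M.ρ f) ∧ IsCompactOperator (M.ρ f * T)) ∧
    M.propagation T < ⊤}
  zero_mem' := ⟨fun f => by simp only [zero_mul, mul_zero]; exact ⟨isCompactOperator_zero,
    isCompactOperator_zero⟩, by simp [propagation_zero]⟩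
  add_mem' {S T} hS hT := ⟨fun f => by
      rw [add_mul, mul_add]
      exact ⟨(hS.1 f).1.add (hT.1 f).1, (hS.1 f).2.add (hT.1 f).2⟩,
    (propagation_add S T).trans_lt (max_lt hS.2 hT.2)⟩
  smul_mem' c T hT := ⟨fun f => by
      rw [smul_mul_assoc, mul_smul_comm]
      exact ⟨(hT.1 f).1.smul c, (hT.1 f).2.smul c⟩,
    (propagation_smul c T).trans_lt hT.2⟩
  mul_mem' {S T} hS hT := ⟨fun f => by
      rw [mul_assoc, ← mul_assoc (M.ρ f)]
      exact ⟨(hT.1 f).1.clm_comp S, (hS.1 f).2.comp_clm T⟩,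
    (propagation_mul S T).trans_lt (ENNReal.add_lt_top.2 ⟨hS.2, hT.2⟩)⟩
  star_mem' {T} hT := ⟨fun f => by
      have h1 := isCompactOperator_star (hT.1 (star f)).1
      have h2 := isCompactOperator_star (hT.1 (star f)).2
      rw [star_mul, map_star, star_star] at h1 h2
      exact ⟨h2, h1⟩,
    (propagation_star T).trans_lt hT.2⟩

end AmpleModule

section LocalizationAlgebra

open Filter BoundedContinuousFunction

/-- The product of bounded uniformly continuous functions is uniformly continuous. -/
lemma uniformContinuous_bilin {α E F G : Type*} [PseudoMetricSpace α] [NormedAddCommGroup E]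
    [NormedAddCommGroup F] [NormedAddCommGroup G] (L : E → F → G)
    (hL1 : ∀ x x' y, L (x - x') y = L x y - L x' y) (hL2 : ∀ x y y', L x (y - y') = L x y - L x y')
    (hL : ∀ x y, ‖L x y‖ ≤ ‖x‖ * ‖y‖)
    {u : α → E} {v : α → F} {a b : ℝ}
    (hu : UniformContinuous u) (hv : UniformContinuous v) (hua : ∀ x, ‖u x‖ ≤ a)
    (hvb : ∀ x, ‖v x‖ ≤ b) : UniformContinuous fun x => L (u x) (v x) := by
  rw [Metric.uniformContinuous_iff] at *
  intro ε hε
  obtain ⟨δ, hδ, h1⟩ := hu (ε / 2 / (|b| + 1)) (by positivity)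
  obtain ⟨δ', hδ', h2⟩ := hv (ε / 2 / (|a| + 1)) (by positivity)
  refine ⟨min δ δ', lt_min hδ hδ', fun {x y} hxy => ?_⟩
  have e1 := h1 (hxy.trans_le (min_le_left _ _))
  have e2 := h2 (hxy.trans_le (min_le_right _ _))
  rw [dist_eq_norm] at e1 e2 ⊢
  have e : L (u x) (v x) - L (u y) (v y) = L (u x - u y) (v x) + L (u y) (v x - v y) := by
    rw [hL1, hL2]; abel
  have hb : ‖v x‖ ≤ |b| + 1 := (hvb x).trans (by linarith [le_abs_self b])
  have ha : ‖u y‖ ≤ |a| + 1 := (hua y).trans (by linarith [le_abs_self a])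
  have b0 : 0 < |b| + 1 := by positivity
  have a0 : 0 < |a| + 1 := by positivity
  rw [lt_div_iff₀ b0] at e1
  rw [lt_div_iff₀ a0] at e2
  rw [e]
  calc _ ≤ ‖L (u x - u y) (v x)‖ + ‖L (u y) (v x - v y)‖ := norm_add_le _ _
    _ ≤ ‖u x - u y‖ * ‖v x‖ + ‖u y‖ * ‖v x - v y‖ := add_le_add (hL _ _) (hL _ _)
    _ ≤ ‖u x - u y‖ * (|b| + 1) + (|a| + 1) * ‖v x - v y‖ := by gcongr
    _ < ε := by linarith

/-- The half line `[1, ∞)`. -/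
abbrev Ray : Type := Set.Ici (1 : ℝ)

variable {X : Type*} [MetricSpace X] [LocallyCompactSpace X]
variable {H : Type*} [NormedAddCommGroup H] [InnerProductSpace ℂ H] [CompleteSpace H]
variable (M : AmpleModule X H)

/-- The algebraic localization algebra `C*_{L,alg}(H)`: the bounded uniformly continuous functions
`f : [1, ∞) → C*_alg(H)` with `prop(f(t)) → 0` as `t → ∞`. -/
def algLoc : NonUnitalStarSubalgebra ℂ (Ray →ᵇ (H →L[ℂ] H)) where
  carrier := {f | UniformContinuous f ∧ (∀ t, f t ∈ M.algRoe) ∧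
    Tendsto (fun t => M.propagation (f t)) atTop (nhds 0)}
  zero_mem' := ⟨uniformContinuous_const, fun _ => M.algRoe.zero_mem, by
    simp [AmpleModule.propagation_zero]⟩
  add_mem' {f g} hf hg := by
    refine ⟨hf.1.add hg.1, fun t => M.algRoe.add_mem (hf.2.1 t) (hg.2.1 t), ?_⟩
    have := hf.2.2.max hg.2.2
    rw [max_self] at this
    exact tendsto_of_tendsto_of_tendsto_of_le_of_le tendsto_const_nhds this (fun _ => zero_le)
      fun t => AmpleModule.propagation_add _ _
  smul_mem' c f hf := by
    refine ⟨hf.1.const_smul c, fun t => M.algRoe.smul_mem' c (hf.2.1 t), ?_⟩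
    exact tendsto_of_tendsto_of_tendsto_of_le_of_le tendsto_const_nhds hf.2.2 (fun _ => zero_le)
      fun t => AmpleModule.propagation_smul _ _
  mul_mem' {f g} hf hg := by
    refine ⟨?_, fun t => M.algRoe.mul_mem (hf.2.1 t) (hg.2.1 t), ?_⟩
    · exact uniformContinuous_bilin (fun x y : H →L[ℂ] H => x * y)
        (fun _ _ _ => sub_mul _ _ _) (fun _ _ _ => mul_sub _ _ _) (fun x y => norm_mul_le x y)
        hf.1 hg.1 (fun t => f.norm_coe_le_norm t) (fun t => g.norm_coe_le_norm t)
    · have := hf.2.2.add hg.2.2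
      rw [add_zero] at this
      exact tendsto_of_tendsto_of_tendsto_of_le_of_le tendsto_const_nhds this (fun _ => zero_le)
        fun t => AmpleModule.propagation_mul _ _
  star_mem' {f} hf := by
    refine ⟨?_, fun t => M.algRoe.star_mem' (hf.2.1 t), ?_⟩
    · have : UniformContinuous (star : (H →L[ℂ] H) → (H →L[ℂ] H)) :=
        (starₗᵢ ℂ : (H →L[ℂ] H) ≃ₗᵢ⋆[ℂ] (H →L[ℂ] H)).isometry.uniformContinuous
      exact this.comp hf.1
    · exact tendsto_of_tendsto_of_tendsto_of_le_of_le tendsto_const_nhds hf.2.2 (fun _ => zero_le)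
        fun t => AmpleModule.propagation_star _

/-- The localization algebra `C*_L(H)`: the completion of `C*_{L,alg}(H)` in the supremum norm. -/
abbrev LocAlg : Type _ := (algLoc M).topologicalClosure

instance : IsClosed ((algLoc M).topologicalClosure : Set (Ray →ᵇ (H →L[ℂ] H))) :=
  NonUnitalStarSubalgebra.isClosed_topologicalClosure _

/-- `C*_{L,alg}(H)` as a subspace of `C*_L(H)`. -/
def algLocSub : Submodule ℂ (LocAlg M) :=
  (algLoc M).toNonUnitalSubalgebra.toSubmodule.comap
    ((algLoc M).topologicalClosure).toNonUnitalSubalgebra.toSubmodule.subtype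

variable {M}

lemma mem_algLoc {f : Ray →ᵇ (H →L[ℂ] H)} : f ∈ algLoc M ↔ UniformContinuous f ∧
    (∀ t, f t ∈ M.algRoe) ∧ Tendsto (fun t => M.propagation (f t)) atTop (nhds 0) := Iff.rfl

lemma mem_algLocSub {f : LocAlg M} :
    f ∈ algLocSub M ↔ (f : Ray →ᵇ (H →L[ℂ] H)) ∈ algLoc M := Iff.rfl

/-- The function that is `0` on `(-∞, j - 1]`, `1` on `[j, ∞)` and linear in between. -/
def ramp (j : ℕ) (x : ℝ) : ℝ := max 0 (min 1 (x - j + 1))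

lemma ramp_nonneg (j : ℕ) (x : ℝ) : 0 ≤ ramp j x := le_max_left _ _

lemma ramp_le_one (j : ℕ) (x : ℝ) : ramp j x ≤ 1 := max_le zero_le_one (min_le_left _ _)

lemma ramp_eq_one {j : ℕ} {x : ℝ} (h : j ≤ x) : ramp j x = 1 := by
  have : 1 ≤ x - j + 1 := by linarith
  simp [ramp, this]

lemma ramp_eq_zero {j : ℕ} {x : ℝ} (h : x ≤ j - 1) : ramp j x = 0 := by
  have : x - j + 1 ≤ 0 := by linarith
  simp [ramp, this]

lemma ramp_succ_le (j : ℕ) (x : ℝ) : ramp (j + 1) x ≤ ramp j x := by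
  refine max_le_max le_rfl (min_le_min le_rfl ?_)
  push_cast; linarith

lemma ramp_lipschitz (j : ℕ) : LipschitzWith 1 (ramp j) := by
  have h : LipschitzWith 1 fun x : ℝ => x - j + 1 :=
    LipschitzWith.of_dist_le_mul fun x y => by simp [Real.dist_eq]
  exact (h.const_min 1).const_max 0

lemma uniformContinuous_ramp_smul {h : ℝ} (j : ℕ) {u : Ray → (H →L[ℂ] H)} {b : ℝ}
    (hu : UniformContinuous u) (hb : ∀ t, ‖u t‖ ≤ b) :
    UniformContinuous fun t : Ray => ((ramp j ((t - 1) / h) : ℝ) : ℂ) • u t := by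
  refine uniformContinuous_bilin (fun (c : ℂ) (T : H →L[ℂ] H) => c • T)
    (fun _ _ _ => sub_smul _ _ _) (fun _ _ _ => smul_sub _ _ _) (fun c T => norm_smul_le c T)
    (a := 1) ?_ hu ?_ hb
  · have h1 : UniformContinuous fun t : Ray => ((t : ℝ) - 1) / h := by
      simp only [div_eq_inv_mul]
      exact (uniformContinuous_subtype_val.sub uniformContinuous_const).const_mul' h⁻¹
    exact Complex.isometry_ofReal.uniformContinuous.comp
      ((ramp_lipschitz j).uniformContinuous.comp h1)
  · intro t
    rw [Complex.norm_real, Real.norm_of_nonneg (ramp_nonneg _ _)]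
    exact ramp_le_one _ _

/-- The elements of the algebraic localization algebra with `sup_t prop(f(t)) < ∞` are dense. -/
lemma exists_bounded_propagation (f : Ray →ᵇ (H →L[ℂ] H)) (hf : f ∈ algLoc M) {δ : ℝ}
    (hδ : 0 < δ) :
    ∃ g ∈ algLoc M, (⨆ t, M.propagation (g t)) < ⊤ ∧ dist f g ≤ δ := by
  obtain ⟨hu, hR, hp⟩ := hf
  obtain ⟨N, hN⟩ : ∃ N : Ray, ∀ t ≥ N, M.propagation (f t) ≤ 1 := by
    have := hp.eventually (ge_mem_nhds (show (0 : ℝ≥0∞) < 1 from zero_lt_one))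
    exact eventually_atTop.1 this
  obtain ⟨h, hh, hfh⟩ := Metric.uniformContinuous_iff.1 hu δ hδ
  obtain ⟨K, hK⟩ := exists_nat_ge (((N : ℝ) - 1) / h)
  let s : ℕ → Ray := fun k => ⟨1 + k * h, by simp only [Set.mem_Ici]; linarith [show 0 ≤ k * h by positivity]⟩
  let x : Ray → ℝ := fun t => (t - 1) / h
  let φ : ℕ → Ray → ℝ := fun k t => ramp k (x t) - ramp (k + 1) (x t)
  have hφ0 : ∀ k t, 0 ≤ φ k t := fun k t => sub_nonneg.2 (ramp_succ_le _ _)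
  have hφs : ∀ t, ∑ k ∈ Finset.range (K + 1), φ k t = 1 - ramp (K + 1) (x t) := by
    intro t
    have hx : ((0 : ℕ) : ℝ) ≤ x t := by
      have := t.2
      simp only [Set.mem_Ici] at this
      simp only [x, Nat.cast_zero]
      exact div_nonneg (by linarith) hh.le
    rw [Finset.sum_range_sub' (fun k => ramp k (x t)), ramp_eq_one hx]
  have hφd : ∀ k t, φ k t ≠ 0 → dist (s k) t < h := by
    intro k t hk
    have h1 : x t < k + 1 := by
      by_contra! hc
      refine hk ?_
      simp only [φ]
      rw [ramp_eq_one (by linarith), ramp_eq_one (by push_cast; linarith), sub_self]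
    have h2 : k - 1 < x t := by
      by_contra! hc
      refine hk ?_
      simp only [φ]
      rw [ramp_eq_zero hc, ramp_eq_zero (by push_cast; linarith), sub_self]
    simp only [x] at h1 h2
    rw [div_lt_iff₀ hh] at h1
    rw [lt_div_iff₀ hh] at h2
    rw [Subtype.dist_eq, Real.dist_eq, abs_lt]
    simp only [s]
    constructor <;> linarith
  let G : Ray → (H →L[ℂ] H) := fun t => ∑ k ∈ Finset.range (K + 1), ((φ k t : ℝ) : ℂ) • f (s k) +
    ((ramp (K + 1) (x t) : ℝ) : ℂ) • f t
  have hdist : ∀ t, ‖f t - G t‖ ≤ δ := by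
    intro t
    have e : f t - G t = ∑ k ∈ Finset.range (K + 1), ((φ k t : ℝ) : ℂ) • (f t - f (s k)) := by
      have : f t = (∑ k ∈ Finset.range (K + 1), ((φ k t : ℝ) : ℂ)) • f t +
          ((ramp (K + 1) (x t) : ℝ) : ℂ) • f t := by
        rw [← add_smul, ← Complex.ofReal_sum, hφs]
        simp
      conv_lhs => rw [this]
      simp only [G, smul_sub, Finset.sum_sub_distrib, Finset.sum_smul]
      abel
    rw [e]
    calc _ ≤ ∑ k ∈ Finset.range (K + 1), φ k t * δ := by
          refine norm_sum_le_of_le _ fun k _ => ?_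
          rw [norm_smul, Complex.norm_real, Real.norm_of_nonneg (hφ0 k t)]
          by_cases hk : φ k t = 0
          · simp [hk]
          · have := hfh (hφd k t hk)
            rw [dist_comm, dist_eq_norm] at this
            exact mul_le_mul_of_nonneg_left this.le (hφ0 k t)
      _ = (1 - ramp (K + 1) (x t)) * δ := by rw [← Finset.sum_mul, hφs]
      _ ≤ δ := by nlinarith [ramp_nonneg (K + 1) (x t)]
  have hGu : UniformContinuous G := by
    refine UniformContinuous.add ?_
      (uniformContinuous_ramp_smul (K + 1) hu fun t => f.norm_coe_le_norm t)
    have : ∀ n : ℕ, UniformContinuous fun t =>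
        ∑ k ∈ Finset.range n, ((φ k t : ℝ) : ℂ) • f (s k) := by
      intro n
      induction n with
      | zero => simpa using uniformContinuous_const
      | succ n ih =>
        simp only [Finset.sum_range_succ]
        refine ih.add ?_
        simp only [φ, Complex.ofReal_sub, sub_smul]
        exact (uniformContinuous_ramp_smul n uniformContinuous_const (fun _ => le_rfl)).sub
          (uniformContinuous_ramp_smul (n + 1) uniformContinuous_const (fun _ => le_rfl))
    exact this _
  have hGb : ∀ t, ‖G t‖ ≤ ‖f‖ + δ := by
    intro t
    have e : G t = f t - (f t - G t) := by abel
    rw [e]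
    exact (norm_sub_le _ _).trans (add_le_add (f.norm_coe_le_norm t) (hdist t))
  let g : Ray →ᵇ (H →L[ℂ] H) :=
    BoundedContinuousFunction.ofNormedAddCommGroup G hGu.continuous _ hGb
  have hGe : ∀ t : Ray, ((K + 1 : ℕ) : ℝ) ≤ x t → G t = f t := by
    intro t ht
    have h0 : ∀ k ∈ Finset.range (K + 1), ((φ k t : ℝ) : ℂ) • f (s k) = 0 := by
      intro k hk
      have hk' : ((k + 1 : ℕ) : ℝ) ≤ (K + 1 : ℕ) := by exact_mod_cast Finset.mem_range.1 hk
      have h1 : ((k + 1 : ℕ) : ℝ) ≤ x t := hk'.trans ht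
      have h2 : (k : ℝ) ≤ x t := le_trans (by push_cast; linarith) h1
      simp only [φ]
      rw [ramp_eq_one h1, ramp_eq_one h2]
      simp
    simp only [G]
    rw [Finset.sum_eq_zero h0, ramp_eq_one ht]
    simp
  have hsum : ∀ t (n : ℕ), (∑ k ∈ Finset.range n, ((φ k t : ℝ) : ℂ) • f (s k)) ∈ M.algRoe ∧
      M.propagation (∑ k ∈ Finset.range n, ((φ k t : ℝ) : ℂ) • f (s k)) ≤
        ∑ k ∈ Finset.range n, M.propagation (f (s k)) := by
    intro t n
    induction n with
    | zero =>
      simp only [Finset.range_zero, Finset.sum_empty, AmpleModule.propagation_zero]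
      exact ⟨M.algRoe.zero_mem, le_rfl⟩
    | succ n ih =>
      simp only [Finset.sum_range_succ]
      refine ⟨M.algRoe.add_mem ih.1 (M.algRoe.smul_mem' _ (hR _)), ?_⟩
      refine (AmpleModule.propagation_add _ _).trans (max_le ?_ ?_)
      · exact ih.2.trans le_self_add
      · exact (AmpleModule.propagation_smul _ _).trans le_add_self
  refine ⟨g, ⟨hGu, fun t => ?_, ?_⟩, ?_, ?_⟩
  · exact M.algRoe.add_mem (hsum t _).1 (M.algRoe.smul_mem' _ (hR t))
  · refine hp.congr' ?_
    filter_upwards [eventually_ge_atTop (s (K + 1))] with t ht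
    have h1 : 1 + ((K + 1 : ℕ) : ℝ) * h ≤ t := ht
    have : G t = f t := hGe t (by
      simp only [x]
      rw [le_div_iff₀ hh]
      linarith)
    change M.propagation (f t) = M.propagation (G t)
    rw [this]
  · have hfin : (∑ k ∈ Finset.range (K + 1), M.propagation (f (s k))) < ⊤ :=
      ENNReal.sum_lt_top.2 fun k _ => (hR (s k)).2
    refine lt_of_le_of_lt (iSup_le fun t => ?_) (max_lt hfin ENNReal.one_lt_top)
    change M.propagation (G t) ≤ _
    refine (AmpleModule.propagation_add _ _).trans (max_le_max (hsum t _).2 ?_)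
    by_cases ht : x t ≤ K
    · rw [ramp_eq_zero (by push_cast; linarith)]
      simp [AmpleModule.propagation_zero]
    · refine (AmpleModule.propagation_smul _ _).trans (hN t ?_)
      push Not at ht
      have h1 := hK.trans_lt ht
      simp only [x] at h1
      rw [div_lt_div_iff_of_pos_right hh] at h1
      change (N : ℝ) ≤ t
      linarith
  · refine (BoundedContinuousFunction.dist_le hδ.le).2 fun t => ?_
    rw [dist_eq_norm]
    exact hdist t

variable (M) in
/-- The filtration of `C*_L(H)` by the subspaces of those `f` in the algebraic localization algebra
for which `sup_t prop(f(t)) < r`. -/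
def locFiltration : Filtration (LocAlg M) where
  sub r hr :=
    { carrier := {f | f ∈ algLocSub M ∧
        (⨆ t, M.propagation ((f : Ray →ᵇ (H →L[ℂ] H)) t)) < ENNReal.ofReal r}
      zero_mem' := ⟨(algLocSub M).zero_mem, by
        have : (⨆ t, M.propagation (((0 : LocAlg M) : Ray →ᵇ (H →L[ℂ] H)) t)) = 0 := by
          simp [AmpleModule.propagation_zero]
        rw [this]
        exact ENNReal.ofReal_pos.2 hr⟩
      add_mem' := fun {f g} hf hg => ⟨(algLocSub M).add_mem hf.1 hg.1,
        lt_of_le_of_lt (iSup_le fun t => (AmpleModule.propagation_add _ _).trans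
          (max_le_max (le_iSup (fun t => M.propagation ((f : Ray →ᵇ (H →L[ℂ] H)) t)) t)
            (le_iSup (fun t => M.propagation ((g : Ray →ᵇ (H →L[ℂ] H)) t)) t)))
          (max_lt hf.2 hg.2)⟩
      smul_mem' := fun c f hf => ⟨(algLocSub M).smul_mem c hf.1,
        lt_of_le_of_lt (iSup_mono fun t => AmpleModule.propagation_smul c _) hf.2⟩ }
  mono {r r'} hr hr' h f hf := ⟨hf.1, hf.2.trans_le (ENNReal.ofReal_le_ofReal h)⟩
  star_mem {r} hr f hf := ⟨(algLoc M).star_mem' hf.1,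
    lt_of_le_of_lt (iSup_mono fun t => AmpleModule.propagation_star _) hf.2⟩
  mul_mem {r r'} hr hr' f g hf hg := ⟨(algLoc M).mul_mem' hf.1 hg.1, by
    rw [ENNReal.ofReal_add hr.le hr'.le]
    refine lt_of_le_of_lt (iSup_le fun t => (AmpleModule.propagation_mul _ _).trans
      (add_le_add (le_iSup (fun t => M.propagation ((f : Ray →ᵇ (H →L[ℂ] H)) t)) t)
            (le_iSup (fun t => M.propagation ((g : Ray →ᵇ (H →L[ℂ] H)) t)) t)))
          (ENNReal.add_lt_add hf.2 hg.2)⟩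
  dense a := by
    refine Metric.mem_closure_iff.2 fun δ hδ => ?_
    have ha : (a : Ray →ᵇ (H →L[ℂ] H)) ∈ closure (algLoc M : Set (Ray →ᵇ (H →L[ℂ] H))) := a.2
    obtain ⟨f, hf, hfa⟩ := Metric.mem_closure_iff.1 ha (δ / 2) (by positivity)
    obtain ⟨g, hg, hgp, hgf⟩ := exists_bounded_propagation f hf (δ := δ / 4) (by positivity)
    refine ⟨⟨g, subset_closure hg⟩,
      ⟨(⨆ t, M.propagation (g t)).toReal + 1, by positivity, hg, ?_⟩, ?_⟩
    · rw [ENNReal.lt_ofReal_iff_toReal_lt hgp.ne]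
      exact lt_add_one _
    · have := dist_triangle (a : Ray →ᵇ (H →L[ℂ] H)) f g
      rw [Subtype.dist_eq]
      change dist (a : Ray →ᵇ (H →L[ℂ] H)) g < δ
      linarith

end LocalizationAlgebra

/-- The filtration by the closures of the subspaces of a filtration. -/
def Filtration.closure {A : Type*} [NonUnitalCStarAlgebra A] (F : Filtration A) :
    Filtration A where
  sub r hr := (F.sub r hr).topologicalClosure
  mono hr hr' h := Submodule.topologicalClosure_mono (F.mono hr hr' h)
  star_mem hr _ ha := map_mem_closure continuous_star ha fun _ hx => F.star_mem hr hx
  mul_mem hr hr' _ _ ha hb :=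
    map_mem_closure₂ continuous_mul ha hb fun _ hx _ hy => F.mul_mem hr hr' hx hy
  dense a := closure_mono (by
    rintro b ⟨r, hr, hb⟩
    exact ⟨r, hr, subset_closure hb⟩) (F.dense a)

section TimeShift

open Filter BoundedContinuousFunction

variable {X : Type*} [MetricSpace X] [LocallyCompactSpace X]
variable {H : Type*} [NormedAddCommGroup H] [InnerProductSpace ℂ H] [CompleteSpace H]

/-- The map `t ↦ t + N` of the half line `[1, ∞)`. -/
def rayShift (N : NNReal) : C(Ray, Ray) where
  toFun t := ⟨t + N, le_add_of_le_of_nonneg t.2 N.2⟩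
  continuous_toFun := by fun_prop

variable {M : AmpleModule X H}

lemma algLoc_shift (N : NNReal) {f : Ray →ᵇ (H →L[ℂ] H)} (hf : f ∈ algLoc M) :
    f.compContinuous (rayShift N) ∈ algLoc M := by
  obtain ⟨hu, hR, hp⟩ := hf
  refine ⟨?_, fun t => hR _, ?_⟩
  · have h : UniformContinuous (rayShift N) :=
      (uniformContinuous_subtype_val.add uniformContinuous_const).subtype_mk _
    exact UniformContinuous.comp (g := f) hu h
  · refine hp.comp (tendsto_atTop_mono (f := id) (fun t => ?_) tendsto_id)
    change (t : ℝ) ≤ t + N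
    simp

variable (M) in
/-- The shift in time `f ↦ f(N + ·)` on `C*_L(H)`. -/
def timeShift (N : NNReal) : LocAlg M →⋆ₙₐ[ℂ] LocAlg M where
  toFun f := ⟨(f : Ray →ᵇ (H →L[ℂ] H)).compContinuous (rayShift N),
    map_mem_closure (f := fun g : Ray →ᵇ (H →L[ℂ] H) => g.compContinuous (rayShift N))
      (LipschitzWith.of_dist_le_mul (K := 1) fun g g' => by
        rw [NNReal.coe_one, one_mul]
        exact (BoundedContinuousFunction.dist_le dist_nonneg).2 fun t =>
          BoundedContinuousFunction.dist_coe_le_dist (rayShift N t)).continuous f.2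
      fun _ h => algLoc_shift N h⟩
  map_smul' _ _ := rfl
  map_zero' := rfl
  map_add' _ _ := rfl
  map_mul' _ _ := rfl
  map_star' _ := rfl

lemma timeShift_apply (N : NNReal) (f : LocAlg M) (t : Ray) :
    (timeShift M N f : Ray →ᵇ (H →L[ℂ] H)) t = (f : Ray →ᵇ (H →L[ℂ] H)) (rayShift N t) := rfl

/-- The shift in time of a matrix over the unitization of `C*_L(H)`; scalars are constant. -/
def shiftMat (N : NNReal) {n : ℕ} (p : CMat n (Unitization ℂ (LocAlg M))) :
    CMat n (Unitization ℂ (LocAlg M)) :=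
  mapMat (Unitization.starMap (timeShift M N)) p

end TimeShift

end CtrlK

end

/-! The shifts in time form a point-norm continuous family of endomorphisms of $C^*_L(X)$ that
starts at the identity; continuity in $N$ is uniform continuity of the functions, which survives
completion. They preserve the steps of the filtration, and because propagation tends to $0$, every
element of the dense subspace $C^*_{L,\mathrm{alg}}(X)$ is eventually moved into $A_r$, however
small $r$ is. Nothing else about $X$ enters the K-theory: the properties are collected in
`IsContracting` and, for a single subspace of the unitization, in `IsAbsorbing`.

The central point is that paths can be moved into $S=A_r+\mathbb C$. Let $Q$ be the set of all
$\varepsilon$-quasi-projections, or $\varepsilon$-quasi-unitaries, of size $n$ over the unitization.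
It is convex near each of its points and invariant under shifts, and the matrices with eventually
absorbed entries are dense in it (`IsDeformable`). A path in $Q$ between matrices over $S$ can thus
be replaced by a polygon with absorbed vertices; finitely many vertices enter $S$ under one large
shift, and their segments follow by linearity. The shift homotopies at the two ends stay over $S$.
Together with approximation of single points this says that matrices over $S$ in $Q$ have the same
path components as $Q$ (`joinedIn_entriesIn`, `exists_joinedIn_entriesIn`), with no loss in
$\varepsilon$ or $r$.

Next, the straight lines from $p$ to $\chi(p)$ and from $u$ to $u(u^*u)^{-1/2}$ do not leave $Q$
(`norm_line_spectralProj_lt`, `norm_line_polarPart_lt`), so $Q$ may be replaced by genuine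
projections or unitaries. This gives `spectralProjHom_bijective`, `polarPartHom_injective` and
`exists_cls_polarPart_eq`.

For $K_0$, a rotation shows $[q]+[1-q]=[I_m]$. Hence the unit classes are cofinal, and formal
differences $[p]-[I_\ell]$ already form the Grothendieck group (`comparisonHom_bijective`). The rank
condition corresponds to the kernel of $K_0(\tilde A)\to K_0(\mathbb C)$, since rank determines
classes over $\mathbb C$ (`cls_eq_cls_one_iff`). For $K_1$, injectivity is used at the scale
$(3\varepsilon,2r)$ and surjectivity at $(\varepsilon,r)$. Finally, a shift does not change the
K-theory class, and injectivity of the comparison maps identifies their inverses. -/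

section

open Filter Topology

namespace CtrlK

/-! ### Continuity argument along a path. -/

section Chains

/-- If a path runs in the closure of a set `W`, and a transitive relation relates any two points
of `W` that are close to a common point of the path, then it relates the end points. -/
lemma rel_of_path {E : Type*} [TopologicalSpace E] {Q W : Set E} {r : E → E → Prop}
    (htrans : ∀ {x y z}, r x y → r y z → r x z) (hQW : Q ⊆ closure W)
    (hloc : ∀ u ∈ Q, ∃ O ∈ 𝓝 u, ∀ x ∈ O ∩ W, ∀ y ∈ O ∩ W, r x y)
    {x y : E} (hx : x ∈ W) (hy : y ∈ W) (h : JoinedIn Q x y) : r x y := by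
  obtain ⟨γ, hγ⟩ := h
  -- Points of the path need not lie in `W`, so the relation to `x` is required of all points of `W`
  -- near `γ t`. Connectedness of the interval then replaces the choice of a finite chain.
  let T : Set unitInterval := {t | ∃ O ∈ 𝓝 (γ t), ∀ z ∈ O ∩ W, r x z}
  have hT : T = Set.univ := by
    refine IsClopen.eq_univ ⟨?_, ?_⟩ ⟨0, ?_⟩
    · rw [← closure_subset_iff_isClosed]
      intro t ht
      obtain ⟨O, hO, h⟩ := hloc (γ t) (hγ t)
      refine ⟨O, hO, fun z hz => ?_⟩
      obtain ⟨s, hs, O', hO', h'⟩ := mem_closure_iff_nhds.1 ht _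
        (γ.continuous.continuousAt.preimage_mem_nhds (interior_mem_nhds.2 hO))
      have hO1 : O ∈ 𝓝 (γ s) := mem_interior_iff_mem_nhds.1 hs
      -- The intermediate vertex: `w` is reached from `x` because `s ∈ T`, and is related to every
      -- `z` near `γ t` by the local hypothesis.
      obtain ⟨w, hw, hwW⟩ := mem_closure_iff_nhds.1 (hQW (hγ s)) _ (inter_mem hO1 hO')
      exact htrans (h' w ⟨hw.2, hwW⟩) (h w ⟨hw.1, hwW⟩ z hz)
    · rw [isOpen_iff_mem_nhds]
      rintro t ⟨O, hO, h⟩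
      filter_upwards [γ.continuous.continuousAt.preimage_mem_nhds (interior_mem_nhds.2 hO)]
        with s hs
      exact ⟨O, mem_interior_iff_mem_nhds.1 hs, h⟩
    · obtain ⟨O, hO, h⟩ := hloc (γ 0) (hγ 0)
      refine ⟨O, hO, h x ⟨?_, hx⟩⟩
      simpa using mem_of_mem_nhds hO
  obtain ⟨O, hO, h⟩ : (1 : unitInterval) ∈ T := hT ▸ Set.mem_univ _
  exact h y ⟨by simpa using mem_of_mem_nhds hO, hy⟩

end Chains

/-! ### Moving matrices and their homotopies into an absorbing subspace. -/

section Shift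

variable {B : Type*} [CStarAlgebra B] {C : Type*} [CStarAlgebra C]

/-- Entrywise application of a `*`-homomorphism, as a `*`-homomorphism of matrix algebras. -/
noncomputable def mapMatHom (φ : B →⋆ₐ[ℂ] C) (n : ℕ) : CMat n B →⋆ₐ[ℂ] CMat n C where
  toFun := mapMat φ
  map_one' := by
    ext i j
    by_cases h : i = j <;> simp [mapMat, CStarMatrix.one_apply, h]
  map_mul' := mapMat_mul φ
  map_zero' := by ext i j; simp [mapMat]
  map_add' a b := by ext i j; simp [mapMat]
  commutes' c := by
    rw [Algebra.algebraMap_eq_smul_one, Algebra.algebraMap_eq_smul_one]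
    ext i j
    by_cases h : i = j <;> simp [mapMat, h]
  map_star' := mapMat_star φ

lemma mapMatHom_apply (φ : B →⋆ₐ[ℂ] C) {n : ℕ} (a : CMat n B) :
    mapMatHom φ n a = mapMat φ a := rfl

lemma norm_mapMat_le (φ : B →⋆ₐ[ℂ] C) {n : ℕ} (a : CMat n B) : ‖mapMat φ a‖ ≤ ‖a‖ :=
  NonUnitalStarAlgHom.norm_apply_le (mapMatHom φ n) a

/-- A continuous family of `*`-endomorphisms `σ_N`, starting at the identity, that leaves the
subspace `S` invariant and eventually moves a dense set of elements into `S`. -/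
structure IsAbsorbing (σ : NNReal → (B →⋆ₐ[ℂ] B)) (S : Submodule ℂ B) : Prop where
  zero_apply : ∀ b, σ 0 b = b
  continuous_apply : ∀ b, Continuous fun N => σ N b
  map_mem : ∀ N, ∀ b ∈ S, σ N b ∈ S
  star_mem : ∀ b ∈ S, star b ∈ S
  dense : Dense {b | ∀ᶠ N in atTop, σ N b ∈ S}

/-- The elements that are eventually moved into `S`. -/
def absorbed (σ : NNReal → (B →⋆ₐ[ℂ] B)) (S : Submodule ℂ B) : Submodule ℂ B where
  carrier := {b | ∀ᶠ N in atTop, σ N b ∈ S}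
  zero_mem' := by simp
  add_mem' {a b} ha hb := by
    filter_upwards [ha, hb] with N h h'
    rw [map_add]; exact S.add_mem h h'
  smul_mem' c a ha := by
    filter_upwards [ha] with N h
    rw [map_smul]; exact S.smul_mem c h

/-- The matrices with entries in the subspace `S`. -/
def entriesIn (S : Submodule ℂ B) (n : ℕ) : Set (CMat n B) := {a | ∀ i j, a i j ∈ S}

lemma convex_entriesIn (S : Submodule ℂ B) (n : ℕ) : Convex ℝ (entriesIn S n) := by
  intro a ha b hb s t _ _ _ i j
  have h : (s • a + t • b) i j = (s : ℂ) • a i j + (t : ℂ) • b i j := by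
    simp only [CStarMatrix.add_apply, Complex.coe_smul]; rfl
  rw [h]
  exact S.add_mem (S.smul_mem _ (ha i j)) (S.smul_mem _ (hb i j))

/-- A set of matrices that is invariant under `σ`, convex near each of its points, and in which the
matrices with entries in `G` are dense. -/
structure IsDeformable (σ : NNReal → (B →⋆ₐ[ℂ] B)) (G : Submodule ℂ B) {n : ℕ}
    (Q : Set (CMat n B)) : Prop where
  map_mem : ∀ N, ∀ a ∈ Q, mapMat (σ N) a ∈ Q
  locConvex : ∀ a ∈ Q, ∃ O ∈ 𝓝 a, ∀ x ∈ O ∩ Q, ∀ y ∈ O ∩ Q, segment ℝ x y ⊆ Q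
  subset_closure : Q ⊆ closure (Q ∩ entriesIn G n)

variable {σ : NNReal → (B →⋆ₐ[ℂ] B)} {S : Submodule ℂ B} {n : ℕ} {Q : Set (CMat n B)}

lemma continuous_shift_mapMat (hc : ∀ b, Continuous fun N => σ N b) (a : CMat n B) :
    Continuous fun N => mapMat (σ N) a := by
  rw [continuous_entries]
  exact fun i j => hc (a i j)

/-- A matrix has finitely many entries, so one threshold for $N$ serves all of them. -/
lemma entriesIn_absorbed_iff (a : CMat n B) :
    a ∈ entriesIn (absorbed σ S) n ↔ ∀ᶠ N in atTop, mapMat (σ N) a ∈ entriesIn S n := by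
  have h : ∀ N, mapMat (σ N) a ∈ entriesIn S n ↔ ∀ i j, σ N (a i j) ∈ S := fun N => Iff.rfl
  simp only [h, eventually_all]
  rfl

lemma JoinedIn.of_segment {E : Type*} [AddCommGroup E] [Module ℝ E] [TopologicalSpace E]
    [ContinuousAdd E] [ContinuousSMul ℝ E] {s : Set E} {x y : E} (h : segment ℝ x y ⊆ s) :
    JoinedIn s x y :=
  ((convex_segment x y).isPathConnected ⟨x, left_mem_segment ℝ x y⟩).joinedIn x
    (left_mem_segment ℝ x y) y (right_mem_segment ℝ x y) |>.mono h

/-- A matrix is homotopic to its shifts. -/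
lemma joined_shift (hσ0 : ∀ b, σ 0 b = b) (hc : ∀ b, Continuous fun N => σ N b)
    (hQ : ∀ N, ∀ a ∈ Q, mapMat (σ N) a ∈ Q) {a : CMat n B} (ha : a ∈ Q) (N : NNReal) :
    JoinedIn Q a (mapMat (σ N) a) := by
  -- The path is $t\mapsto\sigma_{tN}(a)$, and it starts at `a` since $\sigma_0$ is the identity.
  have e : a = mapMat (σ 0) a := by ext i j; exact (hσ0 (a i j)).symm
  refine ⟨⟨⟨fun t => mapMat (σ (t.1.toNNReal * N)) a, ?_⟩, ?_, ?_⟩, fun t => hQ _ a ha⟩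
  · exact (continuous_shift_mapMat hc a).comp (by fun_prop)
  · simpa using e.symm
  · simp

/-- Matrices with entries in `S` that are homotopic are homotopic through matrices with entries
in `S`. -/
theorem joinedIn_entriesIn (hS : IsAbsorbing σ S) (hQ : IsDeformable σ (absorbed σ S) Q)
    {x y : CMat n B} (hx : x ∈ Q ∩ entriesIn S n) (hy : y ∈ Q ∩ entriesIn S n)
    (h : JoinedIn Q x y) : JoinedIn (Q ∩ entriesIn S n) x y := by
  have hinv : ∀ N, ∀ a ∈ Q ∩ entriesIn S n, mapMat (σ N) a ∈ Q ∩ entriesIn S n :=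
    fun N a ha => ⟨hQ.map_mem N a ha.1, fun i j => hS.map_mem N _ (ha.2 i j)⟩
  have habs : Q ∩ entriesIn S n ⊆ Q ∩ entriesIn (absorbed σ S) n := fun a ha =>
    ⟨ha.1, fun i j => Eventually.of_forall fun N => hS.map_mem N _ (ha.2 i j)⟩
  -- The relation "joined over `S` after every sufficiently large shift" is transitive, because two
  -- thresholds have a common upper bound; this is what makes the chain argument applicable.
  have key : ∀ᶠ N in atTop,
      JoinedIn (Q ∩ entriesIn S n) (mapMat (σ N) x) (mapMat (σ N) y) := by
    refine rel_of_path (W := Q ∩ entriesIn (absorbed σ S) n)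
      (r := fun x y => ∀ᶠ N in atTop,
        JoinedIn (Q ∩ entriesIn S n) (mapMat (σ N) x) (mapMat (σ N) y)) ?_ hQ.subset_closure ?_
      (habs hx) (habs hy) h
    · intro x y z h h'
      filter_upwards [h, h'] with N h h' using h.trans h'
    · intro u hu
      obtain ⟨O, hO, hconv⟩ := hQ.locConvex u hu
      refine ⟨O, hO, fun x hx y hy => ?_⟩
      filter_upwards [(entriesIn_absorbed_iff x).1 hx.2.2, (entriesIn_absorbed_iff y).1 hy.2.2]
        with N h1 h2
      refine JoinedIn.of_segment ?_
      -- The shifted segment lies over `S` because its end points do, and in `Q` because it is the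
      -- image under the shift of a segment in `Q`.
      have e : segment ℝ (mapMat (σ N) x) (mapMat (σ N) y) = mapMat (σ N) '' segment ℝ x y :=
        (image_segment ℝ (((mapMatHom (σ N) n).toLinearMap.restrictScalars ℝ).toAffineMap) x y).symm
      refine Set.subset_inter ?_ ((convex_entriesIn S n).segment_subset h1 h2)
      rw [e]
      rintro _ ⟨z, hz, rfl⟩
      exact hQ.map_mem N z (hconv x ⟨hx.1, hx.2.1⟩ y ⟨hy.1, hy.2.1⟩ hz)
  obtain ⟨N, hN⟩ := key.exists
  -- The shifts of `x` and `y` themselves never leave `S`, so the end points may be returned to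
  -- their original positions.
  exact ((joined_shift hS.zero_apply hS.continuous_apply hinv hx N).trans hN).trans
    (joined_shift hS.zero_apply hS.continuous_apply hinv hy N).symm

/-- Every matrix in `Q` is homotopic to one with entries in `S`. -/
theorem exists_joinedIn_entriesIn (hS : IsAbsorbing σ S) (hQ : IsDeformable σ (absorbed σ S) Q)
    {x : CMat n B} (hx : x ∈ Q) : ∃ y ∈ Q ∩ entriesIn S n, JoinedIn Q x y := by
  obtain ⟨O, hO, hconv⟩ := hQ.locConvex x hx
  obtain ⟨y, hyO, hy⟩ := mem_closure_iff_nhds.1 (hQ.subset_closure hx) O hO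
  have h1 : JoinedIn Q x y :=
    JoinedIn.of_segment (hconv x ⟨mem_of_mem_nhds hO, hx⟩ y ⟨hyO, hy.1⟩)
  obtain ⟨N, hN⟩ := ((entriesIn_absorbed_iff y).1 hy.2).exists
  exact ⟨mapMat (σ N) y, ⟨hQ.map_mem N y hy.1, hN⟩,
    h1.trans (joined_shift hS.zero_apply hS.continuous_apply hQ.map_mem hy.1 N)⟩

end Shift

/-! ### Quasi-projections and quasi-unitaries form deformable sets. -/

section Deformable

variable {B : Type*} [CStarAlgebra B] {σ : NNReal → (B →⋆ₐ[ℂ] B)} {S : Submodule ℂ B}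

/-- Separates the norm conditions, which define the deformable set, from the condition on the
entries. -/
lemma QProj_eq (ε : ℝ) (S : Submodule ℂ B) (n : ℕ) :
    QProj ε S n = QProj ε (⊤ : Submodule ℂ B) n ∩ entriesIn S n := by
  ext p
  exact ⟨fun h => ⟨⟨fun _ _ => trivial, h.2⟩, h.1⟩, fun h => ⟨h.2, h.1.2⟩⟩

lemma QUnit_eq (ε : ℝ) (S : Submodule ℂ B) (n : ℕ) :
    QUnit ε S n = QUnit ε (⊤ : Submodule ℂ B) n ∩ entriesIn S n := by
  ext p
  exact ⟨fun h => ⟨⟨fun _ _ => trivial, h.2⟩, h.1⟩, fun h => ⟨h.2, h.1.2⟩⟩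

lemma mapMat_mem_QProj {C : Type*} [CStarAlgebra C] (φ : B →⋆ₐ[ℂ] C) {ε : ℝ} {n : ℕ}
    {p : CMat n B} (hp : p ∈ QProj ε S n) : mapMat φ p ∈ QProj ε (⊤ : Submodule ℂ C) n := by
  refine ⟨fun _ _ => trivial, hp.2.1.map (mapMatHom φ n), ?_⟩
  have e : mapMat φ p * mapMat φ p - mapMat φ p = mapMat φ (p * p - p) := by
    simp only [← mapMatHom_apply, map_sub, map_mul]
  rw [e]
  exact (norm_mapMat_le φ _).trans_lt hp.2.2

lemma mapMat_mem_QUnit {C : Type*} [CStarAlgebra C] (φ : B →⋆ₐ[ℂ] C) {ε : ℝ} {n : ℕ}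
    {u : CMat n B} (hu : u ∈ QUnit ε S n) : mapMat φ u ∈ QUnit ε (⊤ : Submodule ℂ C) n := by
  refine ⟨fun _ _ => trivial, ?_, ?_⟩
  · have e : star (mapMat φ u) * mapMat φ u - 1 = mapMat φ (star u * u - 1) := by
      simp only [← mapMatHom_apply, map_sub, map_mul, map_star, map_one]
    rw [e]
    exact (norm_mapMat_le φ _).trans_lt hu.2.1
  · have e : mapMat φ u * star (mapMat φ u) - 1 = mapMat φ (u * star u - 1) := by
      simp only [← mapMatHom_apply, map_sub, map_mul, map_star, map_one]
    rw [e]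
    exact (norm_mapMat_le φ _).trans_lt hu.2.2

lemma dense_entriesIn {G : Submodule ℂ B} (hG : Dense (G : Set B)) (n : ℕ) :
    Dense (entriesIn G n) := by
  have h : Dense (Set.pi Set.univ fun _ : Fin n => Set.pi Set.univ fun _ : Fin n => (G : Set B)) :=
    dense_pi _ fun _ _ => dense_pi _ fun _ _ => hG
  have e : entriesIn G n =
      (Set.pi Set.univ fun _ : Fin n => Set.pi Set.univ fun _ : Fin n => (G : Set B)) := by
    ext a
    exact ⟨fun h i _ j _ => h i j, fun h i j => h i trivial j trivial⟩
  rw [e]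
  exact h

lemma star_mem_absorbed (hS : IsAbsorbing σ S) {b : B} (hb : b ∈ absorbed σ S) :
    star b ∈ absorbed σ S := by
  have hb : ∀ᶠ N in atTop, σ N b ∈ S := hb
  change ∀ᶠ N in atTop, σ N (star b) ∈ S
  filter_upwards [hb] with N h
  rw [map_star]
  exact hS.star_mem _ h

/-- A ball around `a` inside the open set `O` is convex, and so is its intersection with `V`. -/
lemma locConvex_inter {E : Type*} [NormedAddCommGroup E] [NormedSpace ℝ E] {V O : Set E}
    (hV : Convex ℝ V) (hO : IsOpen O) (a : E) (ha : a ∈ V ∩ O) :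
    ∃ O' ∈ 𝓝 a, ∀ x ∈ O' ∩ (V ∩ O), ∀ y ∈ O' ∩ (V ∩ O), segment ℝ x y ⊆ V ∩ O := by
  obtain ⟨δ, hδ, h⟩ := Metric.isOpen_iff.1 hO a ha.2
  refine ⟨Metric.ball a δ, Metric.ball_mem_nhds a hδ, fun x hx y hy => ?_⟩
  exact Set.subset_inter (hV.segment_subset hx.2.1 hy.2.1)
    (((convex_ball a δ).segment_subset hx.1 hy.1).trans h)

/-- Quasi-projections are not open among all matrices, but they are relatively open in the real
subspace of self-adjoint ones. -/
lemma QProj_isDeformable (hS : IsAbsorbing σ S) (ε : ℝ) (n : ℕ) :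
    IsDeformable σ (absorbed σ S) (QProj ε (⊤ : Submodule ℂ B) n) := by
  set O : Set (CMat n B) := {p | ‖p * p - p‖ < ε}
  have hO : IsOpen O := isOpen_lt (by fun_prop) continuous_const
  have e : QProj ε (⊤ : Submodule ℂ B) n = (selfAdjoint (CMat n B) : Set (CMat n B)) ∩ O := by
    ext p
    exact ⟨fun h => h.2, fun h => ⟨fun _ _ => trivial, h⟩⟩
  have hV : Convex ℝ (selfAdjoint (CMat n B) : Set (CMat n B)) :=
    (selfAdjoint.submodule ℝ (CMat n B)).convex
  refine ⟨fun N a ha => mapMat_mem_QProj (σ N) ha, ?_, ?_⟩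
  · rw [e]
    exact locConvex_inter hV hO
  · rw [e]
    intro a ha
    -- Approximants with absorbed entries are symmetrized by $x\mapsto\frac12(x+x^*)$, which is
    -- continuous, fixes `a` and keeps the entries absorbed.
    have h1 : a ∈ closure ((selfAdjoint (CMat n B) : Set (CMat n B)) ∩
        entriesIn (absorbed σ S) n) := by
      have hc : Continuous fun x : CMat n B => (1 / 2 : ℂ) • (x + star x) := by fun_prop
      have ha' : (1 / 2 : ℂ) • (a + star a) = a := by
        rw [show star a = a from ha.1, ← two_smul ℂ a, smul_smul]; norm_num
      rw [← ha']
      refine map_mem_closure (f := fun x : CMat n B => (1 / 2 : ℂ) • (x + star x)) hc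
        ((dense_entriesIn (G := absorbed σ S) hS.dense n) a) fun x hx => ⟨?_, fun i j => ?_⟩
      · change star ((1 / 2 : ℂ) • (x + star x)) = _
        rw [star_smul, star_add, star_star, add_comm]; simp
      · exact (absorbed σ S).smul_mem _ ((absorbed σ S).add_mem (hx i j)
          (star_mem_absorbed hS (hx j i)))
    have h2 := hO.inter_closure ⟨ha.2, h1⟩
    convert h2 using 2
    ext x
    simp only [Set.mem_inter_iff]
    tauto

/-- Here the set is open in the whole matrix algebra, which gives both local convexity and density.
-/
lemma QUnit_isDeformable (hS : IsAbsorbing σ S) (ε : ℝ) (n : ℕ) :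
    IsDeformable σ (absorbed σ S) (QUnit ε (⊤ : Submodule ℂ B) n) := by
  have hO : IsOpen (QUnit ε (⊤ : Submodule ℂ B) n) := by
    have e : QUnit ε (⊤ : Submodule ℂ B) n =
        {u | ‖star u * u - 1‖ < ε} ∩ {u | ‖u * star u - 1‖ < ε} := by
      ext p
      exact ⟨fun h => h.2, fun h => ⟨fun _ _ => trivial, h⟩⟩
    rw [e]
    exact (isOpen_lt (by fun_prop) continuous_const).inter
      (isOpen_lt (by fun_prop) continuous_const)
  refine ⟨fun N a ha => mapMat_mem_QUnit (σ N) ha, ?_, ?_⟩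
  · have h := locConvex_inter convex_univ hO
    rw [Set.univ_inter] at h
    exact h
  · exact (dense_entriesIn (G := absorbed σ S) hS.dense n).open_subset_closure_inter hO

end Deformable

/-! ### Spectral projections of quasi-projections. -/

section SpectralProjection

variable {D : Type*} [CStarAlgebra D]

lemma cfc_sq_sub_self (p : D) (f : ℝ → ℝ)
    (hf : ContinuousOn f (spectrum ℝ p)) :
    cfc f p * cfc f p - cfc f p = cfc (fun x => f x * f x - f x) p := by
  rw [← cfc_mul f f p, ← cfc_sub (fun x => f x * f x) f p]

/-- The norm of a function of a self-adjoint element is the supremum over the spectrum, so norm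
estimates for `p` become scalar inequalities. -/
lemma abs_lt_of_mem_spectrum {p : D} (hp : IsSelfAdjoint p) {ε : ℝ} (h : ‖p * p - p‖ < ε) :
    ∀ x ∈ spectrum ℝ p, |x * x - x| < ε := by
  have e := cfc_sq_sub_self p id continuousOn_id
  rw [cfc_id ℝ p] at e
  rw [e] at h
  exact (norm_cfc_lt_iff (fun x : ℝ => id x * id x - id x) p
    ((norm_nonneg _).trans_lt h)).1 h

lemma isCompact_abs_sq_sub_le (c : ℝ) : IsCompact {x : ℝ | |x * x - x| ≤ c} := by
  refine Metric.isCompact_of_isClosed_isBounded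
    (isClosed_le (by fun_prop) continuous_const) ?_
  refine (Metric.isBounded_Icc (-(|c| + 2)) (|c| + 2)).subset fun x hx => ?_
  have h1 : x * x - x ≤ c := (le_abs_self _).trans hx
  have h2 := le_abs_self c
  have h3 := abs_nonneg c
  constructor <;> nlinarith

/-- The only jump of $\chi$ is at $x=\frac12$, where $|x^2-x|=\frac14$; this is the source of the
bound $\frac14$ on $\varepsilon$. -/
lemma continuousOn_chi {c : ℝ} (hc : c < 1 / 4) : ContinuousOn chi {x : ℝ | |x * x - x| ≤ c} := by
  intro x hx
  refine ContinuousAt.continuousWithinAt ?_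
  have hx' : x ≠ 1 / 2 := by
    rintro rfl
    have : |(1 / 2 : ℝ) * (1 / 2) - 1 / 2| ≤ c := hx
    norm_num [abs_of_neg] at this
    linarith
  rcases lt_or_gt_of_ne hx' with h | h
  · refine (continuousAt_const (y := (0 : ℝ))).congr ?_
    filter_upwards [gt_mem_nhds h] with y hy
    rw [chi, if_neg (not_le.2 hy)]
  · refine (continuousAt_const (y := (1 : ℝ))).congr ?_
    filter_upwards [lt_mem_nhds h] with y hy
    rw [chi, if_pos (le_of_lt hy)]

lemma continuousOn_chi_spectrum {p : D} (hp : IsSelfAdjoint p) (h : ‖p * p - p‖ < 1 / 4) :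
    ContinuousOn chi (spectrum ℝ p) := by
  obtain ⟨c, h1, h2⟩ := exists_between h
  exact (continuousOn_chi h2).mono fun x hx => (abs_lt_of_mem_spectrum hp h1 x hx).le

/-- Moving `x` linearly towards the nearer of the points $0$ and $1$ does not increase $|x^2-x|$,
the absolute product of the distances to these two points. -/
lemma abs_linear_le {x t : ℝ} (ht : t ∈ Set.Icc (0 : ℝ) 1) :
    |(x + t * (chi x - x)) * (x + t * (chi x - x)) - (x + t * (chi x - x))| ≤ |x * x - x| := by
  obtain ⟨h0, h1⟩ := ht
  have h2 : 0 ≤ 1 - t := by linarith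
  unfold chi
  split_ifs with h
  · have e : (x + t * (1 - x)) * (x + t * (1 - x)) - (x + t * (1 - x)) =
        ((1 - t) * (x - 1)) * (1 + (1 - t) * (x - 1)) := by ring
    have e' : x * x - x = (x - 1) * (1 + (x - 1)) := by ring
    rw [e, e', abs_mul, abs_mul (x - 1), abs_mul, abs_of_nonneg h2]
    have h3 : 0 ≤ 1 + (1 - t) * (x - 1) := by nlinarith
    rw [abs_of_nonneg h3, abs_of_nonneg (by linarith : 0 ≤ 1 + (x - 1))]
    -- Outside $[0,1]$ both distances shrink. Inside, with $a=1-x\le\frac12$ and $s=1-t$, the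
    -- difference $a(1-a)-sa(1-sa)$ equals $ta(1-(2-t)a)\ge0$; the case $x<\frac12$ is the mirror
    -- image.
    rcases le_total 1 x with hx | hx
    · rw [abs_of_nonneg (by linarith)]
      have : 0 ≤ x - 1 := by linarith
      have : 1 + (1 - t) * (x - 1) ≤ 1 + (x - 1) := by nlinarith
      have : (1 - t) * (x - 1) ≤ x - 1 := by nlinarith
      exact mul_le_mul this (by assumption) h3 (by assumption)
    · rw [abs_of_nonpos (by linarith)]
      nlinarith [mul_nonneg h0 (by linarith : 0 ≤ 1 - x),
        mul_nonneg (mul_nonneg h0 (by linarith : 0 ≤ 1 - x))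
          (by nlinarith : 0 ≤ 1 - (2 - t) * (1 - x))]
  · push Not at h
    have e : (x + t * (0 - x)) * (x + t * (0 - x)) - (x + t * (0 - x)) =
        -(((1 - t) * x) * (1 - (1 - t) * x)) := by ring
    have e' : x * x - x = -(x * (1 - x)) := by ring
    rw [e, e', abs_neg, abs_neg, abs_mul, abs_mul x, abs_mul, abs_of_nonneg h2]
    have h3 : 0 ≤ 1 - (1 - t) * x := by nlinarith
    rw [abs_of_nonneg h3, abs_of_nonneg (by linarith : 0 ≤ 1 - x)]
    rcases le_total x 0 with hx | hx
    · rw [abs_of_nonpos hx]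
      have : 0 ≤ - x := by linarith
      have : 1 - (1 - t) * x ≤ 1 - x := by nlinarith
      have : (1 - t) * -x ≤ -x := by nlinarith
      exact mul_le_mul this (by assumption) h3 (by assumption)
    · rw [abs_of_nonneg hx]
      nlinarith [mul_nonneg h0 hx,
        mul_nonneg (mul_nonneg h0 hx) (by nlinarith : 0 ≤ 1 - (2 - t) * x)]

/-- The straight line from an almost idempotent self-adjoint element to its spectral projection
consists of almost idempotent elements. -/
lemma norm_line_spectralProj_lt {p : D} (hp : IsSelfAdjoint p) {ε : ℝ} (hε : ε ≤ 1 / 4)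
    (h : ‖p * p - p‖ < ε) {t : ℝ} (ht : t ∈ Set.Icc (0 : ℝ) 1) :
    IsSelfAdjoint (p + t • (spectralProj p - p)) ∧
      ‖(p + t • (spectralProj p - p)) * (p + t • (spectralProj p - p)) -
        (p + t • (spectralProj p - p))‖ < ε := by
  have hc := continuousOn_chi_spectrum hp (h.trans_le hε)
  -- The whole line lies in the functional calculus of `p`, so the scalar estimate applies on the
  -- spectrum.
  have e : p + t • (spectralProj p - p) = cfc (fun x => x + t * (chi x - x)) p := by
    rw [cfc_add p (fun x : ℝ => x) (fun x => t * (chi x - x)) (by fun_prop) (by fun_prop),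
      cfc_const_mul t (fun x => chi x - x) p (by fun_prop),
      cfc_sub chi (fun x : ℝ => x) p hc (by fun_prop), cfc_id' ℝ p]
    rfl
  rw [e]
  refine ⟨cfc_predicate _ p, ?_⟩
  rw [cfc_sq_sub_self p _ (by fun_prop)]
  refine norm_cfc_lt ((norm_nonneg _).trans_lt h) fun x hx => ?_
  exact (abs_linear_le ht).trans_lt (abs_lt_of_mem_spectrum hp h x hx)

/-- The function $\chi$ is the identity on $\{0,1\}$, which contains the spectrum of a projection.
-/
lemma spectralProj_of_isStarProjection {p : D} (hp : IsStarProjection p) : spectralProj p = p := by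
  have hsa := hp.isSelfAdjoint
  conv_rhs => rw [← cfc_id' ℝ p]
  refine cfc_congr fun x hx => ?_
  rcases hp.isIdempotentElem.spectrum_subset ℝ hx with h | h
  · simp [chi, h]
  · have : x = 1 := h
    rw [this, chi, if_pos (by norm_num)]

lemma spectralProj_map {D' : Type*} [CStarAlgebra D'] (φ : D →⋆ₐ[ℂ] D') {p : D}
    (hp : IsSelfAdjoint p) (h : ‖p * p - p‖ < 1 / 4) :
    φ (spectralProj p) = spectralProj (φ p) :=
  cfc_hom φ chi p hp (continuousOn_chi_spectrum hp h)

end SpectralProjection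

/-! ### Unitary parts of quasi-unitaries. -/

section PolarPart

variable {D : Type*} [CStarAlgebra D]

lemma norm_sub_one_lt_iff {a : D} (ha : IsSelfAdjoint a) {ε : ℝ} (hε : 0 < ε) :
    ‖a - 1‖ < ε ↔ ∀ x ∈ spectrum ℝ a, |x - 1| < ε := by
  have e : a - 1 = cfc (fun x : ℝ => x - 1) a := by
    rw [cfc_sub (fun x => x) (fun _ => 1) a, cfc_id' ℝ a, cfc_const_one ℝ a]
  rw [e, norm_cfc_lt_iff (fun x : ℝ => x - 1) a hε]
  rfl

lemma isUnit_of_norm_sub_one_lt {a : D} (h : ‖a - 1‖ < 1) : IsUnit a := by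
  have := isUnit_one_sub_of_norm_lt_one (x := 1 - a) (by rwa [norm_sub_rev])
  simpa using this

lemma isUnit_of_quasiUnitary {u : D} (h1 : ‖star u * u - 1‖ < 1) (h2 : ‖u * star u - 1‖ < 1) :
    IsUnit u := by
  obtain ⟨y, hy⟩ := (isUnit_of_norm_sub_one_lt h2).exists_right_inv
  obtain ⟨z, hz⟩ := (isUnit_of_norm_sub_one_lt h1).exists_left_inv
  exact isUnit_iff_exists_and_exists.2 ⟨⟨star u * y, by rw [← mul_assoc, hy]⟩,
    ⟨z * star u, by rw [mul_assoc, hz]⟩⟩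

/-- For invertible $w$ the elements $ww^*=w(w^*w)w^{-1}$ and $w^*w$ have the same spectrum, which
determines the distance of a self-adjoint element from $1$. -/
lemma norm_mul_star_sub_one_lt {w : D} (hw : IsUnit w) {ε : ℝ} (h : ‖star w * w - 1‖ < ε) :
    ‖w * star w - 1‖ < ε := by
  have hε : 0 < ε := (norm_nonneg _).trans_lt h
  rw [norm_sub_one_lt_iff (IsSelfAdjoint.mul_star_self w) hε]
  rw [norm_sub_one_lt_iff (IsSelfAdjoint.star_mul_self w) hε] at h
  obtain ⟨v, rfl⟩ := hw
  have e : (v : D) * star (v : D) = v * (star (v : D) * v) * (v⁻¹ : Dˣ) := by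
    simp [mul_assoc]
  rw [e, spectrum.units_conjugate]
  exact h

/-- The function `x ↦ x^{-1/2}`. -/
noncomputable def invSqrt (x : ℝ) : ℝ := x ^ (-(1 / 2) : ℝ)

lemma continuousOn_invSqrt : ContinuousOn invSqrt (Set.Ioi 0) := fun x hx =>
  (Real.continuousAt_rpow_const x _ (Or.inl (ne_of_gt hx))).continuousWithinAt

lemma invSqrt_eq (x : ℝ) (hx : 0 < x) : invSqrt x = (√x)⁻¹ := by
  rw [invSqrt, Real.rpow_neg hx.le, Real.sqrt_eq_rpow]

lemma polarPart_eq (u : D) : polarPart u = u * cfc invSqrt (star u * u) := rfl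

/-- With $s=\sqrt x$ the expression is $(s+t(1-s))^2-1$, and $s+t(1-s)$ lies between $s$ and $1$. -/
lemma abs_interpolation_le {x t : ℝ} (hx : 0 < x) (ht : t ∈ Set.Icc (0 : ℝ) 1) :
    |(1 + t * (invSqrt x - 1)) * x * (1 + t * (invSqrt x - 1)) - 1| ≤ |x - 1| := by
  obtain ⟨h0, h1⟩ := ht
  have hs : 0 < √x := Real.sqrt_pos.2 hx
  have hss : √x * √x = x := Real.mul_self_sqrt hx.le
  rw [invSqrt_eq x hx]
  generalize √x = s at hs hss
  subst hss
  have e : (1 + t * (s⁻¹ - 1)) * (s * s) * (1 + t * (s⁻¹ - 1)) = (s + t * (1 - s)) ^ 2 := by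
    field_simp
  have e1 : (s + t * (1 - s)) ^ 2 - 1 = ((1 - t) * (s - 1)) * (1 + s + t * (1 - s)) := by ring
  have e2 : s * s - 1 = (s - 1) * (1 + s) := by ring
  have h3 : 0 ≤ 1 - t := by linarith
  have h4 : 0 ≤ 1 + s + t * (1 - s) := by nlinarith
  rw [e, e1, e2, abs_mul, abs_mul, abs_mul, abs_of_nonneg h3, abs_of_nonneg h4,
    abs_of_pos (by linarith : 0 < 1 + s)]
  have h5 : (1 - t) * (1 + s + t * (1 - s)) ≤ 1 + s := by
    nlinarith [mul_nonneg h0 h3, mul_nonneg h0 h0, mul_nonneg h0 hs.le,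
      mul_nonneg (mul_nonneg h0 h0) hs.le, mul_nonneg (mul_nonneg h0 h3) hs.le]
  nlinarith [mul_le_mul_of_nonneg_left h5 (abs_nonneg (s - 1))]

lemma spectrum_star_mul_self_pos {u : D} (h1 : ‖star u * u - 1‖ < 1) :
    spectrum ℝ (star u * u) ⊆ Set.Ioi 0 := fun x hx => by
  have := (norm_sub_one_lt_iff (IsSelfAdjoint.star_mul_self u) one_pos).1 h1 x hx
  rw [abs_lt] at this
  simp only [Set.mem_Ioi]
  linarith

/-- The straight line from a quasi-unitary element to its unitary part consists of quasi-unitary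
elements. -/
lemma norm_line_polarPart_lt {u : D} {ε : ℝ} (hε : ε ≤ 1) (h1 : ‖star u * u - 1‖ < ε)
    (h2 : ‖u * star u - 1‖ < ε) {t : ℝ} (ht : t ∈ Set.Icc (0 : ℝ) 1) :
    ‖star (u + t • (polarPart u - u)) * (u + t • (polarPart u - u)) - 1‖ < ε ∧
      ‖(u + t • (polarPart u - u)) * star (u + t • (polarPart u - u)) - 1‖ < ε := by
  have hε0 : 0 < ε := (norm_nonneg _).trans_lt h1
  have hpos := spectrum_star_mul_self_pos (h1.trans_le hε)
  set a := star u * u with ha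
  have hasa : IsSelfAdjoint a := IsSelfAdjoint.star_mul_self u
  have hc : ContinuousOn invSqrt (spectrum ℝ a) := continuousOn_invSqrt.mono hpos
  set g : ℝ → ℝ := fun x => 1 + t * (invSqrt x - 1) with hg
  have hgc : ContinuousOn g (spectrum ℝ a) := by fun_prop
  -- Every point of the line is $u\,g(a)$ with $a=u^*u$, so its $w^*w$ is the function $x\mapsto
  -- g(x)\,x\,g(x)$ of `a`.
  have e : u + t • (polarPart u - u) = u * cfc g a := by
    rw [hg, cfc_add a (fun _ : ℝ => 1) (fun x => t * (invSqrt x - 1)) (by fun_prop) (by fun_prop),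
      cfc_const_mul t (fun x => invSqrt x - 1) a (by fun_prop),
      cfc_sub invSqrt (fun _ : ℝ => 1) a hc (by fun_prop),
      cfc_const_one ℝ a, polarPart_eq, mul_add, mul_one, mul_smul_comm, mul_sub, mul_one]
  have hsa : star (cfc g a) = cfc g a := (cfc_predicate g a : IsSelfAdjoint _)
  have e2 : star (u * cfc g a) * (u * cfc g a) - 1 = cfc (fun x => g x * x * g x - 1) a := by
    rw [cfc_sub (fun x => g x * x * g x) (fun _ => 1) a, cfc_mul (fun x => g x * x) g a,
      cfc_mul g (fun x => x) a, cfc_id' ℝ a, cfc_const_one ℝ a, star_mul, hsa, ha]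
    simp only [mul_assoc]
  have h3 : ‖star (u * cfc g a) * (u * cfc g a) - 1‖ < ε := by
    rw [e2]
    refine norm_cfc_lt hε0 fun x hx => ?_
    exact (abs_interpolation_le (hpos hx) ht).trans_lt
      ((norm_sub_one_lt_iff hasa hε0).1 h1 x hx)
  rw [e]
  -- The product in the other order is not in the functional calculus of `a`. The estimate is
  -- transferred through invertibility, which holds because $g$ is positive on the spectrum of `a`.
  refine ⟨h3, norm_mul_star_sub_one_lt ?_ h3⟩
  refine (isUnit_of_quasiUnitary (h1.trans_le hε) (h2.trans_le hε)).mul ?_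
  rw [isUnit_cfc_iff g a]
  intro x hx
  have h0 : 0 < invSqrt x := Real.rpow_pos_of_pos (hpos hx) _
  have : 0 < g x := by
    simp only [hg]
    obtain ⟨ht0, ht1⟩ := ht
    rcases ht1.lt_or_eq with h | h
    · nlinarith [mul_nonneg ht0 h0.le]
    · rw [h]; linarith
  exact this.ne'

lemma polarPart_of_mem_unitary {u : D} (hu : u ∈ unitary D) : polarPart u = u := by
  rw [polarPart_eq, (Unitary.mem_iff.1 hu).1, cfc_apply_one, invSqrt, Real.one_rpow]
  simp

end PolarPart

/-! ### Homotopies from quasi-projections and quasi-unitaries to genuine ones. -/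

section Retractions

variable {B : Type*} [CStarAlgebra B] {S : Submodule ℂ B} {n m : ℕ} {ε : ℝ}

lemma joinedIn_line {E : Type*} [AddCommGroup E] [Module ℝ E] [TopologicalSpace E]
    [ContinuousAdd E] [ContinuousSMul ℝ E] {s : Set E} {x y : E}
    (h : ∀ t ∈ Set.Icc (0 : ℝ) 1, x + t • (y - x) ∈ s) : JoinedIn s x y := by
  refine JoinedIn.of_segment ?_
  rw [segment_eq_image']
  rintro _ ⟨t, ht, rfl⟩
  exact h t ht

lemma joinedIn_spectralProj (hε : ε ≤ 1 / 4) {p : CMat n B} (hp : p ∈ QProj ε S n) :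
    JoinedIn (QProj ε (⊤ : Submodule ℂ B) n) p (spectralProj p) :=
  joinedIn_line fun _ ht => ⟨fun _ _ => trivial, norm_line_spectralProj_lt hp.2.1 hε hp.2.2 ht⟩

lemma joinedIn_polarPart (hε : ε ≤ 1) {u : CMat n B} (hu : u ∈ QUnit ε S n) :
    JoinedIn (QUnit ε (⊤ : Submodule ℂ B) n) u (polarPart u) :=
  joinedIn_line fun _ ht => ⟨fun _ _ => trivial, norm_line_polarPart_lt hε hu.2.1 hu.2.2 ht⟩

/-- All spectra along the path lie in one compact set on which $\chi$ is continuous, so $\chi$ of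
the path is again norm-continuous. The strict bound on $\varepsilon$ keeps $\frac12$ out of this
set. -/
lemma joinedIn_spectralProj_spectralProj (hε : ε < 1 / 4) {p q : CMat n B}
    (h : JoinedIn (QProj ε S n) p q) :
    JoinedIn {p : CMat n B | IsStarProjection p} (spectralProj p) (spectralProj q) := by
  obtain ⟨γ, hγ⟩ := h
  refine ⟨⟨⟨fun t => spectralProj (γ t), ?_⟩, by simp, by simp⟩,
    fun t => spectralProj_isStarProjection _⟩
  exact Continuous.cfc' (isCompact_abs_sq_sub_le ε) chi γ.continuous
    (fun t x hx => (abs_lt_of_mem_spectrum (hγ t).2.1 (hγ t).2.2 x hx).le)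
    (continuousOn_chi hε) (fun t => (hγ t).2.1)

/-- The spectra of $u^*u$ along the path stay in $[1-\varepsilon,1+\varepsilon]$, a compact subset
of $(0,\infty)$ on which $x^{-1/2}$ is continuous. -/
lemma joinedIn_polarPart_polarPart (hε : ε < 1) {u v : CMat n B}
    (h : JoinedIn (QUnit ε S n) u v) :
    JoinedIn {u : CMat n B | u ∈ unitary (CMat n B)} (polarPart u) (polarPart v) := by
  obtain ⟨γ, hγ⟩ := h
  have h0 : 0 < ε := (norm_nonneg _).trans_lt (hγ 0).2.1
  refine ⟨⟨⟨fun t => polarPart (γ t), ?_⟩, by simp, by simp⟩,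
    fun t => QUnit_polarPart_mem hε.le (hγ t)⟩
  refine γ.continuous.mul (Continuous.cfc' (isCompact_Icc (a := 1 - ε) (b := 1 + ε)) invSqrt
    (by fun_prop) (fun t x hx => ?_) (continuousOn_invSqrt.mono fun x hx => ?_)
    fun t => IsSelfAdjoint.star_mul_self _)
  · have := (norm_sub_one_lt_iff (IsSelfAdjoint.star_mul_self (γ t)) h0).1 (hγ t).2.1 x hx
    rw [abs_lt] at this
    constructor <;> linarith
  · simp only [Set.mem_Ioi]
    linarith [hx.1]

lemma spectralProj_dsum (hε : ε ≤ 1 / 4) {p : CMat n B} {q : CMat m B} (hp : p ∈ QProj ε S n)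
    (hq : q ∈ QProj ε S m) :
    spectralProj (dsum p q) = dsum (spectralProj p) (spectralProj q) :=
  (cfc_hom_prod (dsumHom B n m) chi p q hp.2.1 hq.2.1
    (by
      -- The two defects are strictly below $\frac14$, so a common $c<\frac14$ exists even when
      -- $\varepsilon=\frac14$.
      obtain ⟨c, h1, h2⟩ := exists_between (max_lt (hp.2.2.trans_le hε) (hq.2.2.trans_le hε))
      rw [max_lt_iff] at h1
      exact (continuousOn_chi h2).mono (Set.union_subset
        (fun x hx => (abs_lt_of_mem_spectrum hp.2.1 h1.1 x hx).le)
        (fun x hx => (abs_lt_of_mem_spectrum hq.2.1 h1.2 x hx).le)))).symm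

lemma polarPart_dsum (hε : ε ≤ 1) {u : CMat n B} {v : CMat m B} (hu : u ∈ QUnit ε S n)
    (hv : v ∈ QUnit ε S m) : polarPart (dsum u v) = dsum (polarPart u) (polarPart v) := by
  rw [polarPart_eq, polarPart_eq, polarPart_eq, ← dsum_mul, dsum_star, dsum_mul]
  congr 1
  exact (cfc_hom_prod (dsumHom B n m) invSqrt _ _ (IsSelfAdjoint.star_mul_self u)
    (IsSelfAdjoint.star_mul_self v) (continuousOn_invSqrt.mono (Set.union_subset
      (spectrum_star_mul_self_pos (hu.2.1.trans_le hε))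
      (spectrum_star_mul_self_pos (hv.2.1.trans_le hε))))).symm

end Retractions

/-! ### Maps between families of matrices and their effect on homotopy classes. -/

namespace MatFamily

variable {B : Type*} [CStarAlgebra B] {F : MatFamily B}

lemma cls_eq_iff {n m : ℕ} {a : CMat n B} {b : CMat m B} (ha : a ∈ F.carrier n)
    (hb : b ∈ F.carrier m) : cls a ha = cls b hb ↔ F.Homotopic ⟨n, a, ha⟩ ⟨m, b, hb⟩ :=
  Quotient.eq (r := F.homotopySetoid)

lemma cls_eq_of_joinedIn {n : ℕ} {a b : CMat n B} (ha : a ∈ F.carrier n) (hb : b ∈ F.carrier n)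
    (h : JoinedIn (F.carrier n) a b) : cls a ha = cls b hb :=
  (cls_eq_iff ha hb).2 ⟨n, le_rfl, le_rfl, by simpa only [pad_self] using h⟩

lemma cls_diagMat (k : ℕ) : cls (diagMat F.d k) (F.diag_mem k) = 0 := by
  refine (cls_eq_iff _ _).2 ⟨k, le_rfl, Nat.zero_le k, ?_⟩
  have e : pad F.d k (diagMat F.d 0) = diagMat F.d k := by
    ext i j
    simp [pad_apply, diagMat, of_apply, Matrix.diagonal_apply]
  rw [pad_self, e]
  exact JoinedIn.refl (F.diag_mem k)

/-- A map between families of matrices that is compatible with block sums and padding and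
maps homotopic matrices to homotopic matrices. -/
structure Hom (F F' : MatFamily B) where
  toFun : ∀ {n : ℕ}, CMat n B → CMat n B
  map_mem : ∀ {n : ℕ} {a : CMat n B}, a ∈ F.carrier n → toFun a ∈ F'.carrier n
  map_diag : ∀ k, toFun (diagMat F.d k) = diagMat F'.d k
  map_dsum : ∀ {n m : ℕ} {a : CMat n B} {b : CMat m B}, a ∈ F.carrier n → b ∈ F.carrier m →
    toFun (dsum a b) = dsum (toFun a) (toFun b)
  map_joinedIn : ∀ {n : ℕ} {a b : CMat n B}, JoinedIn (F.carrier n) a b →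
    JoinedIn (F'.carrier n) (toFun a) (toFun b)

namespace Hom

variable {F' : MatFamily B} (f : Hom F F')

lemma map_pad {n N : ℕ} (h : n ≤ N) {a : CMat n B} (ha : a ∈ F.carrier n) :
    f.toFun (pad F.d N a) = pad F'.d N (f.toFun a) := by
  obtain ⟨k, rfl⟩ := Nat.exists_eq_add_of_le h
  rw [pad_add, pad_add, f.map_dsum ha (F.diag_mem k), f.map_diag]

/-- The homomorphism on homotopy classes induced by a map of families. -/
def classesMap : F.Classes →+ F'.Classes where
  toFun := Quotient.map (fun a => ⟨a.1, f.toFun a.2.1, f.map_mem a.2.2⟩) (by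
    rintro a b ⟨N, h1, h2, h⟩
    refine ⟨N, h1, h2, ?_⟩
    have := f.map_joinedIn h
    rwa [f.map_pad h1 a.2.2, f.map_pad h2 b.2.2] at this)
  map_zero' := by
    refine congrArg (Quotient.mk F'.homotopySetoid) ?_
    exact Sigma.ext rfl (heq_of_eq (Subtype.ext (f.map_diag 0)))
  map_add' := by
    rintro ⟨a⟩ ⟨b⟩
    refine congrArg (Quotient.mk F'.homotopySetoid) ?_
    exact Sigma.ext rfl (heq_of_eq (Subtype.ext (f.map_dsum a.2.2 b.2.2)))

/-- Since the map commutes with padding, stable homotopies can be compared size by size. -/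
lemma classesMap_injective (h : ∀ {n : ℕ} {a b : CMat n B}, a ∈ F.carrier n → b ∈ F.carrier n →
    JoinedIn (F'.carrier n) (f.toFun a) (f.toFun b) → JoinedIn (F.carrier n) a b) :
    Function.Injective f.classesMap := by
  rintro ⟨a⟩ ⟨b⟩ hab
  obtain ⟨N, h1, h2, hj⟩ := Quotient.exact (s := F'.homotopySetoid) hab
  refine Quotient.sound (s := F.homotopySetoid) ⟨N, h1, h2, ?_⟩
  refine h (pad_mem h1 a.2.2) (pad_mem h2 b.2.2) ?_
  rwa [f.map_pad h1 a.2.2, f.map_pad h2 b.2.2]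

end Hom

end MatFamily

/-! ### Quasi-projections and quasi-unitaries over `S` have the homotopy classes of genuine ones. -/

section Comparison

variable {B : Type*} [CStarAlgebra B] {S : Submodule ℂ B} {n m : ℕ} {ε : ℝ}

lemma isStarProjection_mem_QProj (hε : 0 < ε) {p : CMat n B} (hp : IsStarProjection p) :
    p ∈ QProj ε (⊤ : Submodule ℂ B) n :=
  ⟨fun _ _ => trivial, hp.isSelfAdjoint, by
    rw [hp.isIdempotentElem.eq, sub_self, norm_zero]; exact hε⟩

lemma unitary_mem_QUnit (hε : 0 < ε) {u : CMat n B} (hu : u ∈ unitary (CMat n B)) :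
    u ∈ QUnit ε (⊤ : Submodule ℂ B) n :=
  ⟨fun _ _ => trivial, by
    rw [(Unitary.mem_iff.1 hu).1, sub_self, norm_zero]; exact hε, by
    rw [(Unitary.mem_iff.1 hu).2, sub_self, norm_zero]; exact hε⟩

/-- Spectral projections, as a map from quasi-projections to projections. -/
noncomputable def spectralProjHom (hε : 0 < ε) (hε' : ε < 1 / 4) (S : Submodule ℂ B) :
    MatFamily.Hom (qProjFam ε hε S) (projFam B) where
  toFun p := spectralProj p
  map_mem _ := spectralProj_isStarProjection _
  map_diag k := spectralProj_of_isStarProjection ((projFam B).diag_mem k)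
  map_dsum hp hq := spectralProj_dsum hε'.le hp hq
  map_joinedIn h := joinedIn_spectralProj_spectralProj hε' h

/-- Unitary parts, as a map from quasi-unitaries to unitaries. -/
noncomputable def polarPartHom (hε : 0 < ε) (hε' : ε < 1) (S : Submodule ℂ B) (h1 : (1 : B) ∈ S) :
    MatFamily.Hom (qUnitFam ε hε S h1) (unitFam B) where
  toFun u := polarPart u
  map_mem hu := QUnit_polarPart_mem hε'.le hu
  map_diag k := polarPart_of_mem_unitary ((unitFam B).diag_mem k)
  map_dsum hu hv := polarPart_dsum hε'.le hu hv
  map_joinedIn h := joinedIn_polarPart_polarPart hε' h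

variable {σ : NNReal → (B →⋆ₐ[ℂ] B)}

/-- For injectivity, the chain from $p$ to $\chi(p)$, $\chi(q)$ and $q$ runs through unrestricted
quasi-projections and is then deformed into `S`. For surjectivity, a projection is moved to a
quasi-projection over `S`, and $\chi$ is applied to the path. -/
theorem spectralProjHom_bijective (hS : IsAbsorbing σ S) (hε : 0 < ε) (hε' : ε < 1 / 4) :
    Function.Bijective (spectralProjHom hε hε' S).classesMap := by
  refine ⟨MatFamily.Hom.classesMap_injective _ fun {n p q} hp hq h => ?_, ?_⟩
  · change JoinedIn (QProj ε S n) p q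
    have hp' : p ∈ QProj ε S n := hp
    have hq' : q ∈ QProj ε S n := hq
    rw [QProj_eq] at hp' hq' ⊢
    refine joinedIn_entriesIn hS (QProj_isDeformable hS ε n) hp' hq' ?_
    have h' : JoinedIn (QProj ε (⊤ : Submodule ℂ B) n) (spectralProj p) (spectralProj q) :=
      JoinedIn.mono h fun _ hx => isStarProjection_mem_QProj hε hx
    exact (joinedIn_spectralProj hε'.le hp).trans
      (h'.trans (joinedIn_spectralProj hε'.le hq).symm)
  · rintro ⟨n, p, hp⟩
    obtain ⟨q, hq, hj⟩ := exists_joinedIn_entriesIn hS (QProj_isDeformable hS ε n)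
      (isStarProjection_mem_QProj hε hp)
    rw [← QProj_eq] at hq
    refine ⟨MatFamily.cls (F := qProjFam ε hε S) q hq, ?_⟩
    refine MatFamily.cls_eq_of_joinedIn (F := projFam B) _ hp ?_
    have := joinedIn_spectralProj_spectralProj hε' hj
    rw [spectralProj_of_isStarProjection hp] at this
    exact this.symm

/-- A homotopy of unitary parts is extended by the straight lines to $u$ and $v$ and then deformed
into `S`. -/
theorem polarPartHom_injective (hS : IsAbsorbing σ S) (h1 : (1 : B) ∈ S) (hε : 0 < ε)
    (hε' : ε < 1) : Function.Injective (polarPartHom hε hε' S h1).classesMap := by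
  refine MatFamily.Hom.classesMap_injective _ fun {n u v} hu hv h => ?_
  change JoinedIn (QUnit ε S n) u v
  have hu' : u ∈ QUnit ε S n := hu
  have hv' : v ∈ QUnit ε S n := hv
  rw [QUnit_eq] at hu' hv' ⊢
  refine joinedIn_entriesIn hS (QUnit_isDeformable hS ε n) hu' hv' ?_
  have h' : JoinedIn (QUnit ε (⊤ : Submodule ℂ B) n) (polarPart u) (polarPart v) :=
    JoinedIn.mono h fun _ hx => unitary_mem_QUnit hε hx
  exact (joinedIn_polarPart hε'.le hu).trans (h'.trans (joinedIn_polarPart hε'.le hv).symm)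

/-- Every class of unitaries is the class of the unitary part of a quasi-unitary with entries
in `S`. -/
theorem exists_cls_polarPart_eq (hS : IsAbsorbing σ S) (hε : 0 < ε) (hε' : ε < 1)
    (x : K1Unital B) : ∃ (n : ℕ) (u : CMat n B) (hu : u ∈ QUnit ε S n),
      MatFamily.cls (F := unitFam B) (polarPart u) (QUnit_polarPart_mem hε'.le hu) = x := by
  obtain ⟨n, v, hv⟩ := x
  obtain ⟨u, hu, hj⟩ := exists_joinedIn_entriesIn hS (QUnit_isDeformable hS ε n)
    (unitary_mem_QUnit hε hv)
  rw [← QUnit_eq] at hu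
  refine ⟨n, u, hu, MatFamily.cls_eq_of_joinedIn (F := unitFam B) _ hv ?_⟩
  have := joinedIn_polarPart_polarPart hε' hj
  rw [polarPart_of_mem_unitary hv] at this
  exact this.symm

/-- The unitary parts of a quasi-unitary and of its shifts have the same class. -/
lemma cls_polarPart_shift (hσ0 : ∀ b, σ 0 b = b) (hc : ∀ b, Continuous fun N => σ N b)
    {S' : Submodule ℂ B} (hε' : ε < 1) {u : CMat n B} (hu : u ∈ QUnit ε S n) (N : NNReal)
    (hN : mapMat (σ N) u ∈ QUnit ε S' n) :
    MatFamily.cls (F := unitFam B) (polarPart (mapMat (σ N) u)) (QUnit_polarPart_mem hε'.le hN) =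
      MatFamily.cls (F := unitFam B) (polarPart u) (QUnit_polarPart_mem hε'.le hu) :=
  (MatFamily.cls_eq_of_joinedIn (F := unitFam B) _ _ (joinedIn_polarPart_polarPart hε'
    (joined_shift (Q := QUnit ε (⊤ : Submodule ℂ B) n) hσ0 hc
      (fun N _ h => mapMat_mem_QUnit (σ N) h) ⟨fun _ _ => trivial, hu.2⟩ N))).symm

/-- The spectral projections of a quasi-projection and of its shifts have the same class. -/
lemma cls_spectralProj_shift (hσ0 : ∀ b, σ 0 b = b) (hc : ∀ b, Continuous fun N => σ N b)
    (hε' : ε < 1 / 4) {p : CMat n B} (hp : p ∈ QProj ε S n) (N : NNReal) :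
    K0Unital.cls (spectralProj (mapMat (σ N) p)) (spectralProj_isStarProjection _) =
      K0Unital.cls (spectralProj p) (spectralProj_isStarProjection _) :=
  congrArg Algebra.GrothendieckAddGroup.of
    (MatFamily.cls_eq_of_joinedIn (F := projFam B) _ _ (joinedIn_spectralProj_spectralProj hε'
    (joined_shift (Q := QProj ε (⊤ : Submodule ℂ B) n) hσ0 hc
      (fun N _ h => mapMat_mem_QProj (σ N) h) ⟨fun _ _ => trivial, hp.2⟩ N))).symm

end Comparison

/-! ### Block matrices and the rotation homotopy. -/

section Rotation

open Matrix

variable {B : Type*} [CStarAlgebra B] {n m : ℕ}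

/-- A block matrix. -/
def block (a : Matrix (Fin n) (Fin n) B) (b : Matrix (Fin n) (Fin m) B)
    (c : Matrix (Fin m) (Fin n) B) (d : Matrix (Fin m) (Fin m) B) : CMat (n + m) B :=
  CStarMatrix.ofMatrix (Matrix.reindex finSumFinEquiv finSumFinEquiv (Matrix.fromBlocks a b c d))

lemma dsum_eq_block (a : CMat n B) (b : CMat m B) :
    dsum a b = block (CStarMatrix.ofMatrix.symm a) 0 0 (CStarMatrix.ofMatrix.symm b) := rfl

lemma block_mul (a a' : Matrix (Fin n) (Fin n) B) (b b' : Matrix (Fin n) (Fin m) B)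
    (c c' : Matrix (Fin m) (Fin n) B) (d d' : Matrix (Fin m) (Fin m) B) :
    block a b c d * block a' b' c' d' =
      block (a * a' + b * c') (a * b' + b * d') (c * a' + d * c') (c * b' + d * d') := by
  have h := Matrix.submatrix_mul_equiv (Matrix.fromBlocks a b c d) (Matrix.fromBlocks a' b' c' d')
    finSumFinEquiv.symm finSumFinEquiv.symm finSumFinEquiv.symm
  rw [Matrix.fromBlocks_multiply] at h
  exact h

lemma block_star (a : Matrix (Fin n) (Fin n) B) (b : Matrix (Fin n) (Fin m) B)
    (c : Matrix (Fin m) (Fin n) B) (d : Matrix (Fin m) (Fin m) B) :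
    star (block a b c d) = block aᴴ cᴴ bᴴ dᴴ := by
  unfold block
  rw [← Matrix.fromBlocks_conjTranspose]
  rfl

lemma continuous_block {Y : Type*} [TopologicalSpace Y] {a : Y → Matrix (Fin n) (Fin n) B}
    {b : Y → Matrix (Fin n) (Fin m) B} {c : Y → Matrix (Fin m) (Fin n) B}
    {d : Y → Matrix (Fin m) (Fin m) B} (ha : Continuous a) (hb : Continuous b)
    (hc : Continuous c) (hd : Continuous d) :
    Continuous fun y => block (a y) (b y) (c y) (d y) :=
  (ha.matrix_fromBlocks hb hc hd).matrix_reindex _ _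

/-- Murray-von Neumann equivalent projections become homotopic after a rotation, also in the
presence of an orthogonal projection `x`. -/
lemma joinedIn_rotation {x : Matrix (Fin n) (Fin n) B} (hx : x * x = x) (hxs : xᴴ = x)
    {v : Matrix (Fin n) (Fin m) B} (hxv : x * v = 0) (hv : v * vᴴ * v = v) :
    JoinedIn {p : CMat (n + m) B | IsStarProjection p}
      (dsum (CStarMatrix.ofMatrix (x + v * vᴴ)) 0)
      (dsum (CStarMatrix.ofMatrix x) (CStarMatrix.ofMatrix (vᴴ * v))) := by
  let c : ℝ → ℂ := fun t => (Real.cos (Real.pi / 2 * t) : ℝ)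
  let s : ℝ → ℂ := fun t => (Real.sin (Real.pi / 2 * t) : ℝ)
  have hcs : ∀ t, c t * c t + s t * s t = 1 := fun t => by
    have := Real.cos_sq_add_sin_sq (Real.pi / 2 * t)
    simp only [c, s]
    norm_cast
    linarith
  have hvx : vᴴ * x = 0 := by
    have := congrArg conjTranspose hxv
    rwa [conjTranspose_mul, hxs, conjTranspose_zero] at this
  have hv' : vᴴ * v * vᴴ = vᴴ := by
    have := congrArg conjTranspose hv
    rwa [conjTranspose_mul, conjTranspose_mul, conjTranspose_conjTranspose, ← Matrix.mul_assoc]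
      at this
  have hv2 : v * vᴴ * (v * vᴴ) = v * vᴴ := by rw [← Matrix.mul_assoc, hv]
  have hv3 : vᴴ * v * (vᴴ * v) = vᴴ * v := by rw [← Matrix.mul_assoc, hv']
  have hxvv : x * (v * vᴴ) = 0 := by rw [← Matrix.mul_assoc, hxv, Matrix.zero_mul]
  have hvvx : v * vᴴ * x = 0 := by rw [Matrix.mul_assoc, hvx, Matrix.mul_zero]
  have hcc : ∀ t, star (c t) = c t := fun t => Complex.conj_ofReal _
  have hss : ∀ t, star (s t) = s t := fun t => Complex.conj_ofReal _
  -- This is $\mathrm{diag}(x,0)+w_tw_t^*$ for the partial isometry $w_t$ with blocks $c_tv$ and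
  -- $s_tv^*v$; the identity $vv^*v=v$ simplifies the off-diagonal blocks, and $xv=0$ makes the two
  -- summands orthogonal.
  refine JoinedIn.ofLine (f := fun t => block (x + (c t * c t) • (v * vᴴ)) ((c t * s t) • v)
    ((c t * s t) • vᴴ) ((s t * s t) • (vᴴ * v))) ?_ ?_ ?_ ?_
  · have h1 : Continuous c := by fun_prop
    have h2 : Continuous s := by fun_prop
    exact (continuous_block (by fun_prop) (by fun_prop) (by fun_prop) (by fun_prop)).continuousOn
  · simp only [c, s, dsum_eq_block]
    simp
    rfl
  · simp [c, s, dsum_eq_block]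
  · rintro _ ⟨t, -, rfl⟩
    have h := hcs t
    have h1 := hcc t
    have h2 := hss t
    dsimp only
    generalize c t = c at *
    generalize s t = s at *
    constructor
    · rw [IsIdempotentElem, block_mul]
      simp only [Matrix.add_mul, Matrix.mul_add, hx, Matrix.smul_mul, Matrix.mul_smul, hxvv, hvvx,
        hxv, hvx, smul_zero, hv, hv', hv2, hv3, add_zero, zero_add, smul_smul,
        ← Matrix.mul_assoc vᴴ v vᴴ, ← Matrix.mul_assoc v vᴴ v]
      congr 1
      · rw [add_assoc, ← add_smul]
        congr 2
        linear_combination (c * c) * h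
      · rw [← add_smul]
        congr 1
        linear_combination (c * s) * h
      · rw [← add_smul]
        congr 1
        linear_combination (c * s) * h
      · rw [← add_smul]
        congr 1
        linear_combination (s * s) * h
    · rw [IsSelfAdjoint, block_star]
      simp only [conjTranspose_add, conjTranspose_smul, conjTranspose_mul,
        conjTranspose_conjTranspose, hxs, star_mul', h1, h2]

end Rotation

/-! ### The group of formal differences $[p,\ell]$ as a Grothendieck group. -/

section KZero

variable {B : Type*} [CStarAlgebra B] {S : Submodule ℂ B} {n m : ℕ} {ε : ℝ}

-- The equations for `p`, `q` and `y` are separate hypotheses so that the rotation, which is phrased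
-- for plain matrices, can be applied to elements of the C*-matrix algebra. The zero block in the
-- rotation contributes the zero class.
open Matrix in
lemma cls_eq_add_of_rotation {x : Matrix (Fin n) (Fin n) B} (hx : x * x = x)
    (hxs : xᴴ = x) {v : Matrix (Fin n) (Fin m) B} (hxv : x * v = 0) (hv : v * vᴴ * v = v)
    {p : CMat n B} {q : CMat n B} {y : CMat m B} (hp : IsStarProjection p)
    (hq : IsStarProjection q) (hy : IsStarProjection y)
    (ep : p = CStarMatrix.ofMatrix (x + v * vᴴ)) (eq : q = CStarMatrix.ofMatrix x)
    (ey : y = CStarMatrix.ofMatrix (vᴴ * v)) :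
    MatFamily.cls (F := projFam B) p hp =
      MatFamily.cls (F := projFam B) q hq + MatFamily.cls (F := projFam B) y hy := by
  have h := joinedIn_rotation hx hxs hxv hv
  rw [← ep, ← eq, ← ey] at h
  have h0 : MatFamily.cls (F := projFam B) (0 : CMat m B) (IsStarProjection.zero _) = 0 := by
    rw [← MatFamily.cls_diagMat (F := projFam B) m]
    congr 1
    exact (diagMat_zero m).symm
  rw [← add_zero (MatFamily.cls (F := projFam B) p hp), ← h0]
  exact MatFamily.cls_eq_of_joinedIn (F := projFam B)
    ((projFam B).dsum_mem hp (IsStarProjection.zero _)) ((projFam B).dsum_mem hq hy) h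

/-- This is the rotation with $x=q$ and $v=1-q$. It makes every projection a summand of a unit
matrix, so unit classes suffice both for cancellation and as subtrahends. -/
lemma cls_add_cls_one_sub {q : CMat n B} (hq : IsStarProjection q) :
    MatFamily.cls (F := projFam B) q hq + MatFamily.cls (F := projFam B) (1 - q) hq.one_sub =
      MatFamily.cls (F := projFam B) (1 : CMat n B) (IsStarProjection.one _) := by
  have h1 : q * q = q := hq.isIdempotentElem
  have h2 : star (1 - q) = 1 - q := hq.one_sub.isSelfAdjoint
  have h3 : (1 - q) * (1 - q) = 1 - q := hq.one_sub.isIdempotentElem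
  refine (cls_eq_add_of_rotation (x := CStarMatrix.ofMatrix.symm q)
    (v := CStarMatrix.ofMatrix.symm (1 - q)) h1 hq.isSelfAdjoint ?_ ?_ _ _ _ ?_ rfl ?_).symm
  · change q * (1 - q) = 0
    rw [mul_sub, h1, mul_one, sub_self]
  · change (1 - q) * star (1 - q) * (1 - q) = 1 - q
    rw [h2, h3, h3]
  · change 1 = q + (1 - q) * star (1 - q)
    rw [h2, h3]; abel
  · change 1 - q = star (1 - q) * (1 - q)
    rw [h2, h3]

lemma oneCls_zero (ε : ℝ) (hε : 0 < ε) (S : Submodule ℂ B) (h1 : (1 : B) ∈ S) :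
    oneCls ε hε S h1 0 = 0 := by
  refine congrArg (Quotient.mk (qProjFam ε hε S).homotopySetoid) ?_
  exact Sigma.ext rfl (heq_of_eq (Subtype.ext (by ext i; exact i.elim0)))

lemma classesMap_oneCls (hε : 0 < ε) (hε' : ε < 1 / 4) (h1 : (1 : B) ∈ S) (k : ℕ) :
    (spectralProjHom hε hε' S).classesMap (oneCls ε hε S h1 k) =
      MatFamily.cls (F := projFam B) (1 : CMat k B) (IsStarProjection.one _) := by
  refine congrArg (Quotient.mk (projFam B).homotopySetoid) ?_
  exact Sigma.ext rfl (heq_of_eq (Subtype.ext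
    (spectralProj_of_isStarProjection (IsStarProjection.one _))))

lemma grothendieck_of_eq_iff {P : Type*} [AddCommMonoid P] {a b : P} :
    Algebra.GrothendieckAddGroup.of a = Algebra.GrothendieckAddGroup.of b ↔
      ∃ c, c + a = c + b := by
  refine ((AddLocalization.addMonoidOf (⊤ : AddSubmonoid P)).eq_iff_exists).trans ?_
  exact ⟨fun ⟨c, h⟩ => ⟨c, h⟩, fun ⟨c, h⟩ => ⟨⟨c, trivial⟩, h⟩⟩

lemma grothendieck_exists_sub {P : Type*} [AddCommMonoid P]
    (x : Algebra.GrothendieckAddGroup P) :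
    ∃ a b : P, x = Algebra.GrothendieckAddGroup.of a - Algebra.GrothendieckAddGroup.of b := by
  obtain ⟨⟨a, b⟩, h⟩ := (AddLocalization.addMonoidOf (⊤ : AddSubmonoid P)).surj x
  exact ⟨a, b, eq_sub_of_add_eq h⟩

/-- The comparison map `[p, ℓ] ↦ [χ(p)] - [I_ℓ]` before passing to the quotient. -/
noncomputable def preComparisonHom (hε : 0 < ε) (hε' : ε < 1 / 4) (S : Submodule ℂ B)
    (h1 : (1 : B) ∈ S) : (qProjFam ε hε S).Classes × ℕ →+ K0Unital B where
  toFun x := Algebra.GrothendieckAddGroup.of ((spectralProjHom hε hε' S).classesMap x.1) -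
    Algebra.GrothendieckAddGroup.of ((spectralProjHom hε hε' S).classesMap
      (oneCls ε hε S h1 x.2))
  map_zero' := by
    simp only [Prod.fst_zero, Prod.snd_zero, oneCls_zero, sub_self]
  map_add' x y := by
    simp only [Prod.fst_add, Prod.snd_add, oneCls_add, map_add]
    abel

/-- The auxiliary summand $I_k$ of the relation cancels in a group. -/
lemma preComparisonHom_eq (hε : 0 < ε) (hε' : ε < 1 / 4) (h1 : (1 : B) ∈ S)
    {x y : (qProjFam ε hε S).Classes × ℕ} (h : k0Con ε hε S h1 x y) :
    preComparisonHom hε hε' S h1 x = preComparisonHom hε hε' S h1 y := by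
  obtain ⟨k, h⟩ := h
  have h := congrArg (fun z => (Algebra.GrothendieckAddGroup.of
    ((spectralProjHom hε hε' S).classesMap z) : K0Unital B)) h
  simp only [oneCls_add, map_add] at h
  refine sub_eq_sub_iff_add_eq_add.2 ?_
  rw [add_left_comm, add_left_comm (Algebra.GrothendieckAddGroup.of
    ((spectralProjHom hε hε' S).classesMap y.1))] at h
  exact add_left_cancel h

/-- The comparison map `[p, ℓ] ↦ [χ(p)] - [I_ℓ]`. -/
noncomputable def comparisonHom (hε : 0 < ε) (hε' : ε < 1 / 4) (S : Submodule ℂ B)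
    (h1 : (1 : B) ∈ S) : CtrlK0Unital ε hε S h1 →+ K0Unital B :=
  (k0Con ε hε S h1).lift (preComparisonHom hε hε' S h1)
    fun _ _ h => preComparisonHom_eq hε hε' h1 h

lemma comparisonHom_cls (hε : 0 < ε) (hε' : ε < 1 / 4) (h1 : (1 : B) ∈ S) {p : CMat n B}
    (hp : p ∈ QProj ε S n) (l : ℕ) :
    comparisonHom hε hε' S h1 (CtrlK0Unital.cls hε h1 p hp l) =
      K0Unital.cls (spectralProj p) (spectralProj_isStarProjection p) -
        K0Unital.cls (1 : CMat l B) (IsStarProjection.one _) := by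
  change Algebra.GrothendieckAddGroup.of ((spectralProjHom hε hε' S).classesMap _) -
    Algebra.GrothendieckAddGroup.of ((spectralProjHom hε hε' S).classesMap
      (oneCls ε hε S h1 l)) = _
  rw [classesMap_oneCls]
  rfl

/-- Combines the bijection between the monoids of classes with cofinality of the unit classes in the
Grothendieck group. -/
theorem comparisonHom_bijective {σ : NNReal → (B →⋆ₐ[ℂ] B)} (hS : IsAbsorbing σ S) (hε : 0 < ε)
    (hε' : ε < 1 / 4) (h1 : (1 : B) ∈ S) :
    Function.Bijective (comparisonHom hε hε' S h1) := by
  have hb := spectralProjHom_bijective hS hε hε'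
  constructor
  · rintro ⟨x, l⟩ ⟨y, k⟩ h
    have h' : Algebra.GrothendieckAddGroup.of ((spectralProjHom hε hε' S).classesMap x) -
        Algebra.GrothendieckAddGroup.of ((spectralProjHom hε hε' S).classesMap
          (oneCls ε hε S h1 l)) =
      Algebra.GrothendieckAddGroup.of ((spectralProjHom hε hε' S).classesMap y) -
        Algebra.GrothendieckAddGroup.of ((spectralProjHom hε hε' S).classesMap
          (oneCls ε hε S h1 k)) := h
    rw [sub_eq_sub_iff_add_eq_add, ← map_add, ← map_add, ← map_add, ← map_add,
      grothendieck_of_eq_iff] at h'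
    obtain ⟨⟨m, q, hq⟩, hc⟩ := h'
    -- Equality in the Grothendieck group holds after adding some $[q]$; adding $[1-q]$ as well
    -- turns this into $[I_m]$, and $m$ becomes the witness $k$ of the relation.
    have hc := congrArg (fun z => MatFamily.cls (F := projFam B) (1 - q) (IsStarProjection.one_sub hq) + z) hc
    have e : ∀ z, MatFamily.cls (F := projFam B) (1 - q) (IsStarProjection.one_sub hq) +
        (MatFamily.cls (F := projFam B) q hq + z) =
        (spectralProjHom hε hε' S).classesMap (oneCls ε hε S h1 m) + z := by
      intro z
      rw [classesMap_oneCls, ← cls_add_cls_one_sub hq]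
      abel
    refine (AddCon.eq (k0Con ε hε S h1)).2 ⟨m, hb.1 ?_⟩
    have hc := ((e _).symm.trans hc).trans (e _)
    simp only [oneCls_add, map_add] at hc ⊢
    rw [add_left_comm, hc, add_left_comm]
  · intro x
    obtain ⟨a, ⟨m, q, hq⟩, rfl⟩ := grothendieck_exists_sub x
    -- This rewrites $a-[q]$ as $(a+[1-q])-[I_m]$, whose subtrahend is a unit class.
    obtain ⟨y, hy⟩ := hb.2 (a + MatFamily.cls (F := projFam B) (1 - q) (IsStarProjection.one_sub hq))
    refine ⟨(k0Con ε hε S h1).toQuotient (y, m), ?_⟩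
    change Algebra.GrothendieckAddGroup.of ((spectralProjHom hε hε' S).classesMap y) -
        Algebra.GrothendieckAddGroup.of ((spectralProjHom hε hε' S).classesMap
          (oneCls ε hε S h1 m)) = Algebra.GrothendieckAddGroup.of a -
            Algebra.GrothendieckAddGroup.of (MatFamily.cls (F := projFam B) q hq)
    rw [hy, classesMap_oneCls, ← cls_add_cls_one_sub hq, map_add, map_add]
    abel

end KZero

/-! ### Projections over $\mathbb C$ are classified by their rank. -/

section Scalars

open Matrix

/-- A projection of rank `l` over `ℂ` is of the form `v v*` for an isometry `v` on `ℂ^l`. -/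
lemma exists_isometry_of_rank {n l : ℕ} {p : Matrix (Fin n) (Fin n) ℂ} (hp : p * p = p)
    (hps : p.IsHermitian) (hl : p.rank = l) :
    ∃ v : Matrix (Fin n) (Fin l) ℂ, v * vᴴ = p ∧ vᴴ * v = 1 := by
  have hev : ∀ i, hps.eigenvalues i = 0 ∨ hps.eigenvalues i = 1 := by
    intro i
    have h1 := hps.mulVec_eigenvectorBasis i
    have h2 : p *ᵥ (p *ᵥ (hps.eigenvectorBasis i).ofLp) = p *ᵥ (hps.eigenvectorBasis i).ofLp := by
      rw [mulVec_mulVec, hp]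
    rw [h1, mulVec_smul, h1, smul_smul] at h2
    have h3 : (hps.eigenvectorBasis i).ofLp ≠ 0 := by
      intro h
      have := hps.eigenvectorBasis.orthonormal.ne_zero i
      exact this (by ext j; simp [h])
    have h4 := smul_left_injective ℝ h3 h2
    have h5 : hps.eigenvalues i * (hps.eigenvalues i - 1) = 0 := by
      linear_combination h4
    rcases mul_eq_zero.1 h5 with h | h
    · exact Or.inl h
    · exact Or.inr (by linarith)
  have hcard : Fintype.card {i // hps.eigenvalues i ≠ 0} = l := by
    rw [← hps.rank_eq_card_non_zero_eigs, hl]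
  -- The rank counts the nonzero eigenvalues, all of which are $1$; the columns of the isometry are
  -- the corresponding orthonormal eigenvectors.
  let e : Fin l ≃ {i // hps.eigenvalues i ≠ 0} := (Fintype.equivFinOfCardEq hcard).symm
  let U : Matrix (Fin n) (Fin n) ℂ := hps.eigenvectorUnitary
  have hU : Uᴴ * U = 1 := (Unitary.mem_iff.1 hps.eigenvectorUnitary.2).1
  refine ⟨Matrix.of fun i k => U i (e k), ?_, ?_⟩
  · have h := hps.spectral_theorem
    rw [Unitary.conjStarAlgAut_apply] at h
    conv_rhs => rw [h]
    ext i j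
    rw [Matrix.mul_apply, Matrix.mul_assoc, Matrix.mul_apply]
    have hs : ∀ k, (diagonal (RCLike.ofReal (K := ℂ) ∘ hps.eigenvalues) * star U) k j =
        (hps.eigenvalues k : ℂ) * star (U j k) := by
      intro k
      rw [diagonal_mul]
      rfl
    change ∑ k, U i (e k) * star (U j (e k)) = ∑ k, U i k *
      (diagonal (RCLike.ofReal (K := ℂ) ∘ hps.eigenvalues) * star U) k j
    rw [Equiv.sum_comp e fun k : {i // hps.eigenvalues i ≠ 0} => U i k * star (U j k)]
    rw [← Finset.sum_subtype (Finset.univ.filter fun i => hps.eigenvalues i ≠ 0) (by simp)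
      (fun k => U i k * star (U j k)), Finset.sum_filter]
    refine Finset.sum_congr rfl fun k _ => ?_
    rw [hs]
    rcases hev k with h0 | h0 <;> simp [h0]
  · ext k k'
    have h := congrFun (congrFun hU (e k)) (e k')
    rw [Matrix.mul_apply] at h ⊢
    rw [Matrix.one_apply] at h ⊢
    simp only [Subtype.coe_inj, EmbeddingLike.apply_eq_iff_eq] at h
    exact h

/-- With $p=vv^*$ for an isometry $v$, the trace is that of $v^*v$, a unit matrix of size the rank.
-/
lemma trace_eq_rank {n : ℕ} {p : Matrix (Fin n) (Fin n) ℂ} (hp : p * p = p)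
    (hps : p.IsHermitian) : p.trace = p.rank := by
  obtain ⟨v, h1, h2⟩ := exists_isometry_of_rank hp hps rfl
  conv_lhs => rw [← h1]
  rw [trace_mul_comm, h2, trace_one, Fintype.card_fin]

/-- Along a path of projections the rank is the trace, hence continuous, and an integer-valued
continuous function on the interval is constant. -/
lemma rank_eq_of_joinedIn {n : ℕ} {p q : CMat n ℂ}
    (h : JoinedIn {p : CMat n ℂ | IsStarProjection p} p q) :
    (CStarMatrix.ofMatrix.symm p).rank = (CStarMatrix.ofMatrix.symm q).rank := by
  obtain ⟨γ, hγ⟩ := h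
  have h1 : ∀ t, (CStarMatrix.ofMatrix.symm (γ t)).trace.re =
      ((CStarMatrix.ofMatrix.symm (γ t)).rank : ℝ) := fun t => by
    rw [trace_eq_rank (p := CStarMatrix.ofMatrix.symm (γ t)) (hγ t).isIdempotentElem
      (hγ t).isSelfAdjoint, Complex.natCast_re]
  have h2 : Continuous fun t => ((CStarMatrix.ofMatrix.symm (γ t)).rank : ℝ) := by
    simp only [← h1]
    have h3 : Continuous fun t => (CStarMatrix.ofMatrix.symm (γ t) : Matrix (Fin n) (Fin n) ℂ) :=
      γ.continuous
    exact Complex.continuous_re.comp h3.matrix_trace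
  have h3 : Continuous fun t => (CStarMatrix.ofMatrix.symm (γ t)).rank :=
    Nat.isUniformEmbedding_coe_real.isEmbedding.continuous_iff.2 h2
  simpa using PreconnectedSpace.constant inferInstance h3 (x := 0) (y := 1)

lemma rank_dsum {n m : ℕ} (p : CMat n ℂ) (q : CMat m ℂ) :
    (CStarMatrix.ofMatrix.symm (dsum p q)).rank =
      (CStarMatrix.ofMatrix.symm p).rank + (CStarMatrix.ofMatrix.symm q).rank := by
  rw [← rank_fromBlocks_diag]
  exact Matrix.rank_reindex _ _ _

lemma rank_pad {n N : ℕ} (h : n ≤ N) (p : CMat n ℂ) :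
    (CStarMatrix.ofMatrix.symm (pad 0 N p)).rank = (CStarMatrix.ofMatrix.symm p).rank := by
  obtain ⟨k, rfl⟩ := Nat.exists_eq_add_of_le h
  rw [pad_add, rank_dsum, diagMat_zero]
  change _ + (0 : Matrix (Fin k) (Fin k) ℂ).rank = _
  rw [Matrix.rank_zero, add_zero]

/-- The rank on homotopy classes of projections over `ℂ`. -/
noncomputable def rankClasses : (projFam ℂ).Classes →+ ℤ where
  toFun := Quotient.lift (fun a => ((CStarMatrix.ofMatrix.symm a.2.1).rank : ℤ)) (by
    rintro a b ⟨N, h1, h2, h⟩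
    have := rank_eq_of_joinedIn h
    have e1 := rank_pad h1 a.2.1
    have e2 := rank_pad h2 b.2.1
    exact congrArg _ (e1.symm.trans (this.trans e2)))
  map_zero' := by
    change ((CStarMatrix.ofMatrix.symm (diagMat (0 : ℂ) 0)).rank : ℤ) = 0
    rw [diagMat_zero]
    exact_mod_cast Matrix.rank_zero
  map_add' := by
    rintro ⟨a⟩ ⟨b⟩
    exact (congrArg Nat.cast (rank_dsum a.2.1 b.2.1)).trans (Nat.cast_add _ _)

/-- Two projections over `ℂ` define the same class in `K_0(ℂ)` if and only if they have the same
rank. -/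
theorem cls_eq_cls_one_iff {n l : ℕ} {p : CMat n ℂ} (hp : IsStarProjection p) :
    K0Unital.cls p hp = K0Unital.cls (1 : CMat l ℂ) (IsStarProjection.one _) ↔
      (CStarMatrix.ofMatrix.symm p).rank = l := by
  constructor
  · intro h
    have h := congrArg (Algebra.GrothendieckAddGroup.lift rankClasses) h
    have e : ∀ x, Algebra.GrothendieckAddGroup.lift rankClasses
        (Algebra.GrothendieckAddGroup.of x) = rankClasses x :=
      DFunLike.congr_fun (Algebra.GrothendieckAddGroup.lift.symm_apply_apply rankClasses)
    rw [K0Unital.cls, K0Unital.cls, e, e] at h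
    have h' : ((CStarMatrix.ofMatrix.symm p).rank : ℤ) =
      ((1 : Matrix (Fin l) (Fin l) ℂ).rank : ℤ) := h
    rw [Matrix.rank_one, Fintype.card_fin] at h'
    exact_mod_cast h'
  · intro h
    obtain ⟨v, h1, h2⟩ := exists_isometry_of_rank (p := CStarMatrix.ofMatrix.symm p)
      hp.isIdempotentElem hp.isSelfAdjoint h
    refine congrArg Algebra.GrothendieckAddGroup.of ?_
    have h0 : MatFamily.cls (F := projFam ℂ) (0 : CMat n ℂ) (IsStarProjection.zero _) = 0 := by
      rw [← MatFamily.cls_diagMat (F := projFam ℂ) n]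
      congr 1
      exact (diagMat_zero n).symm
    -- The isometry is a Murray-von Neumann equivalence between $p=vv^*$ and $I_l=v^*v$, so the
    -- rotation applies with $x=0$.
    rw [cls_eq_add_of_rotation (x := 0) (v := v) (by simp) (by simp) (by simp)
      (by rw [Matrix.mul_assoc, h2, Matrix.mul_one]) hp (IsStarProjection.zero _)
      (IsStarProjection.one (CMat l ℂ)) (by rw [zero_add, h1]; rfl) rfl (by rw [h2]; rfl), h0,
      zero_add]

end Scalars

/-! ### Analytic properties of the shift in time. -/

section LocalizationShift

open BoundedContinuousFunction

variable {X : Type*} [MetricSpace X] [LocallyCompactSpace X]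
variable {H : Type*} [NormedAddCommGroup H] [InnerProductSpace ℂ H] [CompleteSpace H]
variable {M : AmpleModule X H}

/-- Uniform continuity passes to uniform limits. -/
lemma uniformContinuous_of_mem_locAlg (f : LocAlg M) :
    UniformContinuous (f : Ray →ᵇ (H →L[ℂ] H)) := by
  rw [Metric.uniformContinuous_iff]
  intro δ hδ
  obtain ⟨g, hg, hfg⟩ := Metric.mem_closure_iff.1
    (show (f : Ray →ᵇ (H →L[ℂ] H)) ∈ closure (algLoc M : Set (Ray →ᵇ (H →L[ℂ] H))) from f.2)
    (δ / 3) (by positivity)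
  obtain ⟨η, hη, h⟩ := Metric.uniformContinuous_iff.1 hg.1 (δ / 3) (by positivity)
  refine ⟨η, hη, fun {s t} hst => ?_⟩
  have h1 := BoundedContinuousFunction.dist_coe_le_dist (f := (f : Ray →ᵇ (H →L[ℂ] H))) (g := g) s
  have h2 := BoundedContinuousFunction.dist_coe_le_dist (f := (f : Ray →ᵇ (H →L[ℂ] H))) (g := g) t
  have h3 := h hst
  have h4 := dist_triangle4_right ((f : Ray →ᵇ (H →L[ℂ] H)) s) ((f : Ray →ᵇ (H →L[ℂ] H)) t)
    (g s) (g t)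
  linarith

/-- Norm continuity in $N$ is uniform continuity of $f$: at each time, the two shifted arguments
differ by $|N'-N|$. -/
lemma continuous_timeShift_apply (f : LocAlg M) : Continuous fun N => timeShift M N f := by
  rw [Metric.continuous_iff]
  intro N δ hδ
  obtain ⟨η, hη, h⟩ := Metric.uniformContinuous_iff.1 (uniformContinuous_of_mem_locAlg f) (δ / 2)
    (by positivity)
  refine ⟨η, hη, fun N' hN' => ?_⟩
  refine lt_of_le_of_lt ?_ (half_lt_self hδ)
  rw [Subtype.dist_eq]
  refine (BoundedContinuousFunction.dist_le (by positivity)).2 fun t => ?_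
  rw [timeShift_apply, timeShift_apply]
  refine (h ?_).le
  rw [Subtype.dist_eq]
  change dist ((t : ℝ) + N') ((t : ℝ) + N) < η
  rw [dist_add_left]
  exact hN'

lemma timeShift_zero (f : LocAlg M) : timeShift M 0 f = f := by
  refine Subtype.ext (BoundedContinuousFunction.ext fun t => ?_)
  rw [timeShift_apply]
  congr 1
  exact Subtype.ext (by change (t : ℝ) + ((0 : NNReal) : ℝ) = t; simp)

lemma continuous_timeShift (N : NNReal) : Continuous (timeShift M N) :=
  (LipschitzWith.of_dist_le_mul (K := 1) fun f g => by
    rw [NNReal.coe_one, one_mul]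
    exact (BoundedContinuousFunction.dist_le dist_nonneg).2 fun t =>
      BoundedContinuousFunction.dist_coe_le_dist (f := (f : Ray →ᵇ (H →L[ℂ] H)))
        (g := (g : Ray →ᵇ (H →L[ℂ] H))) (rayShift N t)).continuous

lemma timeShift_mem_locFiltration {r : ℝ} (hr : 0 < r) (N : NNReal) {f : LocAlg M}
    (hf : f ∈ (locFiltration M).sub r hr) : timeShift M N f ∈ (locFiltration M).sub r hr :=
  ⟨algLoc_shift N hf.1, lt_of_le_of_lt (iSup_le fun t =>
    le_iSup (fun t => M.propagation ((f : Ray →ᵇ (H →L[ℂ] H)) t)) (rayShift N t)) hf.2⟩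

/-- Once the propagation stays small from some time on, a shift beyond that time removes all larger
values. -/
lemma eventually_timeShift_mem {r : ℝ} (hr : 0 < r) {f : LocAlg M} (hf : f ∈ algLocSub M) :
    ∀ᶠ N in atTop, timeShift M N f ∈ (locFiltration M).sub r hr := by
  -- A bound by $r/2$ at each time keeps the supremum strictly below $r$.
  have h0 : (0 : ℝ≥0∞) < ENNReal.ofReal (r / 2) := ENNReal.ofReal_pos.2 (by positivity)
  obtain ⟨T, hT⟩ := eventually_atTop.1
    ((mem_algLoc.1 (mem_algLocSub.1 hf)).2.2.eventually (ge_mem_nhds h0))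
  filter_upwards [eventually_ge_atTop (T : ℝ).toNNReal] with N hN
  refine ⟨algLoc_shift N hf, lt_of_le_of_lt (iSup_le fun t => hT (rayShift N t) ?_)
    ((ENNReal.ofReal_lt_ofReal_iff hr).2 (half_lt_self hr))⟩
  change (T : ℝ) ≤ t + N
  have h1 := Real.le_coe_toNNReal (T : ℝ)
  have h2 : ((T : ℝ).toNNReal : ℝ) ≤ N := NNReal.coe_le_coe.2 hN
  have h3 : (1 : ℝ) ≤ t := t.2
  linarith

lemma dense_algLocSub : Dense (algLocSub M : Set (LocAlg M)) := by
  intro f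
  refine Metric.mem_closure_iff.2 fun δ hδ => ?_
  obtain ⟨g, hg, hfg⟩ := Metric.mem_closure_iff.1
    (show (f : Ray →ᵇ (H →L[ℂ] H)) ∈ closure (algLoc M : Set (Ray →ᵇ (H →L[ℂ] H))) from f.2) δ hδ
  exact ⟨⟨g, subset_closure hg⟩, hg, hfg⟩

/-- A filtration of the localization algebra that contains the subspaces of `locFiltration` and is
invariant under shifts in time. -/
structure ShiftInvariant (F : Filtration (LocAlg M)) : Prop where
  le : ∀ {r : ℝ} (hr : 0 < r), (locFiltration M).sub r hr ≤ F.sub r hr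
  map_mem : ∀ {r : ℝ} (hr : 0 < r) (N : NNReal), ∀ f ∈ F.sub r hr, timeShift M N f ∈ F.sub r hr

/-- The two filtrations enter the rest of the proof only through these properties; for the closures,
invariance follows from continuity of each shift. -/
lemma shiftInvariant_of_eq {F : Filtration (LocAlg M)}
    (hF : F = locFiltration M ∨ F = (locFiltration M).closure) : ShiftInvariant F := by
  rcases hF with rfl | rfl
  · exact ⟨fun hr => le_rfl, fun hr N f hf => timeShift_mem_locFiltration hr N hf⟩
  · exact ⟨fun hr => Submodule.le_topologicalClosure _, fun hr N f hf =>
      map_mem_closure (continuous_timeShift N) hf fun _ h => timeShift_mem_locFiltration hr N h⟩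

end LocalizationShift

/-! ### Passing to the unitization with fixed scalars. -/

section UnitizationShift

variable {A : Type*} [NonUnitalCStarAlgebra A] {τ : NNReal → (A →⋆ₙₐ[ℂ] A)} {F : Filtration A}
  {D : Submodule ℂ A}

/-- A continuous family of endomorphisms of a filtered C*-algebra, starting at the identity, that
preserves the filtration and moves the elements of a dense subspace `D` into every step of the
filtration. -/
structure IsContracting (τ : NNReal → (A →⋆ₙₐ[ℂ] A)) (F : Filtration A) (D : Submodule ℂ A) :
    Prop where
  zero_apply : ∀ a, τ 0 a = a
  continuous_apply : ∀ a, Continuous fun N => τ N a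
  map_mem : ∀ {r : ℝ} (hr : 0 < r) (N : NNReal), ∀ a ∈ F.sub r hr, τ N a ∈ F.sub r hr
  eventually_mem : ∀ {r : ℝ} (hr : 0 < r), ∀ a ∈ D, ∀ᶠ N in atTop, τ N a ∈ F.sub r hr
  dense : Dense (D : Set A)

lemma snd_starMap (φ : A →⋆ₙₐ[ℂ] A) (x : Unitization ℂ A) :
    (Unitization.starMap φ x).snd = φ x.snd := by
  induction x with
  | inl_add_inr c a =>
    rw [map_add, Unitization.starMap_inl, Unitization.starMap_inr]
    simp [Unitization.algebraMap_eq_inl]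

lemma fst_starMap (φ : A →⋆ₙₐ[ℂ] A) (x : Unitization ℂ A) :
    (Unitization.starMap φ x).fst = x.fst := by
  induction x with
  | inl_add_inr c a =>
    rw [map_add, Unitization.starMap_inl, Unitization.starMap_inr]
    simp [Unitization.algebraMap_eq_inl]

lemma starMap_mem_addScalars {S : Submodule ℂ A} {φ : A →⋆ₙₐ[ℂ] A} {x : Unitization ℂ A} :
    Unitization.starMap φ x ∈ addScalars S ↔ φ x.snd ∈ S := by
  rw [← snd_starMap]
  rfl

lemma IsContracting.eventually_starMap_mem (h : IsContracting τ F D) {r : ℝ} (hr : 0 < r)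
    {x : Unitization ℂ A} (hx : x ∈ addScalars D) :
    ∀ᶠ N in atTop, Unitization.starMap (τ N) x ∈ addScalars (F.sub r hr) :=
  (h.eventually_mem hr x.snd hx).mono fun _ h => starMap_mem_addScalars.2 h

/-- The unitization is topologically the product of $\mathbb C$ and $A$, and the extended
endomorphisms act only on the second factor. -/
lemma IsContracting.isAbsorbing (h : IsContracting τ F D) {r : ℝ} (hr : 0 < r) :
    IsAbsorbing (fun N => Unitization.starMap (τ N)) (addScalars (F.sub r hr)) where
  zero_apply x := Unitization.ext (fst_starMap _ x) ((snd_starMap _ x).trans (h.zero_apply _))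
  continuous_apply x := by
    have h' : Continuous fun N => Unitization.uniformEquivProd.symm (x.fst, τ N x.snd) :=
      Unitization.uniformEquivProd.symm.continuous.comp
        (continuous_const.prodMk (h.continuous_apply x.snd))
    exact h'.congr fun N => Unitization.ext (fst_starMap _ x).symm (snd_starMap _ x).symm
  map_mem N x hx := starMap_mem_addScalars.2 (h.map_mem hr N _ hx)
  star_mem x hx := F.star_mem hr hx
  dense := by
    -- Preimages of dense sets under open maps are dense, so $D+\mathbb C$ is dense in the
    -- unitization.
    have h' : IsOpenMap fun x : Unitization ℂ A => x.snd :=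
      isOpenMap_snd.comp Unitization.uniformEquivProd.toHomeomorph.isOpenMap
    exact (h.dense.preimage h').mono fun x hx => h.eventually_starMap_mem hr hx

lemma IsContracting.exists_forall_mem (h : IsContracting τ F D) {r : ℝ} (hr : 0 < r)
    {n : ℕ} {a : CMat n (Unitization ℂ A)} (ha : ∀ i j, a i j ∈ addScalars D) :
    ∃ N₀ : NNReal, ∀ N ≥ N₀, ∀ i j,
      mapMat (Unitization.starMap (τ N)) a i j ∈ addScalars (F.sub r hr) :=
  eventually_atTop.1 ((entriesIn_absorbed_iff (σ := fun N => Unitization.starMap (τ N)) a).1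
    fun i j => h.eventually_starMap_mem hr (ha i j))

end UnitizationShift

/-! ### The isomorphisms for a filtered C*-algebra with contracting endomorphisms. -/

section ScalarPart

variable {A : Type*} [NonUnitalCStarAlgebra A]

/-- The class `[χ(p)] - [I_ℓ]` lies in `K_0(A)` if and only if `χ(ρ_A(p))` has rank `ℓ`. -/
lemma comparisonK0_mem_iff {ε : ℝ} (hε' : ε < 1 / 4) {S : Submodule ℂ A} {n : ℕ}
    {p : CMat n (Unitization ℂ A)} (hp : p ∈ QP ε S n) (l : ℕ) :
    comparisonK0 p l ∈ K0 A ↔ chiRank (mapMat (scalarPart A) p) = l := by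
  -- Functional calculus commutes with $\rho_A$, which turns membership in the kernel into a
  -- statement about classes over $\mathbb C$.
  have e1 : mapMat (scalarPart A) (spectralProj p) = spectralProj (mapMat (scalarPart A) p) :=
    spectralProj_map (mapMatHom (scalarPart A) n) hp.2.1 (hp.2.2.trans hε')
  have e2 : mapMat (scalarPart A) (1 : CMat l (Unitization ℂ A)) = 1 :=
    map_one (mapMatHom (scalarPart A) l)
  rw [AddMonoidHom.mem_ker, comparisonK0, map_sub, K0Unital.map_cls, K0Unital.map_cls,
    sub_eq_zero]
  simp only [e1, e2]
  exact cls_eq_cls_one_iff _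

/-- The controlled `K_0`-group of a filtered C*-algebra with contracting endomorphisms is
isomorphic to the `K_0`-group, and the inverse isomorphism is given by the endomorphisms. -/
theorem IsContracting.exists_equiv_K0 {τ : NNReal → (A →⋆ₙₐ[ℂ] A)} {F : Filtration A}
    {D : Submodule ℂ A} (h : IsContracting τ F D) {ε r : ℝ} (hε : 0 < ε) (hε' : ε < 1 / 4)
    (hr : 0 < r) :
    ∃ e : CtrlK0 F ε r hε hr ≃+ K0 A,
      (∀ (n : ℕ) (p : CMat n (Unitization ℂ A)) (hp : p ∈ QP ε (F.sub r hr) n) (l : ℕ)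
        (x : CtrlK0 F ε r hε hr), (x : CtrlK0Unitization F ε r hε hr) = .cls hε hr p hp l →
          (e x : K0Unital (Unitization ℂ A)) = comparisonK0 p l) ∧
      ∀ (n : ℕ) (p : CMat n (Unitization ℂ A)), p ∈ QP ε D n →
        (∃ N₀ : NNReal, ∀ N ≥ N₀, mapMat (Unitization.starMap (τ N)) p ∈ QP ε (F.sub r hr) n) ∧
        ∀ (N : NNReal) (hN : mapMat (Unitization.starMap (τ N)) p ∈ QP ε (F.sub r hr) n) (l : ℕ)
          (y : K0 A), (y : K0Unital (Unitization ℂ A)) = comparisonK0 p l →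
            (e.symm y : CtrlK0Unitization F ε r hε hr) =
              .cls hε hr (mapMat (Unitization.starMap (τ N)) p) hN l := by
  have hS := h.isAbsorbing hr
  let Φ := comparisonHom hε hε' (addScalars (F.sub r hr)) (one_mem_addScalars _)
  have hΦ : Function.Bijective Φ := comparisonHom_bijective hS hε hε' (one_mem_addScalars _)
  have hcls : ∀ (n : ℕ) (p : CMat n (Unitization ℂ A)) (hp : p ∈ QP ε (F.sub r hr) n) (l : ℕ),
      Φ (CtrlK0Unitization.cls hε hr p hp l) = comparisonK0 p l := fun n p hp l =>
    comparisonHom_cls hε hε' (one_mem_addScalars _) hp l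
  -- The rank condition cuts out exactly the preimage of the kernel, so the bijection for the
  -- unitization restricts to one for $A$. The equivalence also shows that the condition does not
  -- depend on the representative.
  have hmem : ∀ x, x ∈ CtrlK0 F ε r hε hr ↔ Φ x ∈ K0 A := by
    intro x
    constructor
    · rintro ⟨n, p, hp, l, hl, rfl⟩
      rw [hcls]
      exact (comparisonK0_mem_iff hε' hp l).2 hl
    · obtain ⟨⟨⟨n, p, hp⟩, l⟩⟩ := x
      intro hx
      refine ⟨n, p, hp, l, (comparisonK0_mem_iff hε' hp l).1 ?_, rfl⟩
      rw [← hcls n p hp l]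
      exact hx
  let e : CtrlK0 F ε r hε hr ≃+ K0 A := AddEquiv.ofBijective
    ((Φ.comp (CtrlK0 F ε r hε hr).subtype).codRestrict (K0 A) fun x => (hmem x).1 x.2) (by
      refine ⟨fun x y hxy => Subtype.ext (hΦ.1 (congrArg Subtype.val hxy)), fun y => ?_⟩
      obtain ⟨x, hx⟩ := hΦ.2 y
      exact ⟨⟨x, (hmem x).2 (hx ▸ y.2)⟩, Subtype.ext hx⟩)
  have he : ∀ x, (e x : K0Unital (Unitization ℂ A)) = Φ x := fun x => rfl
  refine ⟨e, fun n p hp l x hx => by rw [he, hx, hcls], fun n p hp => ⟨?_, ?_⟩⟩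
  · obtain ⟨N₀, hN₀⟩ := h.exists_forall_mem hr hp.1
    exact ⟨N₀, fun N hN => ⟨hN₀ N hN, (mapMat_mem_QProj _ hp).2⟩⟩
  · intro N hN l y hy
    -- Both sides have the same image in $K_0(\tilde A)$, because the shift joins $p$ to its
    -- translate through quasi-projections.
    refine hΦ.1 ?_
    rw [← he, AddEquiv.apply_symm_apply, hcls, hy]
    exact congrArg (· - K0Unital.cls (1 : CMat l (Unitization ℂ A)) (IsStarProjection.one _))
      (cls_spectralProj_shift hS.zero_apply hS.continuous_apply hε' hp N).symm

/-- The controlled `K_1`-group of a filtered C*-algebra with contracting endomorphisms is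
isomorphic to the `K_1`-group, and the inverse isomorphism is given by the endomorphisms. -/
theorem IsContracting.exists_equiv_K1 {τ : NNReal → (A →⋆ₙₐ[ℂ] A)} {F : Filtration A}
    {D : Submodule ℂ A} (h : IsContracting τ F D) {ε r : ℝ} (hε : 0 < ε) (hε' : ε < 1 / 3)
    (hε1 : ε ≤ 1) (hr : 0 < r) :
    ∃ e : CtrlK1 F ε r hε hr ≃+ K1 A,
      (∀ (n : ℕ) (u : CMat n (Unitization ℂ A)) (hu : u ∈ QU ε (F.sub r hr) n),
        e (CtrlK1.cls hε hr u hu) = comparisonK1 hε1 u hu) ∧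
      ∀ (n : ℕ) (u : CMat n (Unitization ℂ A)) (hu : u ∈ QU ε D n),
        (∃ N₀ : NNReal, ∀ N ≥ N₀, mapMat (Unitization.starMap (τ N)) u ∈ QU ε (F.sub r hr) n) ∧
        ∀ (N : NNReal) (hN : mapMat (Unitization.starMap (τ N)) u ∈ QU ε (F.sub r hr) n),
          e.symm (comparisonK1 hε1 u hu) =
            CtrlK1.cls hε hr (mapMat (Unitization.starMap (τ N)) u) hN := by
  have hS := h.isAbsorbing hr
  have hS' := h.isAbsorbing (r := 2 * r) (by positivity)
  -- Equality of controlled classes is homotopy at the scale $(3\varepsilon,2r)$, so injectivity is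
  -- needed there; this uses $3\varepsilon<1$.
  let Ψ := (polarPartHom (ε := 3 * ε) (by positivity) (by linarith)
    (addScalars (F.sub (2 * r) (by positivity))) (one_mem_addScalars _)).classesMap
  have hΨ : Function.Injective Ψ := polarPartHom_injective hS' _ _ _
  let e : CtrlK1 F ε r hε hr ≃+ K1 A := AddEquiv.ofBijective
    (Ψ.comp (CtrlK1 F ε r hε hr).subtype) (by
      refine ⟨fun x y hxy => Subtype.ext (hΨ hxy), fun y => ?_⟩
      -- Representatives, in contrast, must be found at the finer scale $(\varepsilon,r)$.
      obtain ⟨n, u, hu, rfl⟩ := exists_cls_polarPart_eq hS hε (by linarith : ε < 1) y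
      exact ⟨CtrlK1.cls hε hr u hu, rfl⟩)
  have he : ∀ (n : ℕ) (u : CMat n (Unitization ℂ A)) (hu : u ∈ QU ε (F.sub r hr) n),
      e (CtrlK1.cls hε hr u hu) = comparisonK1 hε1 u hu := fun n u hu => rfl
  refine ⟨e, he, fun n u hu => ⟨?_, ?_⟩⟩
  · obtain ⟨N₀, hN₀⟩ := h.exists_forall_mem hr hu.1
    exact ⟨N₀, fun N hN => ⟨hN₀ N hN, (mapMat_mem_QUnit _ hu).2⟩⟩
  · intro N hN
    rw [AddEquiv.symm_apply_eq, he]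
    exact (cls_polarPart_shift hS.zero_apply hS.continuous_apply (by linarith : ε < 1) hu N hN).symm

end ScalarPart

/-! ### Application to the localization algebra. -/

section LocalizationShift

variable {X : Type*} [MetricSpace X] [LocallyCompactSpace X]
variable {H : Type*} [NormedAddCommGroup H] [InnerProductSpace ℂ H] [CompleteSpace H]

lemma ShiftInvariant.isContracting {M : AmpleModule X H} {F : Filtration (LocAlg M)}
    (hF : ShiftInvariant F) :
    IsContracting (timeShift M) F (algLocSub M) where
  zero_apply := timeShift_zero
  continuous_apply := continuous_timeShift_apply
  map_mem := hF.map_mem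
  eventually_mem hr _ hf := (eventually_timeShift_mem hr hf).mono fun _ h => hF.le hr h
  dense := dense_algLocSub

end LocalizationShift

end CtrlK

end

open CtrlK in
theorem lemma6p1 {X : Type*} [MetricSpace X] [LocallyCompactSpace X]
    {H : Type*} [NormedAddCommGroup H] [InnerProductSpace ℂ H] [CompleteSpace H]
    [TopologicalSpace.SeparableSpace H] (M : AmpleModule X H)
    (F : Filtration (LocAlg M)) (hF : F = locFiltration M ∨ F = (locFiltration M).closure)
    {ε r : ℝ} (hε : 0 < ε) (hε' : ε < 1 / 8) (hr : 0 < r) :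
    -- The forgetful map `[p, ℓ] ↦ [χ(p)] - [I_ℓ]` is well defined and an isomorphism.
    (∃ e : CtrlK0 F ε r hε hr ≃+ K0 (LocAlg M),
      (∀ (n : ℕ) (p : CMat n (Unitization ℂ (LocAlg M))) (hp : p ∈ QP ε (F.sub r hr) n) (l : ℕ)
        (x : CtrlK0 F ε r hε hr), (x : CtrlK0Unitization F ε r hε hr) = .cls hε hr p hp l →
          (e x : K0Unital (Unitization ℂ (LocAlg M))) = comparisonK0 p l) ∧
      -- The inverse is the shift in time of quasi-projections over the algebraic localization
      -- algebra.
      ∀ (n : ℕ) (p : CMat n (Unitization ℂ (LocAlg M))), p ∈ QP ε (algLocSub M) n →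
        (∃ N₀ : NNReal, ∀ N ≥ N₀, shiftMat N p ∈ QP ε (F.sub r hr) n) ∧
        ∀ (N : NNReal) (hN : shiftMat N p ∈ QP ε (F.sub r hr) n) (l : ℕ) (y : K0 (LocAlg M)),
          (y : K0Unital (Unitization ℂ (LocAlg M))) = comparisonK0 p l →
            (e.symm y : CtrlK0Unitization F ε r hε hr) = .cls hε hr (shiftMat N p) hN l) ∧
    -- The forgetful map `[u] ↦ [u (u* u)^{-1/2}]` is well defined and an isomorphism.
    (∃ e : CtrlK1 F ε r hε hr ≃+ K1 (LocAlg M),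
      (∀ (n : ℕ) (u : CMat n (Unitization ℂ (LocAlg M))) (hu : u ∈ QU ε (F.sub r hr) n),
        e (CtrlK1.cls hε hr u hu) = comparisonK1 (by linarith) u hu) ∧
      -- The inverse is the shift in time of quasi-unitaries over the algebraic localization
      -- algebra.
      ∀ (n : ℕ) (u : CMat n (Unitization ℂ (LocAlg M))) (hu : u ∈ QU ε (algLocSub M) n),
        (∃ N₀ : NNReal, ∀ N ≥ N₀, shiftMat N u ∈ QU ε (F.sub r hr) n) ∧
        ∀ (N : NNReal) (hN : shiftMat N u ∈ QU ε (F.sub r hr) n),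
          e.symm (comparisonK1 (by linarith) u hu) = CtrlK1.cls hε hr (shiftMat N u) hN) := by
  have h := (shiftInvariant_of_eq hF).isContracting
  -- The bound $\varepsilon<\frac18$ supplies $\varepsilon<\frac14$ for the spectral projections and
  -- $\varepsilon<\frac13$ for the unitary parts at the scale $3\varepsilon$.
  exact ⟨h.exists_equiv_K0 hε (by linarith) hr, h.exists_equiv_K1 hε (by linarith) _ hr⟩
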